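/- **Theorem.** For $n\in\mathbb N$ let $H^n=H^{n,2}(\mathbb R)$ be the real Sobolev space of functions in $L^2(\mathbb R)$ whose weak derivatives up to order $n$ belong to $L^2(\mathbb R)$, with norm $\|u\|_{H^n}=\|(1-\partial_x^2)^{n/2}u\|_{L^2}$, i.e. $\|u\|_{H^n}^2=\sum_{k=0}^n\binom nk\|\partial_x^k u\|_{L^2}^2$. Put $X=H^1$, $Y=H^2$, and let $Q=(1-\partial_x^2)^{1/2}$ be the Fourier multiplier which is an isometric isomorphism of $H^2$ onto $H^1$. There is a constant $K>0$ such that the following holds. Let $a:H^1\to H^3$ and $b:H^1\to H^2$ be Lipschitz continuous maps with $\sup_{y\in H^1}\|a(y)\|_{H^3}<\infty$ and $\sup_{y\in H^1}\|b(y)\|_{H^2}<\infty$. For every $y\in H^1$ there is exactly one operator $\mathcal A(y)$ in $H^1$ that is the generator of a one-parameter $C_0$-group in $H^1$, contains $H^2$ in its domain, and satisfies $\mathcal A(y)u=a(y)\,\partial_xu+b(y)\,u$ for $u\in H^2$. Moreover, for every $y\in H^1$ there is a bounded operator $B(y)\in\mathcal L(H^1)$ with $$Q\mathcal A(y)Q^{-1}=\mathcal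 A(y)+B(y),\qquad \|B(y)\|_{\mathcal L(H^1)}\le K\max\bigl(\|\partial_xa(y)\|_{H^2},\|b(y)\|_{H^2}\bigr)$$ (an equality of unbounded operators in $H^1$, including their domains, where $\mathrm{Dom}(Q\mathcal A(y)Q^{-1})=\{x\in H^1:\ Q^{-1}x\in \mathrm{Dom}\,\mathcal A(y),\ \mathcal A(y)Q^{-1}x\in H^2\}$). Finally, for every $R>0$ and every $\tau>0$ the family $A(t,v):=\mathcal A(v)$, $B(t,v):=B(v)$, $t\in I=[-\tau,\tau]$, $v\in Y$, satisfies Kato's condition with radius $R$ for the densely embedded pair of Hilbert spaces $Y\subset X$, that is: 1. for all $v\in Y$, $t\in I$ the operator $-A(t,v)$ generates a $C_0$-semigroup in $X$, and there is $\beta\in\mathbb R$ such that $\|e^{-sA(t,v)}\|_{\mathcal L(X)}\le e^{\beta s}$ for all $s\ge0$, $t\in I$ and $\|v\|_Y\le R$; 2. for all $v\in Y$, $t\in I$ one has $QA(t,v)Q^{-1}=A(t,v)+B(t,v)$ with $B(t,v)\in\mathcal L(X)$, the map $I\ni t\mapsto B(t,v)\in\mathcal L(X)$ is strongly measurable, and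 $\sup_{t\in I}\sup_{\|v\|_Y\le R}\|B(t,v)\|_{\mathcal L(X)}<\infty$; 3. for all $v\in Y$, $t\in I$ one has $A(t,v)\in\mathcal L(Y,X)$, and the map $I\ni t\mapsto A(t,v)\in\mathcal L(Y,X)$ is continuous; 4. there is $\mu\in\mathbb R$ such that $\|(A(t,v_1)-A(t,v_2))u\|_X\le\mu\|v_1-v_2\|_X\|u\|_Y$ for all $t\in I$, $u\in Y$ and $\|v_1\|_Y,\|v_2\|_Y\le R$. -/

import Mathlib

open MeasureTheory Filter Topology
open scoped SchwartzMap FourierTransform InnerProductSpace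

noncomputable section

/-- The real Hilbert space `L²(ℝ)`. -/
abbrev RealL2 : Type := Lp ℝ 2 (volume : Measure ℝ)

/-- `v ∈ L²` is the weak (distributional) derivative of `u ∈ L²`. -/
def HasWeakDeriv (u v : RealL2) : Prop :=
  ∀ φ : 𝓢(ℝ, ℝ), ∫ x, u x * deriv φ x = -∫ x, v x * φ x

theorem hasWeakDeriv_iff_inner (u v : RealL2) :
    HasWeakDeriv u v ↔ ∀ φ : 𝓢(ℝ, ℝ),
      ⟪u, (SchwartzMap.derivCLM ℝ ℝ φ).toLp 2⟫_ℝ = -⟪v, φ.toLp 2⟫_ℝ := by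
  have key : ∀ (w : RealL2) (ψ : 𝓢(ℝ, ℝ)), ⟪w, ψ.toLp 2⟫_ℝ = ∫ x, w x * ψ x := by
    intro w ψ
    rw [L2.inner_def]
    refine integral_congr_ae ?_
    filter_upwards [ψ.coeFn_toLp 2] with x hx
    rw [hx]
    simp [mul_comm]
  simp only [HasWeakDeriv, key, SchwartzMap.derivCLM_apply]

theorem HasWeakDeriv.unique {u v w : RealL2} (hv : HasWeakDeriv u v) (hw : HasWeakDeriv u w) :
    v = w := by
  rw [hasWeakDeriv_iff_inner] at hv hw
  have hd : DenseRange (SchwartzMap.toLpCLM ℝ (E := ℝ) ℝ 2 volume) :=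
    SchwartzMap.denseRange_toLpCLM ENNReal.ofNat_ne_top
  rw [← sub_eq_zero]
  refine hd.eq_zero_of_inner_left ℝ (x := v - w) ?_
  intro φ
  have h1 := hv φ
  have h2 := hw φ
  rw [inner_sub_left]
  simp only [SchwartzMap.toLpCLM_apply]
  linarith

theorem HasWeakDeriv.add {u u₁ v v₁ : RealL2} (hu : HasWeakDeriv u u₁) (hv : HasWeakDeriv v v₁) :
    HasWeakDeriv (u + v) (u₁ + v₁) := by
  rw [hasWeakDeriv_iff_inner] at *
  intro φ
  rw [inner_add_left, inner_add_left, hu, hv]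
  ring

theorem HasWeakDeriv.smul {u u₁ : RealL2} (c : ℝ) (hu : HasWeakDeriv u u₁) :
    HasWeakDeriv (c • u) (c • u₁) := by
  rw [hasWeakDeriv_iff_inner] at *
  intro φ
  rw [real_inner_smul_left, real_inner_smul_left, hu]
  ring

theorem hasWeakDeriv_zero : HasWeakDeriv 0 0 := by
  rw [hasWeakDeriv_iff_inner]
  simp

open Classical in
/-- The weak derivative of `u ∈ L²`, if it exists in `L²` (and `0` otherwise). -/
def weakDeriv (u : RealL2) : RealL2 :=
  if h : ∃ v, HasWeakDeriv u v then h.choose else 0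

theorem HasWeakDeriv.weakDeriv_eq {u v : RealL2} (h : HasWeakDeriv u v) : weakDeriv u = v := by
  have h' : ∃ v, HasWeakDeriv u v := ⟨v, h⟩
  rw [weakDeriv, dif_pos h']
  exact h'.choose_spec.unique h

/-- `u ∈ L²` has `L²` weak derivatives up to order `n`. -/
def MemSobolevSpace (n : ℕ) (u : RealL2) : Prop :=
  ∀ k < n, HasWeakDeriv (weakDeriv^[k] u) (weakDeriv^[k + 1] u)

theorem MemSobolevSpace.iterate_add {n : ℕ} {u v : RealL2} (hu : MemSobolevSpace n u)
    (hv : MemSobolevSpace n v) :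
    ∀ k ≤ n, weakDeriv^[k] (u + v) = weakDeriv^[k] u + weakDeriv^[k] v
  | 0, _ => rfl
  | k + 1, hk => by
    rw [Function.iterate_succ_apply', MemSobolevSpace.iterate_add hu hv k (by omega)]
    exact ((hu k (by omega)).add (hv k (by omega))).weakDeriv_eq

theorem MemSobolevSpace.iterate_smul {n : ℕ} {u : RealL2} (c : ℝ) (hu : MemSobolevSpace n u) :
    ∀ k ≤ n, weakDeriv^[k] (c • u) = c • weakDeriv^[k] u
  | 0, _ => rfl
  | k + 1, hk => by
    rw [Function.iterate_succ_apply', MemSobolevSpace.iterate_smul c hu k (by omega)]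
    exact ((hu k (by omega)).smul c).weakDeriv_eq

theorem weakDeriv_iterate_zero (k : ℕ) : weakDeriv^[k] 0 = 0 :=
  Function.iterate_fixed hasWeakDeriv_zero.weakDeriv_eq k

/-- `Hⁿ(ℝ)` as a subspace of `L²(ℝ)`. -/
def sobolevSubmodule (n : ℕ) : Submodule ℝ RealL2 where
  carrier := {u | MemSobolevSpace n u}
  add_mem' := by
    intro u v hu hv k hk
    rw [MemSobolevSpace.iterate_add hu hv k hk.le, MemSobolevSpace.iterate_add hu hv (k + 1) hk]
    exact (hu k hk).add (hv k hk)
  zero_mem' := by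
    intro k _
    rw [weakDeriv_iterate_zero, weakDeriv_iterate_zero]
    exact hasWeakDeriv_zero
  smul_mem' := by
    intro c u hu k hk
    rw [MemSobolevSpace.iterate_smul c hu k hk.le, MemSobolevSpace.iterate_smul c hu (k + 1) hk]
    exact (hu k hk).smul c

/-- The real Sobolev space `Hⁿ(ℝ) = H^{n,2}(ℝ)`. It is a type of its own, since its norm is not
the one inherited from `L²`. -/
def SobolevSpace (n : ℕ) : Type := sobolevSubmodule n

namespace SobolevSpace

variable {n : ℕ}

instance : AddCommGroup (SobolevSpace n) := inferInstanceAs (AddCommGroup (sobolevSubmodule n))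

instance : Module ℝ (SobolevSpace n) := inferInstanceAs (Module ℝ (sobolevSubmodule n))

/-- The underlying `L²` function. -/
def toL2 : SobolevSpace n →ₗ[ℝ] RealL2 := (sobolevSubmodule n).subtype

theorem mem (u : SobolevSpace n) : MemSobolevSpace n u.toL2 := Subtype.property u

theorem toL2_injective : Function.Injective (toL2 (n := n)) := Subtype.val_injective

/-- The inner product `⟪u, v⟫ = ∑ₖ (n choose k) ∫ ∂ᵏu ∂ᵏv`, that is,
`⟪(1 - ∂²)^{n/2} u, (1 - ∂²)^{n/2} v⟫` in `L²`. -/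
@[reducible]
def innerCore (n : ℕ) : InnerProductSpace.Core ℝ (SobolevSpace n) where
  inner u v := ∑ k ∈ Finset.range (n + 1),
    (n.choose k : ℝ) * ⟪weakDeriv^[k] u.toL2, weakDeriv^[k] v.toL2⟫_ℝ
  conj_inner_symm u v := by
    simp [real_inner_comm]
  re_inner_nonneg u := by
    rw [RCLike.re_to_real]
    refine Finset.sum_nonneg fun k _ => mul_nonneg (Nat.cast_nonneg _)
      (real_inner_self_nonneg (x := weakDeriv^[k] u.toL2))
  add_left u v w := by
    rw [← Finset.sum_add_distrib]
    refine Finset.sum_congr rfl fun k hk => ?_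
    rw [map_add, u.mem.iterate_add v.mem k (by simpa [Nat.lt_succ_iff] using hk),
      inner_add_left]
    ring
  smul_left u v c := by
    rw [Finset.mul_sum]
    refine Finset.sum_congr rfl fun k hk => ?_
    rw [map_smul, u.mem.iterate_smul c k (by simpa [Nat.lt_succ_iff] using hk),
      real_inner_smul_left]
    simp only [conj_trivial]
    ring
  definite u hu := by
    have h := (Finset.sum_eq_zero_iff_of_nonneg fun k _ =>
      mul_nonneg (Nat.cast_nonneg (n.choose k))
        (real_inner_self_nonneg (x := weakDeriv^[k] u.toL2))).1 hu 0 (by simp)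
    apply toL2_injective
    simpa using h

instance : NormedAddCommGroup (SobolevSpace n) := (innerCore n).toNormedAddCommGroup

instance : InnerProductSpace ℝ (SobolevSpace n) := .ofCore (innerCore n).toCore

theorem inner_eq (u v : SobolevSpace n) : ⟪u, v⟫_ℝ = ∑ k ∈ Finset.range (n + 1),
    (n.choose k : ℝ) * ⟪weakDeriv^[k] u.toL2, weakDeriv^[k] v.toL2⟫_ℝ := rfl

theorem norm_sq_eq (u : SobolevSpace n) : ‖u‖ ^ 2 = ∑ k ∈ Finset.range (n + 1),
    (n.choose k : ℝ) * ‖weakDeriv^[k] u.toL2‖ ^ 2 := by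
  rw [← real_inner_self_eq_norm_sq, inner_eq]
  simp only [real_inner_self_eq_norm_sq]

theorem norm_iterate_le (u : SobolevSpace n) {k : ℕ} (hk : k ≤ n) :
    ‖weakDeriv^[k] u.toL2‖ ≤ ‖u‖ := by
  refine le_of_sq_le_sq ?_ (norm_nonneg _)
  rw [norm_sq_eq]
  have h1 : (1 : ℝ) ≤ n.choose k := by exact_mod_cast Nat.choose_pos hk
  calc ‖weakDeriv^[k] u.toL2‖ ^ 2 ≤ (n.choose k : ℝ) * ‖weakDeriv^[k] u.toL2‖ ^ 2 :=
        le_mul_of_one_le_left (by positivity) h1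
    _ ≤ _ := Finset.single_le_sum
        (f := fun k => (n.choose k : ℝ) * ‖weakDeriv^[k] u.toL2‖ ^ 2)
        (fun k _ => by positivity) (Finset.mem_range.2 (by omega))

theorem iterate_sub (u v : SobolevSpace n) {k : ℕ} (hk : k ≤ n) :
    weakDeriv^[k] (u - v).toL2 = weakDeriv^[k] u.toL2 - weakDeriv^[k] v.toL2 := by
  have h := (u - v).mem.iterate_add v.mem k hk
  rw [← map_add, sub_add_cancel] at h
  rw [h, add_sub_cancel_right]

instance : CompleteSpace (SobolevSpace n) := by
  refine Metric.complete_of_cauchySeq_tendsto fun u hu => ?_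
  have hc : ∀ k ≤ n, ∃ w, Tendsto (fun m => weakDeriv^[k] (u m).toL2) atTop (𝓝 w) := by
    intro k hk
    refine cauchySeq_tendsto_of_complete ?_
    rw [Metric.cauchySeq_iff'] at hu ⊢
    intro ε hε
    obtain ⟨N, hN⟩ := hu ε hε
    refine ⟨N, fun m hm => lt_of_le_of_lt ?_ (hN m hm)⟩
    rw [dist_eq_norm, dist_eq_norm, ← iterate_sub _ _ hk]
    exact norm_iterate_le _ hk
  choose! w hw using hc
  have hd : ∀ k < n, HasWeakDeriv (w k) (w (k + 1)) := by
    intro k hk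
    rw [hasWeakDeriv_iff_inner]
    intro φ
    refine tendsto_nhds_unique (((hw k hk.le).inner tendsto_const_nhds)) ?_
    have h2 := ((hw (k + 1) hk).inner (𝕜 := ℝ)
      (tendsto_const_nhds (x := φ.toLp 2))).neg
    refine h2.congr fun m => ?_
    exact ((hasWeakDeriv_iff_inner _ _).1 ((u m).mem k hk) φ).symm
  have hit : ∀ k ≤ n, weakDeriv^[k] (w 0) = w k := by
    intro k
    induction k with
    | zero => intro _; rfl
    | succ k ih =>
      intro hk
      rw [Function.iterate_succ_apply', ih (by omega)]
      exact (hd k hk).weakDeriv_eq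
  have hmem : MemSobolevSpace n (w 0) := by
    intro k hk
    rw [hit k hk.le, hit (k + 1) hk]
    exact hd k hk
  let v : SobolevSpace n := ⟨w 0, hmem⟩
  refine ⟨v, ?_⟩
  rw [tendsto_iff_norm_sub_tendsto_zero]
  have hsq : Tendsto (fun m => ‖u m - v‖ ^ 2) atTop (𝓝 0) := by
    simp only [norm_sq_eq]
    rw [show (0 : ℝ) = ∑ k ∈ Finset.range (n + 1), (n.choose k : ℝ) * 0 ^ 2 by simp]
    refine tendsto_finsetSum _ fun k hk => ?_
    have hk' : k ≤ n := by simpa [Nat.lt_succ_iff] using hk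
    refine Tendsto.const_mul _ (Tendsto.pow ?_ 2)
    simp only [iterate_sub _ _ hk']
    have hv : weakDeriv^[k] v.toL2 = w k := hit k hk'
    rw [hv]
    exact tendsto_iff_norm_sub_tendsto_zero.1 (hw k hk')
  have := hsq.sqrt
  simpa [Real.sqrt_sq (norm_nonneg _)] using this

/-- The embedding `H^{n+1} ⊂ Hⁿ`. -/
def incl : SobolevSpace (n + 1) →L[ℝ] SobolevSpace n :=
  LinearMap.mkContinuous
    (Submodule.inclusion (p := sobolevSubmodule (n + 1)) (p' := sobolevSubmodule n)
      fun _ hu k hk => hu k (Nat.lt_succ_of_lt hk) :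
        SobolevSpace (n + 1) →ₗ[ℝ] SobolevSpace n) 1 <| by
    intro u
    rw [one_mul]
    refine le_of_sq_le_sq ?_ (norm_nonneg _)
    rw [norm_sq_eq, norm_sq_eq, Finset.sum_range_succ _ (n + 1)]
    refine le_add_of_le_of_nonneg (Finset.sum_le_sum fun k _ => ?_) (by positivity)
    refine mul_le_mul_of_nonneg_right ?_ (by positivity)
    exact_mod_cast Nat.choose_le_choose k (Nat.le_succ n)

/-- The derivative `∂ₓ : H^{n+1} → Hⁿ`. -/
def deriv (u : SobolevSpace (n + 1)) : SobolevSpace n :=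
  ⟨weakDeriv u.toL2, fun k hk => u.mem (k + 1) (Nat.succ_lt_succ hk)⟩

/-- The Fourier transform of `u ∈ Hⁿ` (normalized with the kernel `e^{-2πixξ}`). -/
def fourier (u : SobolevSpace n) : Lp ℂ 2 (volume : Measure ℝ) :=
  𝓕 (Complex.ofRealCLM.compLp u.toL2)

end SobolevSpace

/-- `Q = (1 - ∂ₓ²)^{1/2}` on `H^{n+1}`: the Fourier multiplier with symbol
`(1 + (2πξ)²)^{1/2}`. -/
def IsSqrtOneSubDerivSq {n : ℕ} (Q : SobolevSpace (n + 1) → SobolevSpace n) : Prop :=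
  ∀ u, (Q u).fourier =ᵐ[volume]
    fun ξ : ℝ => (Real.sqrt (1 + (2 * Real.pi * ξ) ^ 2) : ℂ) * u.fourier ξ

section Semigroups

variable {X : Type*} [NormedAddCommGroup X] [NormedSpace ℝ X]

/-- `S s`, `s ≥ 0`, is a `C₀`-semigroup of bounded operators on `X`. -/
structure IsC0Semigroup (S : ℝ → X →L[ℝ] X) : Prop where
  zero : S 0 = ContinuousLinearMap.id ℝ X
  add : ∀ s t, 0 ≤ s → 0 ≤ t → S (s + t) = (S s).comp (S t)
  continuousOn : ∀ x, ContinuousOn (fun s => S s x) (Set.Ici 0)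

/-- `G` is the generator of the semigroup `S`: `G x = lim_{s → 0+} (S s x - x) / s`, with the
domain consisting of all `x` for which the limit exists. -/
def IsGeneratorOfSemigroup (G : X →ₗ.[ℝ] X) (S : ℝ → X →L[ℝ] X) : Prop :=
  ∀ x z, (x, z) ∈ G.graph ↔ Tendsto (fun s : ℝ => s⁻¹ • (S s x - x)) (𝓝[>] 0) (𝓝 z)

/-- `U t`, `t ∈ ℝ`, is a one-parameter `C₀`-group of bounded operators on `X`. -/
structure IsC0Group (U : ℝ → X →L[ℝ] X) : Prop where
  zero : U 0 = ContinuousLinearMap.id ℝ X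
  add : ∀ s t, U (s + t) = (U s).comp (U t)
  continuous : ∀ x, Continuous fun t => U t x

/-- `G` is the generator of the one-parameter group `U`. -/
def IsGeneratorOfGroup (G : X →ₗ.[ℝ] X) (U : ℝ → X →L[ℝ] X) : Prop :=
  ∀ x z, (x, z) ∈ G.graph ↔ Tendsto (fun t : ℝ => t⁻¹ • (U t x - x)) (𝓝[≠] 0) (𝓝 z)

end Semigroups

section Kato

variable {X Y : Type*} [NormedAddCommGroup X] [InnerProductSpace ℝ X] [CompleteSpace X]
  [NormedAddCommGroup Y] [InnerProductSpace ℝ Y] [CompleteSpace Y]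

/-- The equality `Q A Q⁻¹ = A + B` of unbounded operators in `X`, including equality of the
domains, where `Y ⊂ X` through `ι`. The domain of `Q A Q⁻¹` consists of all `x ∈ X` with
`Q⁻¹ x ∈ Dom A` and `A Q⁻¹ x ∈ Y`. -/
def ConjugationIdentity (ι : Y →L[ℝ] X) (Q : Y ≃L[ℝ] X) (A : X →ₗ.[ℝ] X) (B : X →L[ℝ] X) : Prop :=
  ∀ x z, (∃ w : Y, (ι (Q.symm x), ι w) ∈ A.graph ∧ Q w = z) ↔
    ∃ g, (x, g) ∈ A.graph ∧ g + B x = z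

/-- Kato's condition, with radius `R`, for the operators `A t v`, `t ∈ I`, `v ∈ Y`, in `X`,
where the Hilbert space `Y` is densely embedded into the Hilbert space `X` through `ι`,
with the isomorphism `Q : Y → X` and the bounded operators `B t v`. -/
structure KatoCondition (ι : Y →L[ℝ] X) (I : Set ℝ) (R : ℝ) (A : ℝ → Y → X →ₗ.[ℝ] X)
    (Q : Y ≃L[ℝ] X) (B : ℝ → Y → X →L[ℝ] X) : Prop where
  injective : Function.Injective ι
  denseRange : DenseRange ι
  /-- `-A t v` generates a `C₀`-semigroup, with `‖e^{-s A t v}‖ ≤ e^{β s}` for `‖v‖ ≤ R`. -/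
  generates : ∃ S : ℝ → Y → ℝ → X →L[ℝ] X,
    (∀ t ∈ I, ∀ v, IsC0Semigroup (S t v) ∧ IsGeneratorOfSemigroup (-A t v) (S t v)) ∧
    ∃ β : ℝ, ∀ t ∈ I, ∀ v, ‖v‖ ≤ R → ∀ s, 0 ≤ s → ‖S t v s‖ ≤ Real.exp (β * s)
  conjugation : ∀ t ∈ I, ∀ v, ConjugationIdentity ι Q (A t v) (B t v)
  stronglyMeasurable : ∀ v, StronglyMeasurable fun t : I => B t v
  bounded : ∃ lam : ℝ, ∀ t ∈ I, ∀ v, ‖v‖ ≤ R → ‖B t v‖ ≤ lam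
  /-- `A t v` restricts to a bounded operator from `Y` to `X`, continuous in `t`. -/
  continuous : ∀ v, ∃ A' : ℝ → Y →L[ℝ] X,
    (∀ t ∈ I, ∀ u, (ι u, A' t u) ∈ (A t v).graph) ∧ ContinuousOn A' I
  /-- `‖(A t v₁ - A t v₂) u‖_X ≤ μ ‖v₁ - v₂‖_X ‖u‖_Y`. -/
  lipschitz : ∃ μ : ℝ, ∀ t ∈ I, ∀ u v₁ v₂ : Y, ‖v₁‖ ≤ R → ‖v₂‖ ≤ R →
    ∀ f₁ f₂ : X, (ι u, f₁) ∈ (A t v₁).graph → (ι u, f₂) ∈ (A t v₂).graph →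
      ‖f₁ - f₂‖ ≤ μ * ‖ι v₁ - ι v₂‖ * ‖u‖

end Kato

/-- `G` is an operator in `H¹` that generates a one-parameter `C₀`-group, contains `H²` in its
domain and coincides there with the differential operator `a ∂ₓ + b`. -/
def IsFirstOrderGenerator (a : SobolevSpace 3) (b : SobolevSpace 2)
    (G : SobolevSpace 1 →ₗ.[ℝ] SobolevSpace 1) : Prop :=
  (∃ U : ℝ → SobolevSpace 1 →L[ℝ] SobolevSpace 1, IsC0Group U ∧ IsGeneratorOfGroup G U) ∧
  ∀ u : SobolevSpace 2, ∃ f : SobolevSpace 1, (SobolevSpace.incl u, f) ∈ G.graph ∧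
    f.toL2 =ᵐ[volume] fun x : ℝ => a.toL2 x * u.deriv.toL2 x + b.toL2 x * u.toL2 x

end

/-!
In conjugating `a ∂ₓ + b` by `Q = (1 - ∂ₓ²)^{1/2}`, the only error is the commutator with `Q` of
multiplication by `c ∈ {a, b}`. In Fourier variables, with `m(ξ) = (1 + (2πξ)²)^{-1/2}`, the kernel
of the commutator with `Q⁻¹` is `ĉ(s - t) (m(t) - m(s))`, and the bound
`|m(t) - m(s)| ≤ |2π(s - t)| m(t) m(s)` turns the difference into a derivative of `c`; as `m` is
square integrable, this yields a bounded operator `B` on `H¹` with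
`Q(a ∂ₓ + b)Q⁻¹ = a ∂ₓ + b + B`.

Integration by parts bounds the symmetric part of `a ∂ₓ + b` in `H¹`. If `v` is orthogonal to the
range of `r - (a ∂ₓ + b)`, testing against `Q⁻² v` and using the conjugation shows `v = 0` for large
`|r|`. Hence the closure of `a ∂ₓ + b` has two-sided resolvents and generates a group, the limit of
the exponentials of the average of the Yosida approximations for `r` and `-r`. No proper extension
of the closure can be a generator, since the resolvent is already onto; this gives uniqueness, and
the same argument with `A + B` in place of `A` matches the domains in `QAQ⁻¹ = A + B`.
-/

noncomputable section

/-! ### Groups of operators and their generators -/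

section Limits

variable {𝕜 : Type*} [NontriviallyNormedField 𝕜]

section Deriv

variable {E : Type*} [NormedAddCommGroup E] [NormedSpace 𝕜 E]

theorem hasDerivAt_comp_neg_iff {f : 𝕜 → E} {f' : E} {t : 𝕜} :
    HasDerivAt (fun s => f (-s)) f' t ↔ HasDerivAt f (-f') (-t) := by
  refine ⟨fun h => ?_, fun h => ?_⟩
  · rw [← neg_neg t, ← zero_sub (-t)] at h
    simpa using h.comp_const_sub 0 (-t)
  · rw [← zero_sub t] at h
    simpa using h.comp_const_sub 0 t

theorem hasDerivAt_of_tendsto_of_norm_sub_le {κ : Type*} {l : Filter κ} [l.NeBot] {f : κ → 𝕜 → E}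
    {f' : κ → E} {g : 𝕜 → E} {g' : E} {c : κ → ℝ} {t₀ : 𝕜}
    (hf : ∀ n, HasDerivAt (f n) (f' n) t₀) (hf' : Tendsto f' l (𝓝 g')) (hc : Tendsto c l (𝓝 0))
    (hfg : ∀ n, ∀ᶠ t in 𝓝 t₀, ‖(f n t - f n t₀) - (g t - g t₀)‖ ≤ c n * ‖t - t₀‖) :
    HasDerivAt g g' t₀ := by
  rw [hasDerivAt_iff_isLittleO, Asymptotics.isLittleO_iff]
  intro ε hε
  have hsum : Tendsto (fun n => c n + ‖f' n - g'‖) l (𝓝 0) := by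
    simpa using hc.add (tendsto_iff_norm_sub_tendsto_zero.1 hf')
  obtain ⟨n, hn⟩ := (hsum.eventually_lt_const (half_pos hε)).exists
  have hfn := (Asymptotics.isLittleO_iff.1 (hasDerivAt_iff_isLittleO.1 (hf n))) (half_pos hε)
  filter_upwards [hfn, hfg n] with t hft hgt
  have hsplit : g t - g t₀ - (t - t₀) • g' = (f n t - f n t₀ - (t - t₀) • f' n) +
      (t - t₀) • (f' n - g') - ((f n t - f n t₀) - (g t - g t₀)) := by
    rw [smul_sub]
    abel
  calc ‖g t - g t₀ - (t - t₀) • g'‖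
      ≤ ‖f n t - f n t₀ - (t - t₀) • f' n‖ + ‖(t - t₀) • (f' n - g')‖ +
          ‖(f n t - f n t₀) - (g t - g t₀)‖ := by
        rw [hsplit]
        exact (norm_sub_le _ _).trans (by gcongr; exact norm_add_le _ _)
    _ ≤ ε / 2 * ‖t - t₀‖ + ‖t - t₀‖ * ‖f' n - g'‖ + c n * ‖t - t₀‖ := by
        rw [norm_smul]
        gcongr
    _ = (c n + ‖f' n - g'‖ + ε / 2) * ‖t - t₀‖ := by ring
    _ ≤ ε * ‖t - t₀‖ := by
        gcongr
        linarith

end Deriv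

variable {E F : Type*} [SeminormedAddCommGroup E] [NormedSpace 𝕜 E] [SeminormedAddCommGroup F]
  [NormedSpace 𝕜 F]

theorem tendsto_apply_of_norm_le {κ : Type*} {l : Filter κ} {T : κ → E →L[𝕜] F} {C : ℝ}
    (hT : ∀ᶠ i in l, ‖T i‖ ≤ C) {v : κ → E} {x : E} (hv : Tendsto v l (𝓝 x)) {y : F}
    (hTx : Tendsto (fun i => T i x) l (𝓝 y)) : Tendsto (fun i => T i (v i)) l (𝓝 y) := by
  have hsub : Tendsto (fun i => T i (v i - x)) l (𝓝 0) := by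
    have hbound := (tendsto_iff_norm_sub_tendsto_zero.1 hv).const_mul C
    rw [mul_zero] at hbound
    exact squeeze_zero_norm' (hT.mono fun i hi => (T i).le_of_opNorm_le hi _) hbound
  simpa using hsub.add hTx

theorem tendsto_apply_of_norm_le_of_dense {κ : Type*} {l : Filter κ} {T : κ → E →L[𝕜] F}
    {L : E →L[𝕜] F} {C : ℝ} (hT : ∀ᶠ i in l, ‖T i‖ ≤ C) {s : Set E} (hs : Dense s)
    (h : ∀ x ∈ s, Tendsto (fun i => T i x) l (𝓝 (L x))) (x : E) :
    Tendsto (fun i => T i x) l (𝓝 (L x)) := by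
  rw [Metric.tendsto_nhds]
  intro ε hε
  have hpos : 0 < |C| + ‖L‖ + 1 := by positivity
  obtain ⟨y, hys, hy⟩ := hs.exists_dist_lt x (half_pos (div_pos hε hpos))
  have hxy : (|C| + ‖L‖ + 1) * ‖x - y‖ < ε / 2 := by
    rw [dist_eq_norm, div_right_comm, lt_div_iff₀ hpos] at hy
    linarith
  filter_upwards [hT, Metric.tendsto_nhds.1 (h y hys) (ε / 2) (half_pos hε)] with i hi hiy
  rw [dist_eq_norm] at hiy ⊢
  have hTi : ‖T i (x - y)‖ ≤ |C| * ‖x - y‖ := (T i).le_of_opNorm_le (hi.trans (le_abs_self C)) _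
  calc ‖T i x - L x‖ = ‖T i (x - y) + (T i y - L y) - L (x - y)‖ := by
        rw [map_sub, map_sub]
        congr 1
        abel
    _ ≤ ‖T i (x - y)‖ + ‖T i y - L y‖ + ‖L (x - y)‖ :=
        (norm_sub_le _ _).trans (by gcongr; exact norm_add_le _ _)
    _ < ε := by linarith [L.le_opNorm (x - y), norm_nonneg (x - y)]

theorem exists_norm_le_of_isCompact_of_continuousOn_apply [CompleteSpace E]
    {S : Type*} [TopologicalSpace S] {K : Set S} (hK : IsCompact K) {U : S → E →L[𝕜] F}
    (hU : ∀ x, ContinuousOn (fun s => U s x) K) : ∃ M, ∀ s ∈ K, ‖U s‖ ≤ M := by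
  obtain ⟨M, hM⟩ := banach_steinhaus (g := fun s : K => U s) fun x => by
    obtain ⟨C, hC⟩ := hK.exists_bound_of_continuousOn (hU x)
    exact ⟨C, fun s => hC s s.2⟩
  exact ⟨M, fun s hs => hM ⟨s, hs⟩⟩

end Limits

section Groups

variable {X : Type*} [NormedAddCommGroup X] [NormedSpace ℝ X] {U : ℝ → X →L[ℝ] X} {x z : X}

theorem hasDerivAt_zero_iff_tendsto (h : U 0 = ContinuousLinearMap.id ℝ X) (x z : X) :
    HasDerivAt (fun t => U t x) z 0 ↔
      Tendsto (fun t : ℝ => t⁻¹ • (U t x - x)) (𝓝[≠] 0) (𝓝 z) := by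
  have hslope : slope (fun t => U t x) 0 = fun t : ℝ => t⁻¹ • (U t x - x) := by
    ext t
    simp [slope_def_module, h]
  rw [hasDerivAt_iff_tendsto_slope, hslope]

theorem isC0Group_of_dense (hzero : U 0 = ContinuousLinearMap.id ℝ X)
    (hadd : ∀ s t, U (s + t) = (U s).comp (U t)) {C : ℝ} (hbound : ∀ᶠ t in 𝓝 0, ‖U t‖ ≤ C)
    {D : Set X} (hD : Dense D) (hcont : ∀ x ∈ D, ContinuousAt (fun t => U t x) 0) :
    IsC0Group U := by
  refine ⟨hzero, hadd, fun x => continuous_iff_continuousAt.2 fun t => ?_⟩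
  have hat_zero : Tendsto (fun s => U s x) (𝓝 0) (𝓝 (U 0 x)) :=
    tendsto_apply_of_norm_le_of_dense hbound hD hcont x
  have hshift : Tendsto (fun s : ℝ => s - t) (𝓝 t) (𝓝 0) :=
    (continuous_sub_right t).tendsto' t 0 (sub_self t)
  have hlim := ((U t).continuous.tendsto _).comp (hat_zero.comp hshift)
  simpa [ContinuousAt, Function.comp_def, ← ContinuousLinearMap.comp_apply, ← hadd] using hlim

namespace IsC0Group

theorem apply_apply (hU : IsC0Group U) (s t : ℝ) (x : X) : U s (U t x) = U (s + t) x := by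
  rw [hU.add, ContinuousLinearMap.comp_apply]

theorem isGeneratorOfGroup_iff (hU : IsC0Group U) {G : X →ₗ.[ℝ] X} :
    IsGeneratorOfGroup G U ↔ ∀ x z, (x, z) ∈ G.graph ↔ HasDerivAt (fun t => U t x) z 0 := by
  simp only [hasDerivAt_zero_iff_tendsto hU.zero, IsGeneratorOfGroup]

theorem hasDerivAt (hU : IsC0Group U) (h : HasDerivAt (fun s => U s x) z 0) (t : ℝ) :
    HasDerivAt (fun s => U s x) (U t z) t := by
  rw [← sub_self t] at h
  have hshift := (U t).hasFDerivAt.comp_hasDerivAt t (h.comp_sub_const t t)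
  simpa [Function.comp_def, hU.apply_apply] using hshift

theorem comp_neg (hU : IsC0Group U) : IsC0Group fun t => U (-t) where
  zero := by rw [neg_zero, hU.zero]
  add s t := by rw [neg_add, hU.add]
  continuous x := (hU.continuous x).comp continuous_neg

theorem isC0Semigroup (hU : IsC0Group U) : IsC0Semigroup U where
  zero := hU.zero
  add s t _ _ := hU.add s t
  continuousOn x := (hU.continuous x).continuousOn

theorem exists_norm_le [CompleteSpace X] (hU : IsC0Group U) (T : ℝ) :
    ∃ M, ∀ s ∈ Set.Icc (-T) T, ‖U s‖ ≤ M :=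
  exists_norm_le_of_isCompact_of_continuousOn_apply isCompact_Icc
    fun x => (hU.continuous x).continuousOn

theorem norm_apply_sub_le (hU : IsC0Group U) {T M : ℝ} (hM : ∀ s ∈ Set.Icc (-T) T, ‖U s‖ ≤ M)
    (h : HasDerivAt (fun s => U s x) z 0) {t : ℝ} (ht : t ∈ Set.Icc (-T) T) :
    ‖U t x - x‖ ≤ M * ‖z‖ * |t| := by
  have h0 : (0 : ℝ) ∈ Set.Icc (-T) T := by
    constructor <;> linarith [ht.1, ht.2]
  have hmean := (convex_Icc (-T) T).norm_image_sub_le_of_norm_hasDerivWithin_le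
    (fun s _ => (hU.hasDerivAt h s).hasDerivWithinAt)
    (fun s hs => (U s).le_of_opNorm_le (hM s hs) z) h0 ht
  simpa [hU.zero] using hmean

theorem isClosed_setOf_hasDerivAt [CompleteSpace X] (hU : IsC0Group U) :
    IsClosed {p : X × X | HasDerivAt (fun t => U t p.1) p.2 0} := by
  refine IsSeqClosed.isClosed fun p q hp hpq => ?_
  obtain ⟨M, hM⟩ := hU.exists_norm_le 1
  have hfst : Tendsto (fun n => (p n).1) atTop (𝓝 q.1) := (continuous_fst.tendsto q).comp hpq
  have hsnd : Tendsto (fun n => (p n).2) atTop (𝓝 q.2) := (continuous_snd.tendsto q).comp hpq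
  refine hasDerivAt_of_tendsto_of_norm_sub_le (l := atTop) (c := fun n => M * ‖(p n).2 - q.2‖)
    hp hsnd (by simpa using (tendsto_iff_norm_sub_tendsto_zero.1 hsnd).const_mul M) fun n => ?_
  filter_upwards [Icc_mem_nhds (neg_one_lt_zero (R := ℝ)) zero_lt_one] with t ht
  have hpair : ∀ m, ‖(U t (p n).1 - (p n).1) - (U t (p m).1 - (p m).1)‖ ≤
      M * ‖(p n).2 - (p m).2‖ * |t| := by
    intro m
    have hnm : HasDerivAt (fun s => U s ((p n).1 - (p m).1)) ((p n).2 - (p m).2) 0 := by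
      simpa only [map_sub] using (hp n).fun_sub (hp m)
    have hdiff := hU.norm_apply_sub_le hM hnm ht
    rwa [map_sub, sub_sub_sub_comm] at hdiff
  have hlim := le_of_tendsto_of_tendsto'
    (tendsto_const_nhds.sub ((((U t).continuous.tendsto q.1).comp hfst).sub hfst)).norm
    (((tendsto_const_nhds.sub hsnd).norm.const_mul M).mul_const |t|) hpair
  simpa [hU.zero] using hlim

theorem eq_zero_of_hasDerivAt_smul (hU : IsC0Group U) {r : ℝ} (hr : ‖U 1‖ < Real.exp r)
    (h : HasDerivAt (fun t => U t x) (r • x) 0) : x = 0 := by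
  have hderiv : ∀ t, HasDerivAt (fun s => Real.exp (-(r * s)) • U s x) 0 t := by
    intro t
    have hexp : HasDerivAt (fun s => Real.exp (-(r * s))) (Real.exp (-(r * t)) * -(r * 1)) t :=
      ((hasDerivAt_id t).const_mul r).neg.exp
    refine (hexp.smul (hU.hasDerivAt h t)).congr_deriv ?_
    rw [map_smul]
    module
  have hconst : Real.exp (-r) • U 1 x = x := by
    simpa [hU.zero] using is_const_of_deriv_eq_zero (fun t => (hderiv t).differentiableAt)
      (fun t => (hderiv t).deriv) 1 0
  rw [Real.exp_neg, inv_smul_eq_iff₀ (Real.exp_ne_zero r)] at hconst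
  have hle := (U 1).le_opNorm x
  rw [hconst, norm_smul, Real.norm_of_nonneg (Real.exp_pos r).le] at hle
  by_contra hne
  exact hr.not_ge (le_of_mul_le_mul_right hle (norm_pos_iff.2 hne))

theorem hasDerivAt_of_tendsto_nhdsGT [CompleteSpace X] (hU : IsC0Group U)
    (h : Tendsto (fun s : ℝ => s⁻¹ • (U s x - x)) (𝓝[>] 0) (𝓝 z)) :
    HasDerivAt (fun t => U t x) z 0 := by
  rw [hasDerivAt_zero_iff_tendsto hU.zero, ← Set.Iio_union_Ioi, nhdsWithin_union]
  refine Tendsto.sup ?_ h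
  obtain ⟨M, hM⟩ := hU.exists_norm_le 1
  have hbound : ∀ᶠ t : ℝ in 𝓝[<] 0, ‖U t‖ ≤ M := by
    filter_upwards [Ioo_mem_nhdsLT (neg_one_lt_zero (R := ℝ))] with t ht
    exact hM t ⟨ht.1.le, ht.2.le.trans zero_le_one⟩
  have hneg : Tendsto (fun t : ℝ => (-t)⁻¹ • (U (-t) x - x)) (𝓝[<] 0) (𝓝 z) :=
    h.comp (by simpa using tendsto_neg_nhdsLT (a := (0 : ℝ)))
  have hz : Tendsto (fun t => U t z) (𝓝[<] 0) (𝓝 z) := by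
    have hcont := (hU.continuous z).tendsto 0
    rw [hU.zero] at hcont
    exact hcont.mono_left nhdsWithin_le_nhds
  refine (tendsto_apply_of_norm_le hbound hneg hz).congr fun t => ?_
  rw [map_smul, map_sub, hU.apply_apply, add_neg_cancel, hU.zero, ContinuousLinearMap.id_apply,
    inv_neg, neg_smul, ← smul_neg, neg_sub]

end IsC0Group

theorem IsGeneratorOfGroup.neg_isGeneratorOfSemigroup [CompleteSpace X] {G : X →ₗ.[ℝ] X}
    (hG : IsGeneratorOfGroup G U) (hU : IsC0Group U) :
    IsGeneratorOfSemigroup (-G) fun s => U (-s) := by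
  intro x z
  have hright : Tendsto (fun s : ℝ => s⁻¹ • (U (-s) x - x)) (𝓝[>] 0) (𝓝 z) ↔
      HasDerivAt (fun t => U (-t) x) z 0 :=
    ⟨hU.comp_neg.hasDerivAt_of_tendsto_nhdsGT, fun h =>
      ((hasDerivAt_zero_iff_tendsto hU.comp_neg.zero x z).1 h).mono_left
        (nhdsWithin_mono _ fun _ hs => ne_of_gt hs)⟩
  rw [hright, hasDerivAt_comp_neg_iff (f := fun t => U t x), neg_zero,
    ← hU.isGeneratorOfGroup_iff.1 hG, LinearPMap.neg_graph]
  simp only [Submodule.mem_map, Prod.exists, LinearMap.prodMap_apply, Prod.mk.injEq]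
  refine ⟨?_, fun h => ⟨x, -z, h, rfl, by simp⟩⟩
  rintro ⟨x', z', h, rfl, rfl⟩
  simpa using h

end Groups

/-! ### Groups as limits of exponentials -/

section Exponential

variable {X : Type*} [NormedAddCommGroup X] [NormedSpace ℝ X] [CompleteSpace X]
  {C D : X →L[ℝ] X}

theorem hasDerivAt_exp_smul_apply (C : X →L[ℝ] X) (x : X) (t : ℝ) :
    HasDerivAt (fun s : ℝ => NormedSpace.exp (s • C) x) (C (NormedSpace.exp (t • C) x)) t := by
  simpa using (hasDerivAt_exp_smul_const' (𝕂 := ℝ) C t).clm_apply (hasDerivAt_const t x)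

theorem isC0Group_exp_smul (C : X →L[ℝ] X) : IsC0Group fun t => NormedSpace.exp (t • C) where
  zero := by
    rw [zero_smul, NormedSpace.exp_zero]
    rfl
  add s t := by
    let _ : NormedAlgebra ℚ (X →L[ℝ] X) := NormedAlgebra.restrictScalars ℚ ℝ _
    rw [add_smul]
    exact NormedSpace.exp_add_of_commute (((Commute.refl C).smul_left s).smul_right t)
  continuous x := continuous_iff_continuousAt.2 fun t =>
    (hasDerivAt_exp_smul_apply C x t).continuousAt

theorem hasDerivAt_exp_smul_exp_sub_smul_apply (hCD : Commute C D) (x : X) (t s : ℝ) :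
    HasDerivAt (fun s : ℝ => NormedSpace.exp (s • C) (NormedSpace.exp ((t - s) • D) x))
      (NormedSpace.exp (s • C) (NormedSpace.exp ((t - s) • D) (C x - D x))) s := by
  have hD : HasDerivAt (fun s : ℝ => NormedSpace.exp ((t - s) • D) x)
      (-NormedSpace.exp ((t - s) • D) (D x)) s := by
    have h := (hasDerivAt_exp_smul_const (𝕂 := ℝ) D (t - s)).clm_apply
      (hasDerivAt_const (t - s) x)
    simpa using h.comp_const_sub t s
  refine ((hasDerivAt_exp_smul_const (𝕂 := ℝ) C s).clm_apply hD).congr_deriv ?_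
  have hcomm : C (NormedSpace.exp ((t - s) • D) x) = NormedSpace.exp ((t - s) • D) (C x) :=
    DFunLike.congr_fun (hCD.smul_right (t - s)).exp_right.eq x
  rw [mul_apply_eq_comp, hcomm, map_neg, ← sub_eq_add_neg, map_sub, map_sub]

theorem abs_add_abs_sub_of_mem_uIcc {s t : ℝ} (hs : s ∈ Set.uIcc 0 t) :
    |s| + |t - s| = |t| := by
  rw [← segment_eq_uIcc] at hs
  simpa [Real.dist_eq, abs_sub_comm s t] using dist_add_dist_of_mem_segment hs

end Exponential

section EnergyEstimate

variable {X : Type*} [NormedAddCommGroup X] [InnerProductSpace ℝ X] [CompleteSpace X]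
  {C D : X →L[ℝ] X} {ω : ℝ}

theorem norm_exp_smul_apply_le_of_nonneg (hC : ∀ x, ⟪C x, x⟫_ℝ ≤ ω * ‖x‖ ^ 2) {t : ℝ}
    (ht : 0 ≤ t) (x : X) : ‖NormedSpace.exp (t • C) x‖ ≤ Real.exp (ω * t) * ‖x‖ := by
  set u : ℝ → X := fun s => NormedSpace.exp (s • C) x with hu
  have hderiv : ∀ s, HasDerivAt (fun s => Real.exp (-(2 * ω * s)) * ‖u s‖ ^ 2)
      (Real.exp (-(2 * ω * s)) * -(2 * ω * 1) * ‖u s‖ ^ 2 +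
        Real.exp (-(2 * ω * s)) * (2 * ⟪u s, C (u s)⟫_ℝ)) s := fun s =>
    ((hasDerivAt_id s).const_mul (2 * ω)).neg.exp.mul (hasDerivAt_exp_smul_apply C x s).norm_sq
  have hanti : Antitone fun s => Real.exp (-(2 * ω * s)) * ‖u s‖ ^ 2 := by
    refine antitone_of_deriv_nonpos (fun s => (hderiv s).differentiableAt) fun s => ?_
    rw [(hderiv s).deriv, real_inner_comm]
    nlinarith [hC (u s), Real.exp_pos (-(2 * ω * s))]
  have hdecay : Real.exp (-(2 * ω * t)) * ‖u t‖ ^ 2 ≤ ‖x‖ ^ 2 := by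
    simpa [hu] using hanti ht
  rw [Real.exp_neg, inv_mul_le_iff₀ (Real.exp_pos _)] at hdecay
  refine le_of_sq_le_sq ?_ (by positivity)
  rwa [mul_pow, ← Real.exp_nat_mul, Nat.cast_ofNat, ← mul_assoc]

theorem norm_exp_smul_le (hC : ∀ x, |⟪C x, x⟫_ℝ| ≤ ω * ‖x‖ ^ 2) (t : ℝ) :
    ‖NormedSpace.exp (t • C)‖ ≤ Real.exp (ω * |t|) := by
  refine ContinuousLinearMap.opNorm_le_bound _ (Real.exp_pos _).le fun x => ?_
  rcases le_total 0 t with ht | ht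
  · rw [abs_of_nonneg ht]
    exact norm_exp_smul_apply_le_of_nonneg (fun x => (le_abs_self _).trans (hC x)) ht x
  · have hneg : ∀ x, ⟪(-C) x, x⟫_ℝ ≤ ω * ‖x‖ ^ 2 := fun x => by
      rw [neg_apply, inner_neg_left]
      exact (neg_le_abs _).trans (hC x)
    have h := norm_exp_smul_apply_le_of_nonneg hneg (neg_nonneg.2 ht) x
    rwa [smul_neg, neg_smul, neg_neg, ← abs_of_nonpos ht] at h

theorem norm_exp_smul_sub_exp_smul_apply_le (hCD : Commute C D)
    (hC : ∀ x, |⟪C x, x⟫_ℝ| ≤ ω * ‖x‖ ^ 2) (hD : ∀ x, |⟪D x, x⟫_ℝ| ≤ ω * ‖x‖ ^ 2)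
    (t : ℝ) (x : X) :
    ‖NormedSpace.exp (t • C) x - NormedSpace.exp (t • D) x‖ ≤
      Real.exp (ω * |t|) * ‖C x - D x‖ * |t| := by
  have hbound : ∀ s ∈ Set.uIcc 0 t,
      ‖NormedSpace.exp (s • C) (NormedSpace.exp ((t - s) • D) (C x - D x))‖ ≤
        Real.exp (ω * |t|) * ‖C x - D x‖ := by
    intro s hs
    calc ‖NormedSpace.exp (s • C) (NormedSpace.exp ((t - s) • D) (C x - D x))‖
        ≤ Real.exp (ω * |s|) * (Real.exp (ω * |t - s|) * ‖C x - D x‖) :=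
          ContinuousLinearMap.le_of_opNorm_le_of_le _ (norm_exp_smul_le hC s)
            (ContinuousLinearMap.le_of_opNorm_le _ (norm_exp_smul_le hD (t - s)) _)
      _ = Real.exp (ω * |t|) * ‖C x - D x‖ := by
          rw [← mul_assoc, ← Real.exp_add, ← mul_add, abs_add_abs_sub_of_mem_uIcc hs]
  have hmean := (convex_uIcc 0 t).norm_image_sub_le_of_norm_hasDerivWithin_le
    (fun s _ => (hasDerivAt_exp_smul_exp_sub_smul_apply hCD x t s).hasDerivWithinAt) hbound
    Set.left_mem_uIcc Set.right_mem_uIcc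
  simpa using hmean

end EnergyEstimate

section Approximation

variable {X : Type*} [NormedAddCommGroup X] [InnerProductSpace ℝ X] [CompleteSpace X]
  {A : ℕ → X →L[ℝ] X} {ω : ℝ} {U : ℝ → X →L[ℝ] X} {x z : X}

theorem eventually_exp_mul_abs_le_two (ω : ℝ) : ∀ᶠ t in 𝓝 0, Real.exp (ω * |t|) ≤ 2 := by
  have hcont : Continuous fun t : ℝ => Real.exp (ω * |t|) := by fun_prop
  exact (hcont.tendsto' 0 1 (by simp)).eventually_le_const one_lt_two

theorem exists_tendsto_exp_smul (hcomm : ∀ n m, Commute (A n) (A m))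
    (hform : ∀ n x, |⟪A n x, x⟫_ℝ| ≤ ω * ‖x‖ ^ 2) {D : Set X} (hD : Dense D)
    (hcauchy : ∀ x ∈ D, CauchySeq fun n => A n x) :
    ∃ U : ℝ → X →L[ℝ] X, ∀ t x, Tendsto (fun n => NormedSpace.exp (t • A n) x) atTop
      (𝓝 (U t x)) := by
  have hcauchy_exp : ∀ (t : ℝ) x, CauchySeq fun n => NormedSpace.exp (t • A n) x := by
    intro t x
    simp only [cauchySeq_iff_tendsto_dist_atTop_0, dist_eq_norm] at hcauchy ⊢
    rw [← tendsto_zero_iff_norm_tendsto_zero]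
    refine tendsto_apply_of_norm_le_of_dense (L := (0 : X →L[ℝ] X))
      (T := fun q : ℕ × ℕ =>
        (NormedSpace.exp (t • A q.1) - NormedSpace.exp (t • A q.2) : X →L[ℝ] X))
      (.of_forall fun q => (norm_sub_le _ _).trans
        (add_le_add (norm_exp_smul_le (hform q.1) t) (norm_exp_smul_le (hform q.2) t)))
      hD (fun y hy => ?_) x
    have hlim := ((hcauchy y hy).const_mul (Real.exp (ω * |t|))).mul_const |t|
    rw [mul_zero, zero_mul] at hlim
    exact squeeze_zero_norm (fun q => norm_exp_smul_sub_exp_smul_apply_le (hcomm _ _)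
      (hform _) (hform _) t y) hlim
  choose f hf using fun t x => cauchySeq_tendsto_of_complete (hcauchy_exp t x)
  exact ⟨fun t => continuousLinearMapOfTendsto (fun n => NormedSpace.exp (t • A n))
    (tendsto_pi_nhds.2 (hf t)), hf⟩

theorem hasDerivAt_of_tendsto_exp_smul (hcomm : ∀ n m, Commute (A n) (A m))
    (hform : ∀ n x, |⟪A n x, x⟫_ℝ| ≤ ω * ‖x‖ ^ 2)
    (hU : ∀ t, Tendsto (fun n => NormedSpace.exp (t • A n) x) atTop (𝓝 (U t x)))
    (hz : Tendsto (fun n => A n x) atTop (𝓝 z)) : HasDerivAt (fun t => U t x) z 0 := by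
  have hrate : ∀ n t, ‖NormedSpace.exp (t • A n) x - U t x‖ ≤
      Real.exp (ω * |t|) * ‖A n x - z‖ * |t| := fun n t =>
    le_of_tendsto_of_tendsto' (tendsto_const_nhds.sub (hU t)).norm
      (((tendsto_const_nhds.sub hz).norm.const_mul _).mul_const |t|)
      fun m => norm_exp_smul_sub_exp_smul_apply_le (hcomm n m) (hform n) (hform m) t x
  have hU0 : U 0 x = x := tendsto_nhds_unique (hU 0) (by simp)
  refine hasDerivAt_of_tendsto_of_norm_sub_le (l := atTop) (c := fun n => 2 * ‖A n x - z‖)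
    (fun n => hasDerivAt_exp_smul_apply (A n) x 0) (by simpa using hz)
    (by simpa using (tendsto_iff_norm_sub_tendsto_zero.1 hz).const_mul 2) fun n => ?_
  filter_upwards [eventually_exp_mul_abs_le_two ω] with t ht
  simp only [zero_smul, NormedSpace.exp_zero, one_apply_eq_self, hU0, sub_sub_sub_cancel_right,
    sub_zero, Real.norm_eq_abs]
  refine (hrate n t).trans ?_
  gcongr

theorem exists_isC0Group_of_commute (hcomm : ∀ n m, Commute (A n) (A m))
    (hform : ∀ n x, |⟪A n x, x⟫_ℝ| ≤ ω * ‖x‖ ^ 2) {D : Set X} (hD : Dense D)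
    (hlim : ∀ x ∈ D, ∃ z, Tendsto (fun n => A n x) atTop (𝓝 z)) :
    ∃ U : ℝ → X →L[ℝ] X, IsC0Group U ∧
      (∀ x z, Tendsto (fun n => A n x) atTop (𝓝 z) → HasDerivAt (fun t => U t x) z 0) ∧
      ∀ t, ‖U t‖ ≤ Real.exp (ω * |t|) := by
  obtain ⟨U, hU⟩ := exists_tendsto_exp_smul hcomm hform hD fun x hx =>
    (hlim x hx).choose_spec.cauchySeq
  have hderiv : ∀ x z, Tendsto (fun n => A n x) atTop (𝓝 z) →
      HasDerivAt (fun t => U t x) z 0 := fun x _ hz =>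
    hasDerivAt_of_tendsto_exp_smul hcomm hform (hU · x) hz
  have hnorm : ∀ t, ‖U t‖ ≤ Real.exp (ω * |t|) := fun t =>
    ContinuousLinearMap.opNorm_le_bound _ (Real.exp_pos _).le fun x =>
      le_of_tendsto' (hU t x).norm fun n =>
        ContinuousLinearMap.le_of_opNorm_le _ (norm_exp_smul_le (hform n) t) x
  have hzero : U 0 = ContinuousLinearMap.id ℝ X := by
    ext x
    exact tendsto_nhds_unique (hU 0 x) (by simp)
  have hadd : ∀ s t, U (s + t) = (U s).comp (U t) := by
    intro s t
    ext x
    refine tendsto_nhds_unique (hU (s + t) x) ?_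
    simp only [(isC0Group_exp_smul (A _)).add s t]
    exact tendsto_apply_of_norm_le (.of_forall fun n => norm_exp_smul_le (hform n) s) (hU t x)
      (hU s (U t x))
  have hbound : ∀ᶠ t : ℝ in 𝓝 0, ‖U t‖ ≤ 2 :=
    (eventually_exp_mul_abs_le_two ω).mono fun t ht => (hnorm t).trans ht
  refine ⟨U, isC0Group_of_dense hzero hadd hbound hD fun x hx => ?_, hderiv, hnorm⟩
  obtain ⟨z, hz⟩ := hlim x hx
  exact (hderiv x z hz).continuousAt

end Approximation

/-! ### Quasi-skew-adjoint operators -/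

section Resolvents

variable {X : Type*} [NormedAddCommGroup X] [NormedSpace ℝ X]

/-- `R` is the inverse of `r - A`, where `A` is the operator in `X` with the graph `Γ`. -/
structure IsResolvent (Γ : Submodule ℝ (X × X)) (r : ℝ) (R : X →L[ℝ] X) : Prop where
  mem : ∀ y, (R y, r • R y - y) ∈ Γ
  apply_sub : ∀ p ∈ Γ, R (r • p.1 - p.2) = p.1

variable {Γ : Submodule ℝ (X × X)} {β r : ℝ}

namespace IsResolvent

variable {s : ℝ} {R S : X →L[ℝ] X}

theorem apply_snd (hR : IsResolvent Γ r R) {p : X × X} (hp : p ∈ Γ) :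
    R p.2 = r • R p.1 - p.1 := by
  have h := hR.apply_sub p hp
  rw [map_sub, map_smul] at h
  rw [sub_eq_iff_eq_add.1 h]
  abel

theorem commute (hR : IsResolvent Γ r R) (hS : IsResolvent Γ s S) : Commute R S := by
  ext y
  change R (S y) = S (R y)
  have hid : R ((r - s) • S y + y) = S y := by
    have h := hR.apply_sub _ (hS.mem y)
    rwa [show r • S y - (s • S y - y) = (r - s) • S y + y by module] at h
  have hy : s • R (S y) - (r • R (S y) - S y) = R y := by
    rw [map_add, map_smul] at hid
    nth_rw 3 [← hid]
    module
  exact (hS.apply_sub _ (hR.mem (S y))).symm.trans (congrArg S hy)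

theorem exists_smul_sub_add_eq [CompleteSpace X] {B : X →L[ℝ] X} (hR : IsResolvent Γ r R)
    (hBR : ‖B * R‖ < 1) (y : X) : ∃ p ∈ Γ, r • p.1 - (p.2 + B p.1) = y := by
  obtain ⟨S, hS⟩ := isUnit_one_sub_of_norm_lt_one hBR
  set z := (↑S⁻¹ : X →L[ℝ] X) y
  have hzy : z - B (R z) = y := by
    have h := DFunLike.congr_fun (S.mul_inv : (S : X →L[ℝ] X) * ↑S⁻¹ = 1) y
    rwa [hS] at h
  refine ⟨_, hR.mem z, ?_⟩
  change r • R z - (r • R z - z + B (R z)) = y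
  rw [← hzy]
  abel

end IsResolvent

theorem tendsto_smul_resolvent {ι : Type*} {l : Filter ι} {r : ι → ℝ}
    {R : ι → X →L[ℝ] X} (hdense : Dense (Prod.fst '' (Γ : Set (X × X))))
    (hr : Tendsto (fun i => |r i|) l atTop) (hR : ∀ i, IsResolvent Γ (r i) (R i))
    (hnorm : ∀ i, ‖R i‖ ≤ (|r i| - β)⁻¹) (y : X) :
    Tendsto (fun i => r i • R i y) l (𝓝 y) := by
  have hinv : Tendsto (fun i => (|r i| - β)⁻¹) l (𝓝 0) :=
    tendsto_inv_atTop_zero.comp (tendsto_atTop_add_const_right l (-β) hr)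
  have hR0 : ∀ z, Tendsto (fun i => R i z) l (𝓝 0) := fun z =>
    squeeze_zero_norm (fun i => (R i).le_of_opNorm_le (hnorm i) z)
      (by simpa only [zero_mul] using hinv.mul_const ‖z‖)
  have hbound : ∀ᶠ i in l, ‖r i • R i‖ ≤ 2 := by
    filter_upwards [hr.eventually_ge_atTop (2 * |β| + 1)] with i hi
    have hβ := le_abs_self β
    have hpos : 0 < |r i| - β := by linarith [abs_nonneg β]
    calc ‖r i • R i‖ ≤ |r i| * (|r i| - β)⁻¹ := by
          rw [norm_smul, Real.norm_eq_abs]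
          gcongr
          exact hnorm i
      _ ≤ 2 := by
          rw [← div_eq_mul_inv, div_le_iff₀ hpos]
          linarith
  refine tendsto_apply_of_norm_le_of_dense (T := fun i => r i • R i)
    (L := ContinuousLinearMap.id ℝ X) hbound hdense ?_ y
  rintro _ ⟨p, hp, rfl⟩
  have h := (hR0 p.2).add_const p.1
  rw [zero_add] at h
  refine h.congr fun i => ?_
  rw [(hR i).apply_snd hp, sub_add_cancel, smul_apply]

/-- The two-sided Yosida approximation of `A`, where `R` and `S` are the inverses of `r - A` and
`-r - A`: the average of the Yosida approximations of `A` and of `-A` (the latter with the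
opposite sign). -/
def yosidaApprox (r : ℝ) (R S : X →L[ℝ] X) : X →L[ℝ] X := (r ^ 2 / 2) • (R + S)

theorem yosidaApprox_apply (r : ℝ) (R S : X →L[ℝ] X) (x : X) :
    yosidaApprox r R S x = (r ^ 2 / 2) • (R x + S x) := rfl

theorem yosidaApprox_apply_fst (hR : IsResolvent Γ r R) (hS : IsResolvent Γ (-r) S) {p : X × X}
    (hp : p ∈ Γ) : yosidaApprox r R S p.1 = (2⁻¹ : ℝ) • (r • R p.2 + (-r) • S p.2) := by
  rw [yosidaApprox_apply, hR.apply_snd hp, hS.apply_snd hp]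
  module

theorem commute_yosidaApprox {r' : ℝ} {R' S' : X →L[ℝ] X} (hR : IsResolvent Γ r R)
    (hS : IsResolvent Γ (-r) S) (hR' : IsResolvent Γ r' R') (hS' : IsResolvent Γ (-r') S') :
    Commute (yosidaApprox r R S) (yosidaApprox r' R' S') :=
  (((hR.commute hR').add_right (hR.commute hS')).add_left
    ((hS.commute hR').add_right (hS.commute hS'))).smul_left _ |>.smul_right _

end Resolvents

section QuasiSkew

variable {X : Type*} [NormedAddCommGroup X] [InnerProductSpace ℝ X]

variable {Γ : Submodule ℝ (X × X)} {β r : ℝ} {R S : X →L[ℝ] X}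

theorem mul_norm_fst_le_of_form_le {p : X × X} (h : |⟪p.2, p.1⟫_ℝ| ≤ β * ‖p.1‖ ^ 2) (r : ℝ) :
    (|r| - β) * ‖p.1‖ ≤ ‖r • p.1 - p.2‖ := by
  rcases eq_or_ne p.1 0 with hp | hp
  · simp [hp]
  refine le_of_mul_le_mul_right ?_ (norm_pos_iff.2 hp)
  have hsplit : r * ‖p.1‖ ^ 2 = ⟪r • p.1 - p.2, p.1⟫_ℝ + ⟪p.2, p.1⟫_ℝ := by
    rw [inner_sub_left, real_inner_smul_left, real_inner_self_eq_norm_sq]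
    ring
  have hle : |r| * ‖p.1‖ ^ 2 ≤ ‖r • p.1 - p.2‖ * ‖p.1‖ + β * ‖p.1‖ ^ 2 := by
    calc |r| * ‖p.1‖ ^ 2 = |⟪r • p.1 - p.2, p.1⟫_ℝ + ⟪p.2, p.1⟫_ℝ| := by
          rw [← hsplit, abs_mul, abs_of_nonneg (sq_nonneg ‖p.1‖)]
      _ ≤ ‖r • p.1 - p.2‖ * ‖p.1‖ + β * ‖p.1‖ ^ 2 :=
          (abs_add_le _ _).trans (add_le_add (abs_real_inner_le_norm _ _) h)
  linarith

theorem exists_isResolvent (hform : ∀ p ∈ Γ, |⟪p.2, p.1⟫_ℝ| ≤ β * ‖p.1‖ ^ 2) (hr : β < |r|)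
    (hsurj : ∀ y, ∃ p ∈ Γ, r • p.1 - p.2 = y) :
    ∃ R : X →L[ℝ] X, IsResolvent Γ r R ∧ ‖R‖ ≤ (|r| - β)⁻¹ := by
  have hpos : 0 < |r| - β := sub_pos.2 hr
  let L : Γ →ₗ[ℝ] X := (r • LinearMap.fst ℝ X X - LinearMap.snd ℝ X X) ∘ₗ Γ.subtype
  have hL : ∀ p : Γ, L p = r • p.1.1 - p.1.2 := fun _ => rfl
  have hbound : ∀ p : Γ, (|r| - β) * ‖p.1.1‖ ≤ ‖L p‖ := fun p =>
    mul_norm_fst_le_of_form_le (hform p p.2) r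
  have hinj : Function.Injective L := by
    refine (injective_iff_map_eq_zero L).2 fun p hp => ?_
    have hfst : p.1.1 = 0 := by
      have hle := hbound p
      rw [hp, norm_zero] at hle
      exact norm_le_zero_iff.1 (nonpos_of_mul_nonpos_right hle hpos)
    rw [hL, hfst, smul_zero, zero_sub, neg_eq_zero] at hp
    exact Subtype.ext (Prod.ext hfst hp)
  let e : Γ ≃ₗ[ℝ] X := LinearEquiv.ofBijective L
    ⟨hinj, fun y => let ⟨p, hp, hpy⟩ := hsurj y; ⟨⟨p, hp⟩, hpy⟩⟩
  have hLe : ∀ y, L (e.symm y) = y := e.apply_symm_apply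
  let R : X →L[ℝ] X := (LinearMap.fst ℝ X X ∘ₗ Γ.subtype ∘ₗ e.symm.toLinearMap).mkContinuous
    (|r| - β)⁻¹ fun y => by
      rw [← div_eq_inv_mul, le_div_iff₀' hpos]
      exact (hbound (e.symm y)).trans_eq (congrArg norm (hLe y))
  refine ⟨R, ⟨fun y => ?_, fun p hp => ?_⟩,
    LinearMap.mkContinuous_norm_le _ (inv_nonneg.2 hpos.le) _⟩
  · have hsnd : r • (e.symm y).1.1 - y = (e.symm y).1.2 := sub_eq_iff_eq_add.2 <|
      sub_eq_iff_eq_add'.1 (hLe y)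
    change ((e.symm y).1.1, r • (e.symm y).1.1 - y) ∈ Γ
    rw [hsnd]
    exact (e.symm y).2
  · change (e.symm (L ⟨p, hp⟩)).1.1 = p.1
    rw [show e.symm (L ⟨p, hp⟩) = ⟨p, hp⟩ from e.symm_apply_apply _]

/-- A densely defined operator `A`, given by its graph `Γ`, whose symmetric part is bounded by `β`
and for which `r - A` is onto for all large `|r|`. Such operators generate `C₀`-groups. -/
structure IsQuasiSkewAdjoint (Γ : Submodule ℝ (X × X)) (β : ℝ) : Prop where
  nonneg : 0 ≤ β
  form_le : ∀ p ∈ Γ, |⟪p.2, p.1⟫_ℝ| ≤ β * ‖p.1‖ ^ 2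
  dense : Dense (Prod.fst '' (Γ : Set (X × X)))
  exists_surjective : ∃ r₀, ∀ r : ℝ, r₀ < |r| → ∀ y, ∃ p ∈ Γ, r • p.1 - p.2 = y

theorem abs_inner_add_inner_le_of_form_le (h : ∀ p ∈ Γ, |⟪p.2, p.1⟫_ℝ| ≤ β * ‖p.1‖ ^ 2)
    {p q : X × X} (hp : p ∈ Γ) (hq : q ∈ Γ) :
    |⟪p.2, q.1⟫_ℝ + ⟪q.2, p.1⟫_ℝ| ≤ β * (‖p.1‖ ^ 2 + ‖q.1‖ ^ 2) := by
  have hadd := h _ (Γ.add_mem hp hq)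
  have hsub := h _ (Γ.sub_mem hp hq)
  have hpar : β * ‖p.1 + q.1‖ ^ 2 + β * ‖p.1 - q.1‖ ^ 2 = 2 * (β * (‖p.1‖ ^ 2 + ‖q.1‖ ^ 2)) := by
    rw [← mul_add, parallelogram_law_with_norm ℝ p.1 q.1]
    ring
  simp only [Prod.fst_add, Prod.snd_add, Prod.fst_sub, Prod.snd_sub, inner_add_left,
    inner_add_right, inner_sub_left, inner_sub_right, abs_le] at hadd hsub ⊢
  constructor <;> linarith

theorem norm_sq_add_norm_sq_le_of_form_le (h : ∀ p ∈ Γ, |⟪p.2, p.1⟫_ℝ| ≤ β * ‖p.1‖ ^ 2)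
    (hr : 0 < r) (hβ : 4 * β ≤ r) {y v w : X} (hy : (y, r • v) ∈ Γ) (hv : (v, -(r • w)) ∈ Γ) :
    ‖y‖ ^ 2 + ‖v‖ ^ 2 ≤ 2 * ‖y + w‖ ^ 2 := by
  have hpol := le_of_abs_le (abs_inner_add_inner_le_of_form_le h hy hv)
  simp only [inner_neg_left, real_inner_smul_left, real_inner_self_eq_norm_sq] at hpol
  have hquarter : ‖v‖ ^ 2 - ⟪y, w⟫_ℝ ≤ (‖y‖ ^ 2 + ‖v‖ ^ 2) / 4 := by
    refine le_of_mul_le_mul_left ?_ hr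
    rw [real_inner_comm y w] at *
    nlinarith [mul_le_mul_of_nonneg_right hβ (add_nonneg (sq_nonneg ‖y‖) (sq_nonneg ‖v‖))]
  rw [norm_add_sq_real]
  nlinarith [sq_nonneg ‖w‖, sq_nonneg ‖v‖, sq_nonneg ‖y‖]

theorem abs_inner_smul_add_le_of_form_le (hβ0 : 0 ≤ β)
    (h : ∀ p ∈ Γ, |⟪p.2, p.1⟫_ℝ| ≤ β * ‖p.1‖ ^ 2) (hr : 0 < r) (hβ : 4 * β ≤ r) {y v w : X}
    (hy : (y, r • v) ∈ Γ) (hv : (v, -(r • w)) ∈ Γ) :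
    |⟪r • v, y + w⟫_ℝ| ≤ 2 * β * ‖y + w‖ ^ 2 := by
  have hdiff : ⟪r • v, y + w⟫_ℝ = ⟪r • v, y⟫_ℝ - ⟪-(r • w), v⟫_ℝ := by
    simp only [inner_add_right, real_inner_smul_left, inner_neg_left, real_inner_comm v w]
    ring
  calc |⟪r • v, y + w⟫_ℝ| ≤ |⟪r • v, y⟫_ℝ| + |⟪-(r • w), v⟫_ℝ| := by
        rw [hdiff]
        exact abs_sub _ _
    _ ≤ β * ‖y‖ ^ 2 + β * ‖v‖ ^ 2 := add_le_add (h _ hy) (h _ hv)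
    _ = β * (‖y‖ ^ 2 + ‖v‖ ^ 2) := (mul_add _ _ _).symm
    _ ≤ β * (2 * ‖y + w‖ ^ 2) := by
        gcongr
        exact norm_sq_add_norm_sq_le_of_form_le h hr hβ hy hv
    _ = 2 * β * ‖y + w‖ ^ 2 := by ring

theorem abs_inner_yosidaApprox_le (hβ0 : 0 ≤ β) (h : ∀ p ∈ Γ, |⟪p.2, p.1⟫_ℝ| ≤ β * ‖p.1‖ ^ 2)
    (hr : 0 < r) (hβ : 4 * β ≤ r) (hR : IsResolvent Γ r R) (hS : IsResolvent Γ (-r) S) (x : X) :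
    |⟪yosidaApprox r R S x, x⟫_ℝ| ≤ 2 * β * ‖x‖ ^ 2 := by
  -- `A y = yosidaApprox x` and `A (A y) = r² (y - x)`.
  set y := (r / 2) • (R x - S x)
  set v := (r / 2) • (R x + S x)
  have hyv : (y, r • v) ∈ Γ := by
    convert Γ.smul_mem (r / 2) (Γ.sub_mem (hR.mem x) (hS.mem x)) using 1
    refine Prod.ext rfl ?_
    change r • v = (r / 2) • ((r • R x - x) - ((-r) • S x - x))
    module
  have hvw : (v, -(r • (x - y))) ∈ Γ := by
    convert Γ.smul_mem (r / 2) (Γ.add_mem (hR.mem x) (hS.mem x)) using 1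
    refine Prod.ext rfl ?_
    change -(r • (x - y)) = (r / 2) • ((r • R x - x) + ((-r) • S x - x))
    module
  have hA : yosidaApprox r R S x = r • v := by
    rw [yosidaApprox_apply]
    module
  have hinner := abs_inner_smul_add_le_of_form_le hβ0 h hr hβ hyv hvw
  rwa [add_sub_cancel, ← hA] at hinner

namespace IsQuasiSkewAdjoint

theorem exists_isResolvent_seq (h : IsQuasiSkewAdjoint Γ β) :
    ∃ (r : ℕ → ℝ) (R S : ℕ → X →L[ℝ] X), Tendsto r atTop atTop ∧
      (∀ n, 0 < r n ∧ 4 * β ≤ r n) ∧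
      (∀ n, IsResolvent Γ (r n) (R n) ∧ ‖R n‖ ≤ (|r n| - β)⁻¹) ∧
      ∀ n, IsResolvent Γ (-r n) (S n) ∧ ‖S n‖ ≤ (|-r n| - β)⁻¹ := by
  obtain ⟨r₀, hsurj⟩ := h.exists_surjective
  let r : ℕ → ℝ := fun n => max r₀ (4 * β) + 1 + n
  have hr : ∀ n, r₀ < r n ∧ 4 * β < r n := fun n => by
    have : (0 : ℝ) ≤ n := n.cast_nonneg
    constructor <;> linarith [le_max_left r₀ (4 * β), le_max_right r₀ (4 * β),
      show r n = max r₀ (4 * β) + 1 + n from rfl]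
  have hpos : ∀ n, 0 < r n := fun n => by linarith [hr n, h.nonneg]
  have hres : ∀ s : ℝ, ∀ n, |s| = r n → ∃ R, IsResolvent Γ s R ∧ ‖R‖ ≤ (|s| - β)⁻¹ :=
    fun s n hs => exists_isResolvent h.form_le (by linarith [hr n, h.nonneg])
      (hsurj s (hs ▸ (hr n).1))
  choose R hR using fun n => hres (r n) n (abs_of_pos (hpos n))
  choose S hS using fun n => hres (-r n) n (by rw [abs_neg, abs_of_pos (hpos n)])
  exact ⟨r, R, S, tendsto_atTop_add_const_left _ _ tendsto_natCast_atTop_atTop,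
    fun n => ⟨hpos n, (hr n).2.le⟩, hR, hS⟩

theorem exists_commute_tendsto (h : IsQuasiSkewAdjoint Γ β) :
    ∃ A : ℕ → X →L[ℝ] X, (∀ n m, Commute (A n) (A m)) ∧
      (∀ n x, |⟪A n x, x⟫_ℝ| ≤ 2 * β * ‖x‖ ^ 2) ∧
      ∀ p ∈ Γ, Tendsto (fun n => A n p.1) atTop (𝓝 p.2) := by
  obtain ⟨r, R, S, hr, hrβ, hR, hS⟩ := h.exists_isResolvent_seq
  refine ⟨fun n => yosidaApprox (r n) (R n) (S n),
    fun n m => commute_yosidaApprox (hR n).1 (hS n).1 (hR m).1 (hS m).1,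
    fun n => abs_inner_yosidaApprox_le h.nonneg h.form_le (hrβ n).1 (hrβ n).2 (hR n).1 (hS n).1,
    fun p hp => ?_⟩
  have habs : Tendsto (fun n => |r n|) atTop atTop := tendsto_abs_atTop_atTop.comp hr
  have hlimR := tendsto_smul_resolvent h.dense habs (fun n => (hR n).1) (fun n => (hR n).2) p.2
  have hlimS := tendsto_smul_resolvent h.dense (by simpa only [abs_neg] using habs)
    (fun n => (hS n).1) (fun n => (hS n).2) p.2
  have hlim := (hlimR.add hlimS).const_smul (2⁻¹ : ℝ)
  rw [← two_smul ℝ p.2, inv_smul_smul₀ two_ne_zero] at hlim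
  exact hlim.congr fun n => (yosidaApprox_apply_fst (hR n).1 (hS n).1 hp).symm

/-- Surjectivity of `r - A` for one large `r` leaves no room for a proper extension for which
`r - A` is still injective. -/
theorem mem_of_hasDerivAt (h : IsQuasiSkewAdjoint Γ β) {U : ℝ → X →L[ℝ] X} (hU : IsC0Group U)
    (hΓ : ∀ p ∈ Γ, HasDerivAt (fun t => U t p.1) p.2 0) {x z : X}
    (hxz : HasDerivAt (fun t => U t x) z 0) : (x, z) ∈ Γ := by
  obtain ⟨r₀, hsurj⟩ := h.exists_surjective
  obtain ⟨r, hr, hr1⟩ : ∃ r : ℝ, r₀ < r ∧ ‖U 1‖ < Real.exp r :=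
    ((eventually_gt_atTop r₀).and (Real.tendsto_exp_atTop.eventually_gt_atTop _)).exists
  obtain ⟨p, hp, hpr⟩ := hsurj r (hr.trans_le (le_abs_self r)) (r • x - z)
  have hsnd : z - p.2 = r • (x - p.1) := by
    rw [sub_eq_sub_iff_add_eq_add] at hpr
    rw [smul_sub, sub_eq_sub_iff_add_eq_add, add_comm, hpr]
  have hd : HasDerivAt (fun t => U t (x - p.1)) (r • (x - p.1)) 0 := by
    simp only [map_sub, ← hsnd]
    exact hxz.sub (hΓ p hp)
  have hfst := hU.eq_zero_of_hasDerivAt_smul hr1 hd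
  rw [hfst, smul_zero, sub_eq_zero] at hsnd
  rw [sub_eq_zero.1 hfst, hsnd]
  exact hp

theorem exists_isC0Group [CompleteSpace X] (h : IsQuasiSkewAdjoint Γ β) :
    ∃ U : ℝ → X →L[ℝ] X, IsC0Group U ∧
      (∀ x z, (x, z) ∈ Γ ↔ HasDerivAt (fun t => U t x) z 0) ∧
      ∀ t, ‖U t‖ ≤ Real.exp (2 * β * |t|) := by
  obtain ⟨A, hcomm, hform, hlim⟩ := h.exists_commute_tendsto
  obtain ⟨U, hU, hderiv, hnorm⟩ := exists_isC0Group_of_commute hcomm hform h.dense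
    (by rintro _ ⟨p, hp, rfl⟩; exact ⟨p.2, hlim p hp⟩)
  have hΓ : ∀ p ∈ Γ, HasDerivAt (fun t => U t p.1) p.2 0 := fun p hp =>
    hderiv p.1 p.2 (hlim p hp)
  exact ⟨U, hU, fun x z => ⟨hΓ (x, z), h.mem_of_hasDerivAt hU hΓ⟩, hnorm⟩

theorem exists_graph_eq [CompleteSpace X] (h : IsQuasiSkewAdjoint Γ β) :
    ∃ G : X →ₗ.[ℝ] X, G.graph = Γ := by
  obtain ⟨U, -, hΓ, -⟩ := h.exists_isC0Group
  refine ⟨Γ.toLinearPMap, Submodule.toLinearPMap_graph_eq Γ ?_⟩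
  rintro ⟨_, z⟩ hp rfl
  have hd : HasDerivAt (fun t => U t 0) z 0 := (hΓ 0 z).1 hp
  simp only [map_zero] at hd
  exact hd.unique (hasDerivAt_const _ _)

theorem exists_isGeneratorOfGroup [CompleteSpace X] (h : IsQuasiSkewAdjoint Γ β)
    {G : X →ₗ.[ℝ] X} (hG : G.graph = Γ) :
    ∃ U : ℝ → X →L[ℝ] X, IsC0Group U ∧ IsGeneratorOfGroup G U ∧
      ∀ t, ‖U t‖ ≤ Real.exp (2 * β * |t|) := by
  obtain ⟨U, hU, hΓ, hnorm⟩ := h.exists_isC0Group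
  exact ⟨U, hU, hU.isGeneratorOfGroup_iff.2 (hG ▸ hΓ), hnorm⟩

theorem graph_eq_of_le (h : IsQuasiSkewAdjoint Γ β) {G : X →ₗ.[ℝ] X}
    {U : ℝ → X →L[ℝ] X} (hU : IsC0Group U) (hG : IsGeneratorOfGroup G U) (hle : Γ ≤ G.graph) :
    G.graph = Γ := by
  rw [hU.isGeneratorOfGroup_iff] at hG
  refine le_antisymm (fun p hp => ?_) hle
  exact h.mem_of_hasDerivAt hU (fun q hq => (hG q.1 q.2).1 (hle hq)) ((hG p.1 p.2).1 hp)

end IsQuasiSkewAdjoint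

end QuasiSkew

/-! ### Conjugation -/

section Surjectivity

variable {X : Type*} [NormedAddCommGroup X] [InnerProductSpace ℝ X] [CompleteSpace X]
  {Γ : Submodule ℝ (X × X)} {β r : ℝ}

theorem exists_smul_sub_eq_of_dense (hclosed : IsClosed (Γ : Set (X × X)))
    (hform : ∀ p ∈ Γ, |⟪p.2, p.1⟫_ℝ| ≤ β * ‖p.1‖ ^ 2) (hr : β < |r|)
    (hdense : Dense ((fun p : X × X => r • p.1 - p.2) '' Γ)) (y : X) :
    ∃ p ∈ Γ, r • p.1 - p.2 = y := by
  have hpos : 0 < |r| - β := sub_pos.2 hr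
  have := hclosed.completeSpace_coe
  let L : Γ →L[ℝ] X :=
    (r • ContinuousLinearMap.fst ℝ X X - ContinuousLinearMap.snd ℝ X X).comp Γ.subtypeL
  have hfst : ∀ p : Γ, ‖p.1.1‖ ≤ (|r| - β)⁻¹ * ‖L p‖ := fun p => by
    rw [← div_eq_inv_mul, le_div_iff₀' hpos]
    exact mul_norm_fst_le_of_form_le (hform p p.2) r
  have hsnd : ∀ p : Γ, ‖p.1.2‖ ≤ (|r| * (|r| - β)⁻¹ + 1) * ‖L p‖ := fun p => by
    calc ‖p.1.2‖ = ‖r • p.1.1 - L p‖ := congrArg norm (sub_sub_cancel _ _).symm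
      _ ≤ |r| * ‖p.1.1‖ + ‖L p‖ := by
          rw [← Real.norm_eq_abs, ← norm_smul]
          exact norm_sub_le _ _
      _ ≤ |r| * ((|r| - β)⁻¹ * ‖L p‖) + ‖L p‖ := by
          gcongr
          exact hfst p
      _ = (|r| * (|r| - β)⁻¹ + 1) * ‖L p‖ := by ring
  have hanti : AntilipschitzWith
      (max (|r| - β)⁻¹ (|r| * (|r| - β)⁻¹ + 1)).toNNReal L := by
    refine L.antilipschitz_of_bound fun p => ?_
    rw [Real.coe_toNNReal _ (le_max_of_le_left (inv_nonneg.2 hpos.le)),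
      max_mul_of_nonneg _ _ (norm_nonneg _)]
    exact max_le_max (hfst p) (hsnd p)
  have hrange : Set.range L = (fun p : X × X => r • p.1 - p.2) '' Γ := by
    rw [Set.image_eq_range]
    rfl
  have hy : y ∈ Set.range L := by
    rw [← (hanti.isClosed_range L.uniformContinuous).closure_eq, hrange]
    exact hdense y
  obtain ⟨p, hp⟩ := hy
  exact ⟨p, p.2, hp⟩

end Surjectivity

section GraphClosure

variable {X Y : Type*} [NormedAddCommGroup X] [NormedSpace ℝ X] [NormedAddCommGroup Y]
  [NormedSpace ℝ Y]

/-- The graph of the closure of the operator `ι u ↦ T u` in `X`, where `Y ⊂ X` through `ι`. -/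
def graphClosure (ι T : Y →L[ℝ] X) : Submodule ℝ (X × X) :=
  (LinearMap.range (ι.prod T).toLinearMap).topologicalClosure

variable {ι T : Y →L[ℝ] X} {Q : Y ≃L[ℝ] X} {B : X →L[ℝ] X}

theorem mk_mem_graphClosure (ι T : Y →L[ℝ] X) (u : Y) : (ι u, T u) ∈ graphClosure ι T :=
  Submodule.le_topologicalClosure _ ⟨u, rfl⟩

theorem isClosed_graphClosure (ι T : Y →L[ℝ] X) : IsClosed (graphClosure ι T : Set (X × X)) :=
  Submodule.isClosed_topologicalClosure _

theorem graphClosure_subset {s : Set (X × X)} (hs : IsClosed s) (h : ∀ u, (ι u, T u) ∈ s) :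
    (graphClosure ι T : Set (X × X)) ⊆ s :=
  closure_minimal (by rintro _ ⟨u, rfl⟩; exact h u) hs

theorem mk_conj_mem_graphClosure (hconj : ∀ u, T (Q.symm (ι u)) = ι (Q.symm (T u + B (ι u))))
    {p : X × X} (hp : p ∈ graphClosure ι T) :
    (ι (Q.symm p.1), ι (Q.symm (p.2 + B p.1))) ∈ graphClosure ι T := by
  refine graphClosure_subset
    (s := (fun p : X × X => (ι (Q.symm p.1), ι (Q.symm (p.2 + B p.1)))) ⁻¹' graphClosure ι T)
    ((isClosed_graphClosure ι T).preimage (by fun_prop)) (fun u => ?_) hp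
  rw [Set.mem_preimage, ← hconj]
  exact mk_mem_graphClosure ι T _

end GraphClosure

section Conjugation

variable {X Y : Type*} [NormedAddCommGroup X] [InnerProductSpace ℝ X] [NormedAddCommGroup Y]
  [NormedSpace ℝ Y] {ι T : Y →L[ℝ] X} {Q : Y ≃L[ℝ] X} {B : X →L[ℝ] X} {β : ℝ}

theorem graphClosure_form_le (h : ∀ u, |⟪T u, ι u⟫_ℝ| ≤ β * ‖ι u‖ ^ 2) :
    ∀ p ∈ graphClosure ι T, |⟪p.2, p.1⟫_ℝ| ≤ β * ‖p.1‖ ^ 2 := fun _ hp =>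
  graphClosure_subset (s := {p : X × X | |⟪p.2, p.1⟫_ℝ| ≤ β * ‖p.1‖ ^ 2})
    (isClosed_le (by fun_prop) (by fun_prop)) h hp

theorem eq_zero_of_forall_inner_smul_sub_eq_zero (hι : Function.Injective ι)
    (hsymm : ∀ x y, ⟪ι (Q.symm x), y⟫_ℝ = ⟪x, ι (Q.symm y)⟫_ℝ)
    (hconj : ∀ u, T (Q.symm (ι u)) = ι (Q.symm (T u + B (ι u))))
    (hform : ∀ u, |⟪T u, ι u⟫_ℝ| ≤ β * ‖ι u‖ ^ 2) {r : ℝ} (hr : β + ‖B‖ < |r|) {v : X}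
    (hv : ∀ u, ⟪r • ι u - T u, v⟫_ℝ = 0) : v = 0 := by
  -- Testing with `u = Q⁻² v` moves one factor `Q⁻¹` onto `v`.
  set w := ι (Q.symm v) with hw
  have htest : r * ‖w‖ ^ 2 = ⟪T (Q.symm v), w⟫_ℝ + ⟪B w, w⟫_ℝ := by
    have h := hv (Q.symm w)
    rw [hconj, ← map_smul, ← map_smul, ← map_sub, ← map_sub, hsymm, ← hw, inner_sub_left,
      real_inner_smul_left, real_inner_self_eq_norm_sq, inner_add_left] at h
    exact sub_eq_zero.1 h
  have hB : |⟪B w, w⟫_ℝ| ≤ ‖B‖ * ‖w‖ ^ 2 := by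
    rw [sq, ← mul_assoc]
    exact (abs_real_inner_le_norm _ _).trans (by gcongr; exact B.le_opNorm w)
  have hle : |r| * ‖w‖ ^ 2 ≤ (β + ‖B‖) * ‖w‖ ^ 2 :=
    calc |r| * ‖w‖ ^ 2 = |⟪T (Q.symm v), w⟫_ℝ + ⟪B w, w⟫_ℝ| := by
          rw [← htest, abs_mul, abs_of_nonneg (sq_nonneg ‖w‖)]
      _ ≤ β * ‖w‖ ^ 2 + ‖B‖ * ‖w‖ ^ 2 :=
          (abs_add_le _ _).trans (add_le_add (hform _) hB)
      _ = (β + ‖B‖) * ‖w‖ ^ 2 := (add_mul _ _ _).symm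
  have hw0 : w = 0 := by
    by_contra h
    exact hr.not_ge (le_of_mul_le_mul_right hle (by positivity))
  exact (map_eq_zero_iff _ Q.symm.injective).1 ((map_eq_zero_iff ι hι).1 hw0)

variable [CompleteSpace X]

theorem denseRange_of_forall_inner_eq_zero (h : ∀ v, (∀ u, ⟪T u, v⟫_ℝ = 0) → v = 0) :
    DenseRange T := by
  change Dense ((LinearMap.range T.toLinearMap : Submodule ℝ X) : Set X)
  rw [Submodule.dense_iff_topologicalClosure_eq_top, Submodule.topologicalClosure_eq_top_iff,
    Submodule.eq_bot_iff]
  exact fun v hv => h v fun u => hv _ ⟨u, rfl⟩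

theorem denseRange_of_symmetric (hι : Function.Injective ι)
    (hsymm : ∀ x y, ⟪ι (Q.symm x), y⟫_ℝ = ⟪x, ι (Q.symm y)⟫_ℝ) : DenseRange ι := by
  refine denseRange_of_forall_inner_eq_zero fun v hv => ?_
  have hzero : ι (Q.symm v) = 0 :=
    ext_inner_left ℝ fun w => by rw [← hsymm, inner_zero_right, hv]
  exact (map_eq_zero_iff _ Q.symm.injective).1 ((map_eq_zero_iff ι hι).1 hzero)

theorem isQuasiSkewAdjoint_graphClosure (hι : Function.Injective ι)
    (hsymm : ∀ x y, ⟪ι (Q.symm x), y⟫_ℝ = ⟪x, ι (Q.symm y)⟫_ℝ)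
    (hconj : ∀ u, T (Q.symm (ι u)) = ι (Q.symm (T u + B (ι u)))) (hβ : 0 ≤ β)
    (hform : ∀ u, |⟪T u, ι u⟫_ℝ| ≤ β * ‖ι u‖ ^ 2) :
    IsQuasiSkewAdjoint (graphClosure ι T) β where
  nonneg := hβ
  form_le := graphClosure_form_le hform
  dense := (denseRange_of_symmetric hι hsymm).mono <| by
    rintro _ ⟨u, rfl⟩
    exact ⟨_, mk_mem_graphClosure ι T u, rfl⟩
  exists_surjective := by
    refine ⟨β + ‖B‖, fun r hr => exists_smul_sub_eq_of_dense (isClosed_graphClosure ι T)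
      (graphClosure_form_le hform) (by linarith [norm_nonneg B]) ?_⟩
    have hdense : DenseRange (r • ι - T) := denseRange_of_forall_inner_eq_zero fun v hv =>
      eq_zero_of_forall_inner_smul_sub_eq_zero hι hsymm hconj hform hr hv
    refine hdense.mono ?_
    rintro _ ⟨u, rfl⟩
    exact ⟨_, mk_mem_graphClosure ι T u, rfl⟩

end Conjugation

section ConjugationIdentity

variable {X Y : Type*} [NormedAddCommGroup X] [InnerProductSpace ℝ X] [CompleteSpace X]
  [NormedAddCommGroup Y] [InnerProductSpace ℝ Y] {ι T : Y →L[ℝ] X} {Q : Y ≃L[ℝ] X}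
  {B : X →L[ℝ] X} {β : ℝ}

theorem conjugationIdentity_of_graph_eq (hι : Function.Injective ι)
    (hconj : ∀ u, T (Q.symm (ι u)) = ι (Q.symm (T u + B (ι u))))
    (hΓ : IsQuasiSkewAdjoint (graphClosure ι T) β) {A : X →ₗ.[ℝ] X}
    (hA : A.graph = graphClosure ι T) : ConjugationIdentity ι Q A B := by
  intro x z
  rw [hA]
  refine ⟨?_, fun ⟨g, hg, hz⟩ => ⟨Q.symm z, hz ▸ mk_conj_mem_graphClosure hconj hg, by simp⟩⟩
  rintro ⟨w, hw, rfl⟩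
  -- `A + B - r` is onto, and `A - r` is injective on the image under `Q⁻¹`.
  obtain ⟨r₀, hsurj⟩ := hΓ.exists_surjective
  obtain ⟨r, hr₀, hr, hr0⟩ : ∃ r : ℝ, r₀ < r ∧ β + ‖B‖ < r ∧ 0 < r :=
    ((eventually_gt_atTop r₀).and ((eventually_gt_atTop _).and (eventually_gt_atTop 0))).exists
  rw [← abs_of_pos hr0] at hr₀ hr
  have hpos : 0 < |r| - β := by linarith [norm_nonneg B]
  obtain ⟨R, hR, hRnorm⟩ := exists_isResolvent hΓ.form_le (sub_pos.1 hpos) (hsurj r hr₀)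
  have hBR : ‖B * R‖ < 1 := by
    calc ‖B * R‖ ≤ ‖B‖ * (|r| - β)⁻¹ := (norm_mul_le _ _).trans (by gcongr)
      _ < 1 := by
        rw [← div_eq_mul_inv, div_lt_one hpos]
        linarith
  obtain ⟨p, hp, hpr⟩ := hR.exists_smul_sub_add_eq hBR (r • x - Q w)
  have hQw : Q w = r • (x - p.1) + (p.2 + B p.1) := by
    rw [smul_sub, sub_add, hpr, sub_sub_cancel]
  have hx : x = p.1 := by
    have hdiff := Submodule.sub_mem _ hw (mk_conj_mem_graphClosure hconj hp)
    have hle := mul_norm_fst_le_of_form_le (hΓ.form_le _ hdiff) r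
    have hzero : r • (ι (Q.symm x) - ι (Q.symm p.1)) - (ι w - ι (Q.symm (p.2 + B p.1))) = 0 := by
      rw [← Q.symm_apply_apply w, hQw]
      simp only [map_add, map_smul, map_sub]
      abel
    simp only [Prod.fst_sub, Prod.snd_sub] at hle
    rw [hzero, norm_zero] at hle
    have hnorm := norm_le_zero_iff.1 (nonpos_of_mul_nonpos_right hle hpos)
    exact Q.symm.injective (hι (sub_eq_zero.1 hnorm))
  refine ⟨p.2, hx ▸ hp, ?_⟩
  rw [hQw, hx, sub_self, smul_zero, zero_add]

end ConjugationIdentity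

/-! ### The operators `(1 - ∂ₓ²)^{-1/2}` and `∂ₓ(1 - ∂ₓ²)^{-1/2}` on `L²` -/

section SchwartzMultipliers

/-- A real Schwartz function as a complex one. -/
def schwartzOfReal : 𝓢(ℝ, ℝ) →L[ℝ] 𝓢(ℝ, ℂ) := SchwartzMap.postcompCLM Complex.ofRealCLM

@[simp]
theorem schwartzOfReal_apply (φ : 𝓢(ℝ, ℝ)) (x : ℝ) : schwartzOfReal φ x = φ x := rfl

theorem schwartzOfReal_injective : Function.Injective schwartzOfReal := fun _ _ h =>
  SchwartzMap.ext fun x => Complex.ofReal_injective (DFunLike.congr_fun h x)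

/-- The Fourier transform of a real Schwartz function. -/
def realFourier (φ : 𝓢(ℝ, ℝ)) : 𝓢(ℝ, ℂ) := 𝓕 (schwartzOfReal φ)

theorem realFourier_ext {φ ψ : 𝓢(ℝ, ℝ)} (h : ∀ ξ, realFourier φ ξ = realFourier ψ ξ) :
    φ = ψ := by
  have hinv := congrArg (fun f : 𝓢(ℝ, ℂ) => 𝓕⁻ f) (SchwartzMap.ext h)
  simp only [realFourier, FourierTransform.fourierInv_fourier_eq] at hinv
  exact schwartzOfReal_injective hinv

theorem realFourier_apply (φ : 𝓢(ℝ, ℝ)) (ξ : ℝ) :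
    realFourier φ ξ = ∫ x, Complex.exp (↑(-2 * Real.pi * x * ξ) * Complex.I) • (φ x : ℂ) := by
  rw [realFourier, SchwartzMap.fourier_coe, Real.fourier_real_eq_integral_exp_smul]
  rfl

theorem realFourier_neg (φ : 𝓢(ℝ, ℝ)) (ξ : ℝ) :
    realFourier φ (-ξ) = (starRingEnd ℂ) (realFourier φ ξ) := by
  rw [realFourier_apply, realFourier_apply, ← integral_conj]
  refine integral_congr_ae (Eventually.of_forall fun x => ?_)
  simp only [smul_eq_mul, map_mul, Complex.conj_ofReal, ← Complex.exp_conj, Complex.conj_I]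
  congr 2
  push_cast
  ring

theorem schwartzOfReal_deriv (φ : 𝓢(ℝ, ℝ)) :
    schwartzOfReal (SchwartzMap.derivCLM ℝ ℝ φ) =
      SchwartzMap.derivCLM ℝ ℂ (schwartzOfReal φ) :=
  SchwartzMap.ext fun x => ((φ.hasDerivAt x).ofReal_comp.deriv).symm

theorem realFourier_deriv (φ : 𝓢(ℝ, ℝ)) (ξ : ℝ) :
    realFourier (SchwartzMap.derivCLM ℝ ℝ φ) ξ =
      (2 * Real.pi * ξ : ℝ) * Complex.I * realFourier φ ξ := by
  rw [realFourier, schwartzOfReal_deriv, SchwartzMap.fourier_coe]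
  change 𝓕 (deriv (schwartzOfReal φ)) ξ = _
  rw [Real.fourier_deriv (schwartzOfReal φ).integrable (schwartzOfReal φ).differentiable
    (SchwartzMap.derivCLM ℝ ℂ (schwartzOfReal φ)).integrable]
  rw [realFourier, SchwartzMap.fourier_coe]
  simp only [smul_eq_mul]
  push_cast
  ring

theorem integral_inner_realFourier (φ ψ : 𝓢(ℝ, ℝ)) :
    ∫ ξ, ⟪realFourier φ ξ, realFourier ψ ξ⟫_ℂ = ((∫ x, φ x * ψ x : ℝ) : ℂ) := by
  rw [realFourier, realFourier, SchwartzMap.integral_inner_fourier_fourier,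
    ← integral_complex_ofReal]
  refine integral_congr_ae (Eventually.of_forall fun x => ?_)
  simp [mul_comm]

/-- The Fourier multiplier with symbol `m`, followed by taking the real part. -/
def realMultiplier (m : ℝ → ℂ) : 𝓢(ℝ, ℝ) →L[ℝ] 𝓢(ℝ, ℝ) :=
  (SchwartzMap.postcompCLM Complex.reCLM).comp
    (((SchwartzMap.fourierMultiplierCLM ℂ m).restrictScalars ℝ).comp schwartzOfReal)

theorem conj_fourierInv_of_conj_symm {g : 𝓢(ℝ, ℂ)}
    (hg : ∀ ξ, g (-ξ) = (starRingEnd ℂ) (g ξ)) (x : ℝ) :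
    (starRingEnd ℂ) ((𝓕⁻ g) x) = (𝓕⁻ g) x := by
  rw [SchwartzMap.fourierInv_coe, Real.fourierInv_eq', ← integral_conj, ← integral_neg_eq_self]
  refine integral_congr_ae (Eventually.of_forall fun ξ => ?_)
  simp only [smul_eq_mul, map_mul, ← Complex.exp_conj, Complex.conj_I, hg,
    Complex.conj_ofReal, RingHomCompTriple.comp_apply, RingHom.id_apply, inner_neg_left]
  congr 2
  push_cast
  ring

theorem realFourier_realMultiplier {m : ℝ → ℂ} (hm : m.HasTemperateGrowth)
    (hsymm : ∀ ξ, m (-ξ) = (starRingEnd ℂ) (m ξ)) (φ : 𝓢(ℝ, ℝ)) (ξ : ℝ) :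
    realFourier (realMultiplier m φ) ξ = m ξ * realFourier φ ξ := by
  set g : 𝓢(ℝ, ℂ) := SchwartzMap.smulLeftCLM ℂ m (realFourier φ) with hg
  have g_apply : ∀ ξ, g ξ = m ξ * realFourier φ ξ := fun ξ => by
    rw [hg, SchwartzMap.smulLeftCLM_apply_apply hm, smul_eq_mul]
  have g_symm : ∀ ξ, g (-ξ) = (starRingEnd ℂ) (g ξ) := fun ξ => by
    rw [g_apply, g_apply, hsymm, realFourier_neg, map_mul]
  have eq_fourierInv : schwartzOfReal (realMultiplier m φ) = 𝓕⁻ g :=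
    SchwartzMap.ext fun x => Complex.conj_eq_iff_re.1 (conj_fourierInv_of_conj_symm g_symm x)
  rw [realFourier, eq_fourierInv, FourierTransform.fourier_fourierInv_eq, g_apply]

theorem integral_realMultiplier_mul {m m' : ℝ → ℂ} (hm : m.HasTemperateGrowth)
    (hsymm : ∀ ξ, m (-ξ) = (starRingEnd ℂ) (m ξ)) (hm' : m'.HasTemperateGrowth)
    (hconj : ∀ ξ, m' ξ = (starRingEnd ℂ) (m ξ)) (φ ψ : 𝓢(ℝ, ℝ)) :
    ∫ x, realMultiplier m φ x * ψ x = ∫ x, φ x * realMultiplier m' ψ x := by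
  have hsymm' : ∀ ξ, m' (-ξ) = (starRingEnd ℂ) (m' ξ) := fun ξ => by
    rw [hconj, hconj, hsymm]
  apply Complex.ofReal_injective
  rw [← integral_inner_realFourier, ← integral_inner_realFourier]
  refine integral_congr_ae (Eventually.of_forall fun ξ => ?_)
  simp only [realFourier_realMultiplier hm hsymm, realFourier_realMultiplier hm' hsymm', hconj,
    RCLike.inner_apply, map_mul]
  ring

/-- The symbol of `(1 - ∂ₓ²)^{-1/2}`. -/
def besselSymbol (ξ : ℝ) : ℝ := (Real.sqrt (1 + (2 * Real.pi * ξ) ^ 2))⁻¹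

theorem one_add_two_pi_mul_sq_pos (ξ : ℝ) : 0 < 1 + (2 * Real.pi * ξ) ^ 2 := by positivity

theorem besselSymbol_pos (ξ : ℝ) : 0 < besselSymbol ξ :=
  inv_pos.2 (Real.sqrt_pos.2 (one_add_two_pi_mul_sq_pos ξ))

theorem besselSymbol_sq (ξ : ℝ) : besselSymbol ξ ^ 2 * (1 + (2 * Real.pi * ξ) ^ 2) = 1 := by
  rw [besselSymbol, inv_pow, Real.sq_sqrt (one_add_two_pi_mul_sq_pos ξ).le,
    inv_mul_cancel₀ (one_add_two_pi_mul_sq_pos ξ).ne']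

theorem besselSymbol_neg (ξ : ℝ) : besselSymbol (-ξ) = besselSymbol ξ := by
  simp [besselSymbol]

@[fun_prop]
theorem besselSymbol_hasTemperateGrowth : besselSymbol.HasTemperateGrowth := by
  have rpow_growth := (Function.hasTemperateGrowth_one_add_norm_sq_rpow ℝ (-1 / 2 : ℝ)).comp
    (f := fun ξ : ℝ => 2 * Real.pi * ξ) (by fun_prop)
  have eq_rpow : besselSymbol = (fun x : ℝ => (1 + ‖x‖ ^ 2) ^ (-1 / 2 : ℝ)) ∘
      fun ξ : ℝ => 2 * Real.pi * ξ := by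
    funext ξ
    simp only [Function.comp_apply, Real.norm_eq_abs, sq_abs, besselSymbol]
    rw [Real.sqrt_eq_rpow, ← Real.rpow_neg (one_add_two_pi_mul_sq_pos ξ).le]
    norm_num
  rwa [eq_rpow]

/-- The symbol of `∂ₓ(1 - ∂ₓ²)^{-1/2}`. -/
def rieszSymbol (ξ : ℝ) : ℂ := (2 * Real.pi * ξ : ℝ) * Complex.I * besselSymbol ξ

theorem besselSymbol_ofReal_hasTemperateGrowth :
    (fun ξ => (besselSymbol ξ : ℂ)).HasTemperateGrowth := by fun_prop

theorem rieszSymbol_hasTemperateGrowth : rieszSymbol.HasTemperateGrowth := by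
  unfold rieszSymbol
  fun_prop

/-- `(1 - ∂ₓ²)^{-1/2}` on real Schwartz functions. -/
def schwartzBessel : 𝓢(ℝ, ℝ) →L[ℝ] 𝓢(ℝ, ℝ) := realMultiplier fun ξ => besselSymbol ξ

/-- `∂ₓ(1 - ∂ₓ²)^{-1/2}` on real Schwartz functions. -/
def schwartzRiesz : 𝓢(ℝ, ℝ) →L[ℝ] 𝓢(ℝ, ℝ) := realMultiplier rieszSymbol

theorem besselSymbol_symm (ξ : ℝ) :
    (besselSymbol (-ξ) : ℂ) = (starRingEnd ℂ) (besselSymbol ξ : ℂ) := by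
  rw [besselSymbol_neg, Complex.conj_ofReal]

theorem rieszSymbol_symm (ξ : ℝ) : rieszSymbol (-ξ) = (starRingEnd ℂ) (rieszSymbol ξ) := by
  simp only [rieszSymbol, besselSymbol_neg, map_mul, Complex.conj_ofReal, Complex.conj_I]
  push_cast
  ring

theorem realFourier_schwartzBessel (φ : 𝓢(ℝ, ℝ)) (ξ : ℝ) :
    realFourier (schwartzBessel φ) ξ = besselSymbol ξ * realFourier φ ξ :=
  realFourier_realMultiplier besselSymbol_ofReal_hasTemperateGrowth besselSymbol_symm φ ξ

theorem realFourier_schwartzRiesz (φ : 𝓢(ℝ, ℝ)) (ξ : ℝ) :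
    realFourier (schwartzRiesz φ) ξ = rieszSymbol ξ * realFourier φ ξ :=
  realFourier_realMultiplier rieszSymbol_hasTemperateGrowth rieszSymbol_symm φ ξ

theorem realFourier_sub (φ ψ : 𝓢(ℝ, ℝ)) (ξ : ℝ) :
    realFourier (φ - ψ) ξ = realFourier φ ξ - realFourier ψ ξ := by
  rw [realFourier, map_sub]
  exact DFunLike.congr_fun (map_sub (FourierTransform.fourierCLM ℂ 𝓢(ℝ, ℂ))
    (schwartzOfReal φ) (schwartzOfReal ψ)) ξ

theorem deriv_schwartzBessel (φ : 𝓢(ℝ, ℝ)) :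
    SchwartzMap.derivCLM ℝ ℝ (schwartzBessel φ) = schwartzRiesz φ := by
  refine realFourier_ext fun ξ => ?_
  rw [realFourier_deriv, realFourier_schwartzBessel, realFourier_schwartzRiesz, rieszSymbol]
  ring

theorem schwartzBessel_deriv (φ : 𝓢(ℝ, ℝ)) :
    schwartzBessel (SchwartzMap.derivCLM ℝ ℝ φ) = schwartzRiesz φ := by
  refine realFourier_ext fun ξ => ?_
  rw [realFourier_schwartzBessel, realFourier_deriv, realFourier_schwartzRiesz, rieszSymbol]
  ring

theorem schwartzBessel_riesz (φ : 𝓢(ℝ, ℝ)) :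
    schwartzBessel (schwartzRiesz φ) = schwartzRiesz (schwartzBessel φ) := by
  refine realFourier_ext fun ξ => ?_
  simp only [realFourier_schwartzBessel, realFourier_schwartzRiesz]
  ring

theorem schwartzBessel_sq_sub (φ : 𝓢(ℝ, ℝ)) :
    schwartzBessel (schwartzBessel φ) - schwartzRiesz (schwartzRiesz φ) = φ := by
  refine realFourier_ext fun ξ => ?_
  simp only [realFourier_sub, realFourier_schwartzBessel, realFourier_schwartzRiesz, rieszSymbol]
  have symbol_sq : (besselSymbol ξ : ℂ) ^ 2 * (1 + ((2 * Real.pi * ξ : ℝ) : ℂ) ^ 2) = 1 := by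
    exact_mod_cast besselSymbol_sq ξ
  linear_combination realFourier φ ξ * symbol_sq -
    ((2 * Real.pi * ξ : ℝ) : ℂ) ^ 2 * (besselSymbol ξ : ℂ) ^ 2 * realFourier φ ξ *
      Complex.I_sq

theorem integral_schwartzBessel_mul (φ ψ : 𝓢(ℝ, ℝ)) :
    ∫ x, schwartzBessel φ x * ψ x = ∫ x, φ x * schwartzBessel ψ x :=
  integral_realMultiplier_mul besselSymbol_ofReal_hasTemperateGrowth besselSymbol_symm
    besselSymbol_ofReal_hasTemperateGrowth (fun _ => (Complex.conj_ofReal _).symm) φ ψ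

theorem integral_schwartzRiesz_mul (φ ψ : 𝓢(ℝ, ℝ)) :
    ∫ x, schwartzRiesz φ x * ψ x = -∫ x, φ x * schwartzRiesz ψ x := by
  have integration_by_parts :=
    SchwartzMap.integral_mul_deriv_eq_neg_deriv_mul ψ (schwartzBessel φ)
  rw [← deriv_schwartzBessel, ← schwartzBessel_deriv, ← integral_schwartzBessel_mul]
  simp only [SchwartzMap.derivCLM_apply]
  simp only [mul_comm _ (ψ _), integration_by_parts, mul_comm (deriv ψ _)]

end SchwartzMultipliers

section L2Operators

theorem denseRange_toLp_real : DenseRange fun φ : 𝓢(ℝ, ℝ) => (φ.toLp 2 : RealL2) :=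
  SchwartzMap.denseRange_toLpCLM (F := ℝ) (E := ℝ) (μ := volume) ENNReal.ofNat_ne_top

theorem inner_toLp_right (w : RealL2) (ψ : 𝓢(ℝ, ℝ)) : ⟪w, ψ.toLp 2⟫_ℝ = ∫ x, w x * ψ x := by
  rw [L2.inner_def]
  refine integral_congr_ae ?_
  filter_upwards [ψ.coeFn_toLp 2] with x hx
  rw [hx]
  simp [mul_comm]

theorem inner_toLp_toLp (φ ψ : 𝓢(ℝ, ℝ)) :
    ⟪(φ.toLp 2 : RealL2), ψ.toLp 2⟫_ℝ = ∫ x, φ x * ψ x := by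
  rw [inner_toLp_right]
  refine integral_congr_ae ?_
  filter_upwards [φ.coeFn_toLp 2] with x hx
  rw [hx]

theorem toLp_eq_sub (φ : 𝓢(ℝ, ℝ)) : (φ.toLp 2 : RealL2) =
    ((schwartzBessel (schwartzBessel φ)).toLp 2 : RealL2) -
      ((schwartzRiesz (schwartzRiesz φ)).toLp 2 : RealL2) := by
  have h := map_sub (SchwartzMap.toLpCLM ℝ ℝ 2 (volume : Measure ℝ))
    (schwartzBessel (schwartzBessel φ)) (schwartzRiesz (schwartzRiesz φ))
  rwa [schwartzBessel_sq_sub] at h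

theorem norm_sq_schwartzBessel_add (φ : 𝓢(ℝ, ℝ)) :
    ‖((schwartzBessel φ).toLp 2 : RealL2)‖ ^ 2 + ‖((schwartzRiesz φ).toLp 2 : RealL2)‖ ^ 2 =
      ‖(φ.toLp 2 : RealL2)‖ ^ 2 := by
  have inner_self := congrArg (fun f : RealL2 => ⟪(φ.toLp 2 : RealL2), f⟫_ℝ) (toLp_eq_sub φ)
  simp only [inner_sub_right, inner_toLp_toLp, ← integral_schwartzBessel_mul φ] at inner_self
  simp only [← real_inner_self_eq_norm_sq, inner_toLp_toLp, inner_self,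
    integral_schwartzRiesz_mul φ]
  ring

/-- The extension to `L²` of an `L²`-bounded operator on Schwartz functions (and `0` if the
operator is not bounded). -/
def l2Extension (T : 𝓢(ℝ, ℝ) →L[ℝ] 𝓢(ℝ, ℝ)) : RealL2 →L[ℝ] RealL2 :=
  ((SchwartzMap.toLpCLM ℝ ℝ 2 volume).comp T).toLinearMap.extendOfNorm
    (SchwartzMap.toLpCLM ℝ ℝ 2 (volume : Measure ℝ)).toLinearMap

theorem l2Extension_toLp {T : 𝓢(ℝ, ℝ) →L[ℝ] 𝓢(ℝ, ℝ)} {C : ℝ}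
    (hT : ∀ φ, ‖((T φ).toLp 2 : RealL2)‖ ≤ C * ‖(φ.toLp 2 : RealL2)‖) (φ : 𝓢(ℝ, ℝ)) :
    l2Extension T (φ.toLp 2) = (T φ).toLp 2 :=
  LinearMap.extendOfNorm_eq (𝕜 := ℝ)
    (e := (SchwartzMap.toLpCLM ℝ ℝ 2 (volume : Measure ℝ)).toLinearMap)
    denseRange_toLp_real ⟨C, hT⟩ φ

/-- `(1 - ∂ₓ²)^{-1/2}` on `L²`. -/
def bessel : RealL2 →L[ℝ] RealL2 := l2Extension schwartzBessel

/-- `∂ₓ(1 - ∂ₓ²)^{-1/2}` on `L²`. -/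
def riesz : RealL2 →L[ℝ] RealL2 := l2Extension schwartzRiesz

theorem bessel_toLp (φ : 𝓢(ℝ, ℝ)) : bessel (φ.toLp 2) = (schwartzBessel φ).toLp 2 := by
  refine l2Extension_toLp (C := 1) (fun ψ => ?_) φ
  rw [one_mul]
  refine le_of_sq_le_sq ?_ (norm_nonneg _)
  exact (le_add_of_nonneg_right (sq_nonneg _)).trans (norm_sq_schwartzBessel_add ψ).le

theorem riesz_toLp (φ : 𝓢(ℝ, ℝ)) : riesz (φ.toLp 2) = (schwartzRiesz φ).toLp 2 := by
  refine l2Extension_toLp (C := 1) (fun ψ => ?_) φ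
  rw [one_mul]
  refine le_of_sq_le_sq ?_ (norm_nonneg _)
  exact (le_add_of_nonneg_left (sq_nonneg _)).trans (norm_sq_schwartzBessel_add ψ).le

theorem norm_sq_bessel_add (f : RealL2) : ‖bessel f‖ ^ 2 + ‖riesz f‖ ^ 2 = ‖f‖ ^ 2 := by
  refine denseRange_toLp_real.induction_on f (isClosed_eq (by fun_prop) (by fun_prop)) fun φ => ?_
  rw [bessel_toLp, riesz_toLp]
  exact norm_sq_schwartzBessel_add φ

theorem bessel_symm (f g : RealL2) : ⟪bessel f, g⟫_ℝ = ⟪f, bessel g⟫_ℝ := by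
  refine denseRange_toLp_real.induction_on f (isClosed_eq (by fun_prop) (by fun_prop)) fun φ => ?_
  refine denseRange_toLp_real.induction_on g (isClosed_eq (by fun_prop) (by fun_prop)) fun ψ => ?_
  rw [bessel_toLp, bessel_toLp, inner_toLp_toLp, inner_toLp_toLp, integral_schwartzBessel_mul]

theorem riesz_skew (f g : RealL2) : ⟪riesz f, g⟫_ℝ = -⟪f, riesz g⟫_ℝ := by
  refine denseRange_toLp_real.induction_on f (isClosed_eq (by fun_prop) (by fun_prop)) fun φ => ?_
  refine denseRange_toLp_real.induction_on g (isClosed_eq (by fun_prop) (by fun_prop)) fun ψ => ?_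
  rw [riesz_toLp, riesz_toLp, inner_toLp_toLp, inner_toLp_toLp, integral_schwartzRiesz_mul]

theorem bessel_riesz (f : RealL2) : bessel (riesz f) = riesz (bessel f) := by
  refine denseRange_toLp_real.induction_on f (isClosed_eq (by fun_prop) (by fun_prop)) fun φ => ?_
  rw [riesz_toLp, bessel_toLp, bessel_toLp, riesz_toLp, schwartzBessel_riesz]

theorem bessel_sq_sub (f : RealL2) : bessel (bessel f) - riesz (riesz f) = f := by
  refine denseRange_toLp_real.induction_on f (isClosed_eq (by fun_prop) (by fun_prop)) fun φ => ?_
  rw [riesz_toLp, bessel_toLp, bessel_toLp, riesz_toLp]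
  exact (toLp_eq_sub φ).symm

theorem hasWeakDeriv_toLp (φ : 𝓢(ℝ, ℝ)) :
    HasWeakDeriv (φ.toLp 2) ((SchwartzMap.derivCLM ℝ ℝ φ).toLp 2) := by
  rw [hasWeakDeriv_iff_inner]
  intro ψ
  rw [inner_toLp_toLp, inner_toLp_toLp]
  exact SchwartzMap.integral_mul_deriv_eq_neg_deriv_mul φ ψ

theorem isClosed_setOf_hasWeakDeriv : IsClosed {p : RealL2 × RealL2 | HasWeakDeriv p.1 p.2} := by
  simp only [hasWeakDeriv_iff_inner, Set.ofPred_forall]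
  exact isClosed_iInter fun φ => isClosed_eq (by fun_prop) (by fun_prop)

theorem hasWeakDeriv_bessel (f : RealL2) : HasWeakDeriv (bessel f) (riesz f) := by
  refine denseRange_toLp_real.induction_on f
    (isClosed_setOf_hasWeakDeriv.preimage (f := fun f => (bessel f, riesz f)) (by fun_prop))
    fun φ => ?_
  rw [bessel_toLp, riesz_toLp, ← deriv_schwartzBessel]
  exact hasWeakDeriv_toLp _

theorem HasWeakDeriv.bessel_sub {u v : RealL2} (h : HasWeakDeriv u v) :
    bessel (bessel u - riesz v) = u := by
  rw [hasWeakDeriv_iff_inner] at h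
  rw [← sub_eq_zero]
  refine denseRange_toLp_real.eq_zero_of_inner_left ℝ fun φ => ?_
  have inner_riesz_riesz := h (schwartzBessel (schwartzRiesz φ))
  rw [deriv_schwartzBessel, ← riesz_toLp, ← riesz_toLp, ← bessel_toLp, ← riesz_toLp]
    at inner_riesz_riesz
  have inner_split := congrArg (fun g => ⟪u, g⟫_ℝ) (bessel_sq_sub (φ.toLp 2))
  simp only [inner_sub_right] at inner_split
  rw [map_sub, inner_sub_left, inner_sub_left, bessel_symm, bessel_symm, bessel_symm, riesz_skew,
    ← bessel_riesz]
  linarith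

theorem HasWeakDeriv.map_bessel {u v : RealL2} (h : HasWeakDeriv u v) :
    HasWeakDeriv (bessel u) (bessel v) := by
  rw [hasWeakDeriv_iff_inner] at h ⊢
  intro φ
  have hφ := h (schwartzBessel φ)
  rw [deriv_schwartzBessel, ← schwartzBessel_deriv, ← bessel_toLp, ← bessel_toLp] at hφ
  rw [bessel_symm, bessel_symm, hφ]

theorem HasWeakDeriv.riesz_eq {u v : RealL2} (h : HasWeakDeriv u v) : riesz u = bessel v :=
  (hasWeakDeriv_bessel u).unique h.map_bessel

theorem bessel_injective : Function.Injective bessel := by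
  rw [injective_iff_map_eq_zero]
  intro f hf
  have hriesz : riesz f = 0 := (hasWeakDeriv_bessel f).unique (hf ▸ hasWeakDeriv_zero)
  rw [← bessel_sq_sub f, hf, hriesz, map_zero, map_zero, sub_zero]

theorem HasWeakDeriv.map_riesz {u v : RealL2} (h : HasWeakDeriv u v) :
    HasWeakDeriv (riesz u) (riesz v) := by
  rw [h.riesz_eq]
  exact hasWeakDeriv_bessel v

theorem HasWeakDeriv.sub {u u₁ v v₁ : RealL2} (hu : HasWeakDeriv u u₁) (hv : HasWeakDeriv v v₁) :
    HasWeakDeriv (u - v) (u₁ - v₁) := by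
  have := hu.add (hv.smul (-1))
  rwa [neg_one_smul, neg_one_smul, ← sub_eq_add_neg, ← sub_eq_add_neg] at this

theorem HasWeakDeriv.inner_eq_neg {u u₁ v v₁ : RealL2} (hu : HasWeakDeriv u u₁)
    (hv : HasWeakDeriv v v₁) : ⟪u₁, v⟫_ℝ = -⟪u, v₁⟫_ℝ := by
  obtain ⟨g, hg⟩ : ∃ g, bessel g = v := ⟨_, hv.bessel_sub⟩
  have hv₁ : v₁ = riesz g := hv.unique (hg ▸ hasWeakDeriv_bessel g)
  rw [← hg, hv₁, ← bessel_symm, ← hu.riesz_eq, riesz_skew]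

end L2Operators

section Fourier

/-- The Fourier transform on real `L²`. -/
def fourierL2 (f : RealL2) : Lp ℂ 2 (volume : Measure ℝ) := 𝓕 (Complex.ofRealCLM.compLp f)

theorem continuous_fourierL2 : Continuous fourierL2 :=
  (MeasureTheory.Lp.fourierTransformₗᵢ ℝ ℂ).continuous.comp
    (Complex.ofRealCLM.compLpL 2 (volume : Measure ℝ)).continuous

theorem fourierL2_toLp (φ : 𝓢(ℝ, ℝ)) : fourierL2 (φ.toLp 2) = (realFourier φ).toLp 2 := by
  rw [fourierL2, realFourier, ← SchwartzMap.toLp_fourier_eq]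
  congr 1

theorem besselSymbol_le_one (ξ : ℝ) : besselSymbol ξ ≤ 1 := by
  refine inv_le_one_of_one_le₀ ?_
  rw [Real.one_le_sqrt]
  linarith [sq_nonneg (2 * Real.pi * ξ)]

theorem exists_clm_coeFn_eq_mul {m : ℝ → ℂ} (hm : MemLp m ⊤ (volume : Measure ℝ)) :
    ∃ M : Lp ℂ 2 (volume : Measure ℝ) →L[ℂ] Lp ℂ 2 (volume : Measure ℝ),
      ∀ g, M g =ᵐ[volume] fun ξ => m ξ * g ξ := by
  refine ⟨(ContinuousLinearMap.mul ℂ ℂ).holderL volume ⊤ 2 2 hm.toLp, fun g => ?_⟩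
  filter_upwards [(ContinuousLinearMap.mul ℂ ℂ).coeFn_holder (r := 2) hm.toLp g, hm.coeFn_toLp]
    with ξ holder_apply toLp_apply
  rw [← toLp_apply]
  exact holder_apply

theorem memLp_top_besselSymbol :
    MemLp (fun ξ => (besselSymbol ξ : ℂ)) ⊤ (volume : Measure ℝ) := by
  refine memLp_top_of_bound
    besselSymbol_ofReal_hasTemperateGrowth.1.continuous.aestronglyMeasurable 1
    (Eventually.of_forall fun ξ => ?_)
  rw [Complex.norm_real, Real.norm_of_nonneg (besselSymbol_pos ξ).le]
  exact besselSymbol_le_one ξ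

theorem fourierL2_bessel (f : RealL2) :
    fourierL2 (bessel f) =ᵐ[volume] fun ξ => (besselSymbol ξ : ℂ) * fourierL2 f ξ := by
  obtain ⟨M, hM⟩ := exists_clm_coeFn_eq_mul memLp_top_besselSymbol
  suffices fourierL2 (bessel f) = M (fourierL2 f) from this ▸ hM _
  have := continuous_fourierL2
  refine denseRange_toLp_real.induction_on f (isClosed_eq (by fun_prop) (by fun_prop))
    fun φ => ?_
  rw [bessel_toLp, fourierL2_toLp, fourierL2_toLp]
  ext1
  filter_upwards [hM ((realFourier φ).toLp 2), (realFourier φ).coeFn_toLp 2,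
    (realFourier (schwartzBessel φ)).coeFn_toLp 2] with ξ hMφ hφ hbessel
  rw [hMφ, hφ, hbessel, realFourier_schwartzBessel]

end Fourier

/-! ### Sobolev spaces -/

theorem HasWeakDeriv.memSobolevSpace_succ {n : ℕ} {u v : RealL2} (h : HasWeakDeriv u v)
    (hv : MemSobolevSpace n v) : MemSobolevSpace (n + 1) u := by
  rintro (_ | k) hk
  · simpa only [Function.iterate_succ_apply, Function.iterate_zero, id_eq, h.weakDeriv_eq] using h
  · rw [Function.iterate_succ_apply, Function.iterate_succ_apply, h.weakDeriv_eq]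
    exact hv k (by omega)

namespace SobolevSpace

theorem memSobolevSpace_zero (u : RealL2) : MemSobolevSpace 0 u := fun k hk => by omega

variable {n : ℕ}

theorem hasWeakDeriv (u : SobolevSpace (n + 1)) : HasWeakDeriv u.toL2 u.deriv.toL2 :=
  u.mem 0 (by omega)

theorem toL2_incl (u : SobolevSpace (n + 1)) : (incl u).toL2 = u.toL2 := rfl

theorem deriv_incl (u : SobolevSpace (n + 2)) : (incl u).deriv = incl u.deriv := rfl

theorem norm_one_sq (u : SobolevSpace 1) : ‖u‖ ^ 2 = ‖u.toL2‖ ^ 2 + ‖u.deriv.toL2‖ ^ 2 := by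
  rw [norm_sq_eq, Finset.sum_range_succ, Finset.sum_range_one]
  simp only [Nat.choose_self, Nat.choose_zero_right, Nat.cast_one, one_mul]
  rfl

theorem norm_two_sq (u : SobolevSpace 2) :
    ‖u‖ ^ 2 = ‖u.toL2‖ ^ 2 + 2 * ‖u.deriv.toL2‖ ^ 2 + ‖u.deriv.deriv.toL2‖ ^ 2 := by
  rw [norm_sq_eq, Finset.sum_range_succ, Finset.sum_range_succ, Finset.sum_range_one]
  simp only [Nat.choose_self, Nat.choose_zero_right, Nat.choose_one_right, Nat.cast_one, one_mul,
    Nat.cast_ofNat]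
  rfl

theorem inner_one (u v : SobolevSpace 1) :
    ⟪u, v⟫_ℝ = ⟪u.toL2, v.toL2⟫_ℝ + ⟪u.deriv.toL2, v.deriv.toL2⟫_ℝ := by
  rw [inner_eq, Finset.sum_range_succ, Finset.sum_range_one]
  simp only [Nat.choose_self, Nat.choose_zero_right, Nat.cast_one, one_mul]
  rfl

/-- The element of `H^{n+1}` with a given derivative in `Hⁿ`. -/
def mk (u : RealL2) (v : SobolevSpace n) (h : HasWeakDeriv u v.toL2) : SobolevSpace (n + 1) :=
  ⟨u, h.memSobolevSpace_succ v.mem⟩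

theorem toL2_mk (u : RealL2) (v : SobolevSpace n) (h : HasWeakDeriv u v.toL2) :
    (mk u v h).toL2 = u := rfl

theorem deriv_mk (u : RealL2) (v : SobolevSpace n) (h : HasWeakDeriv u v.toL2) :
    (mk u v h).deriv = v :=
  toL2_injective ((mk u v h).hasWeakDeriv.unique h)

theorem ext {u v : SobolevSpace n} (h : u.toL2 = v.toL2) : u = v := toL2_injective h

/-- An `L²` function as an element of `H⁰`. -/
def ofL2 (u : RealL2) : SobolevSpace 0 := ⟨u, memSobolevSpace_zero u⟩

/-- The element of `H¹` with a given derivative in `L²`. -/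
def mkOne (u v : RealL2) (h : HasWeakDeriv u v) : SobolevSpace 1 := mk u (ofL2 v) h

theorem toL2_mkOne (u v : RealL2) (h : HasWeakDeriv u v) : (mkOne u v h).toL2 = u := rfl

theorem toL2_deriv_mkOne (u v : RealL2) (h : HasWeakDeriv u v) :
    (mkOne u v h).deriv.toL2 = v :=
  congrArg toL2 (deriv_mk u (ofL2 v) h)

/-- `(1 - ∂ₓ²)^{-1/2}` as an isometry of `L²` into `H¹`. -/
def besselL2 : RealL2 →ₗᵢ[ℝ] SobolevSpace 1 where
  toFun f := mkOne (bessel f) (riesz f) (hasWeakDeriv_bessel f)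
  map_add' f g := ext (map_add bessel f g)
  map_smul' c f := ext (map_smul bessel c f)
  norm_map' f := by
    refine (sq_eq_sq₀ (norm_nonneg _) (norm_nonneg _)).1 ?_
    change ‖mkOne (bessel f) (riesz f) (hasWeakDeriv_bessel f)‖ ^ 2 = _
    rw [norm_one_sq, toL2_mkOne, toL2_deriv_mkOne, norm_sq_bessel_add]

theorem toL2_besselL2 (f : RealL2) : (besselL2 f).toL2 = bessel f := rfl

theorem toL2_deriv_besselL2 (f : RealL2) : (besselL2 f).deriv.toL2 = riesz f :=
  toL2_deriv_mkOne _ _ (hasWeakDeriv_bessel f)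

theorem besselL2_surjective : Function.Surjective besselL2 := fun u =>
  ⟨bessel u.toL2 - riesz u.deriv.toL2, ext u.hasWeakDeriv.bessel_sub⟩

theorem hasWeakDeriv_bessel_toL2 (u : SobolevSpace 1) :
    HasWeakDeriv (bessel u.toL2) (besselL2 u.deriv.toL2).toL2 := by
  rw [toL2_besselL2]
  exact u.hasWeakDeriv.map_bessel

/-- `(1 - ∂ₓ²)^{-1/2}` as an isometry of `H¹` into `H²`. -/
def besselUp : SobolevSpace 1 →ₗᵢ[ℝ] SobolevSpace 2 where
  toFun u := mk (bessel u.toL2) (besselL2 u.deriv.toL2) u.hasWeakDeriv_bessel_toL2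
  map_add' u v := ext (by
    rw [toL2_mk, map_add, map_add, map_add]
    rfl)
  map_smul' c u := ext (by
    rw [toL2_mk, map_smul, map_smul, map_smul]
    rfl)
  norm_map' u := by
    refine (sq_eq_sq₀ (norm_nonneg _) (norm_nonneg _)).1 ?_
    change ‖mk (bessel u.toL2) (besselL2 u.deriv.toL2) u.hasWeakDeriv_bessel_toL2‖ ^ 2 = _
    rw [norm_two_sq, toL2_mk, deriv_mk, toL2_deriv_besselL2, toL2_besselL2, norm_one_sq,
      ← norm_sq_bessel_add u.toL2, ← norm_sq_bessel_add u.deriv.toL2, u.hasWeakDeriv.riesz_eq]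
    ring

theorem toL2_besselUp (u : SobolevSpace 1) : (besselUp u).toL2 = bessel u.toL2 := rfl

theorem deriv_besselUp (u : SobolevSpace 1) : (besselUp u).deriv = besselL2 u.deriv.toL2 :=
  deriv_mk _ _ u.hasWeakDeriv_bessel_toL2

theorem toL2_incl_besselUp (u : SobolevSpace 1) : (incl (besselUp u)).toL2 = bessel u.toL2 := rfl

theorem toL2_deriv_incl_besselUp (u : SobolevSpace 1) :
    (incl (besselUp u)).deriv.toL2 = bessel u.deriv.toL2 := by
  rw [deriv_incl, deriv_besselUp]
  rfl

theorem besselUp_surjective : Function.Surjective besselUp := by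
  intro u
  refine ⟨mkOne (bessel u.toL2 - riesz u.deriv.toL2)
    (bessel u.deriv.toL2 - riesz u.deriv.deriv.toL2)
    (u.hasWeakDeriv.map_bessel.sub u.deriv.hasWeakDeriv.map_riesz), ext ?_⟩
  rw [toL2_besselUp, toL2_mkOne]
  exact u.hasWeakDeriv.bessel_sub

/-- `(1 - ∂ₓ²)^{1/2}` as an isometric isomorphism of `H²` onto `H¹`. -/
def sqrtOneSub : SobolevSpace 2 ≃ₗᵢ[ℝ] SobolevSpace 1 :=
  (LinearIsometryEquiv.ofSurjective besselUp besselUp_surjective).symm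

theorem sqrtOneSub_besselUp (u : SobolevSpace 1) : sqrtOneSub (besselUp u) = u :=
  sqrtOneSub.apply_symm_apply u

theorem isSqrtOneSubDerivSq_sqrtOneSub : IsSqrtOneSubDerivSq sqrtOneSub := by
  intro v
  obtain ⟨u, rfl⟩ := besselUp_surjective v
  rw [sqrtOneSub_besselUp]
  filter_upwards [fourierL2_bessel u.toL2] with ξ h
  change fourierL2 u.toL2 ξ = _ * fourierL2 (bessel u.toL2) ξ
  rw [h, ← mul_assoc, besselSymbol]
  have sqrt_ne_zero : (Real.sqrt (1 + (2 * Real.pi * ξ) ^ 2) : ℂ) ≠ 0 := by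
    exact_mod_cast (Real.sqrt_pos.2 (one_add_two_pi_mul_sq_pos ξ)).ne'
  rw [Complex.ofReal_inv, mul_inv_cancel₀ sqrt_ne_zero, one_mul]

theorem incl_injective : Function.Injective (incl (n := n)) := fun u v h =>
  ext (congrArg toL2 h : (incl u).toL2 = (incl v).toL2)

theorem inner_incl_besselUp (u v : SobolevSpace 1) :
    ⟪incl (besselUp u), v⟫_ℝ = ⟪u, incl (besselUp v)⟫_ℝ := by
  rw [inner_one, inner_one]
  simp only [toL2_incl_besselUp, toL2_deriv_incl_besselUp, bessel_symm]

end SobolevSpace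

section Schwartz

theorem integrable_schwartz_mul (φ ψ : 𝓢(ℝ, ℝ)) : Integrable fun x => φ x * ψ x :=
  ((SchwartzMap.pairing (ContinuousLinearMap.mul ℝ ℝ) φ ψ).integrable (μ := volume)).congr
    (Eventually.of_forall fun x => by simp)

theorem hasDerivAt_schwartz_sq (φ : 𝓢(ℝ, ℝ)) (x : ℝ) :
    HasDerivAt (fun y => φ y ^ 2) (2 * (φ x * deriv φ x)) x :=
  ((φ.hasDerivAt x).pow 2).congr_deriv (by simp only [Nat.cast_ofNat]; ring)

theorem schwartz_sq_eq_integral_Iic (φ : 𝓢(ℝ, ℝ)) (x : ℝ) :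
    φ x ^ 2 = ∫ y in Set.Iic x, 2 * (φ y * deriv φ y) := by
  have hint : Integrable fun y => 2 * (φ y * deriv φ y) :=
    (integrable_schwartz_mul φ (SchwartzMap.derivCLM ℝ ℝ φ)).const_mul 2
  have hlim : Tendsto (fun y => φ y ^ 2) atBot (𝓝 0) := by
    simpa using ((SchwartzMap.tendsto_cocompact φ).mono_left atBot_le_cocompact).pow 2
  rw [integral_Iic_of_hasDerivAt_of_tendsto
    (hasDerivAt_schwartz_sq φ x).continuousAt.continuousWithinAt
    (fun y _ => hasDerivAt_schwartz_sq φ y) hint.integrableOn hlim, sub_zero]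

theorem schwartz_sq_le (φ : 𝓢(ℝ, ℝ)) (x : ℝ) :
    φ x ^ 2 ≤ ‖(φ.toLp 2 : RealL2)‖ ^ 2 +
      ‖((SchwartzMap.derivCLM ℝ ℝ φ).toLp 2 : RealL2)‖ ^ 2 := by
  have hprod := (integrable_schwartz_mul φ (SchwartzMap.derivCLM ℝ ℝ φ)).const_mul 2
  have hsq := (integrable_schwartz_mul φ φ).add
    (integrable_schwartz_mul (SchwartzMap.derivCLM ℝ ℝ φ) (SchwartzMap.derivCLM ℝ ℝ φ))
  calc φ x ^ 2 = ∫ y in Set.Iic x, 2 * (φ y * SchwartzMap.derivCLM ℝ ℝ φ y) :=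
        schwartz_sq_eq_integral_Iic φ x
    _ ≤ ∫ y in Set.Iic x, (φ y * φ y +
          SchwartzMap.derivCLM ℝ ℝ φ y * SchwartzMap.derivCLM ℝ ℝ φ y) :=
        integral_mono hprod.integrableOn hsq.integrableOn fun y => by
          nlinarith [sq_nonneg (φ y - SchwartzMap.derivCLM ℝ ℝ φ y)]
    _ ≤ ∫ y, (φ y * φ y + SchwartzMap.derivCLM ℝ ℝ φ y * SchwartzMap.derivCLM ℝ ℝ φ y) :=
        setIntegral_le_integral hsq (Eventually.of_forall fun y =>
          add_nonneg (mul_self_nonneg _) (mul_self_nonneg _))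
    _ = _ := by
        rw [← real_inner_self_eq_norm_sq, ← real_inner_self_eq_norm_sq, inner_toLp_toLp,
          inner_toLp_toLp, ← integral_add (integrable_schwartz_mul _ _)
            (integrable_schwartz_mul _ _)]

theorem derivCLM_pairing_mul (φ ψ : 𝓢(ℝ, ℝ)) :
    SchwartzMap.derivCLM ℝ ℝ (SchwartzMap.pairing (ContinuousLinearMap.mul ℝ ℝ) φ ψ) =
      SchwartzMap.pairing (ContinuousLinearMap.mul ℝ ℝ) φ (SchwartzMap.derivCLM ℝ ℝ ψ) +
      SchwartzMap.pairing (ContinuousLinearMap.mul ℝ ℝ) ψ (SchwartzMap.derivCLM ℝ ℝ φ) := by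
  ext x
  have product_rule : HasDerivAt (SchwartzMap.pairing (ContinuousLinearMap.mul ℝ ℝ) φ ψ)
      (deriv φ x * ψ x + φ x * deriv ψ x) x :=
    (φ.hasDerivAt x).mul (ψ.hasDerivAt x)
  rw [SchwartzMap.derivCLM_apply, product_rule.deriv, add_apply,
    SchwartzMap.pairing_apply_apply, SchwartzMap.pairing_apply_apply,
    SchwartzMap.derivCLM_apply, SchwartzMap.derivCLM_apply]
  simp only [ContinuousLinearMap.mul_apply']
  ring

end Schwartz

namespace SobolevSpace

theorem norm_deriv_le {n : ℕ} (u : SobolevSpace (n + 1)) : ‖u.deriv‖ ≤ ‖u‖ := by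
  refine le_of_sq_le_sq ?_ (norm_nonneg _)
  rw [norm_sq_eq, norm_sq_eq, Finset.sum_range_succ' _ (n + 1)]
  refine le_add_of_le_of_nonneg (Finset.sum_le_sum fun k _ => ?_) (by positivity)
  refine mul_le_mul_of_nonneg_right ?_ (by positivity)
  exact_mod_cast (Nat.choose_succ_succ n k).symm ▸ Nat.le_add_right _ _

theorem norm_incl_le {n : ℕ} (u : SobolevSpace (n + 1)) : ‖incl u‖ ≤ ‖u‖ := by
  have h : ‖incl (n := n)‖ ≤ 1 := LinearMap.mkContinuous_norm_le _ zero_le_one _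
  simpa using incl.le_of_opNorm_le h u

/-- The derivative as a bounded operator. -/
def derivL {n : ℕ} : SobolevSpace (n + 1) →L[ℝ] SobolevSpace n :=
  LinearMap.mkContinuous
    { toFun := deriv
      map_add' := fun u v => ext ((u + v).hasWeakDeriv.unique (by
        rw [map_add, map_add]
        exact u.hasWeakDeriv.add v.hasWeakDeriv))
      map_smul' := fun c u => ext ((c • u).hasWeakDeriv.unique (by
        rw [map_smul, map_smul]
        exact u.hasWeakDeriv.smul c)) } 1 fun u => by
    rw [one_mul]
    exact norm_deriv_le u

theorem derivL_apply {n : ℕ} (u : SobolevSpace (n + 1)) : derivL u = u.deriv := rfl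

theorem norm_toL2_le {n : ℕ} (u : SobolevSpace n) : ‖u.toL2‖ ≤ ‖u‖ := by
  have h := u.norm_iterate_le (Nat.zero_le n)
  rwa [Function.iterate_zero, id_eq] at h

/-- The embedding of `Hⁿ` into `L²` as a bounded operator. -/
def toL2L {n : ℕ} : SobolevSpace n →L[ℝ] RealL2 :=
  toL2.mkContinuous 1 fun u => by
    rw [one_mul]
    exact norm_toL2_le u

theorem norm_deriv_toL2_le {n : ℕ} (u : SobolevSpace (n + 1)) : ‖u.deriv.toL2‖ ≤ ‖u‖ :=
  (norm_toL2_le _).trans (norm_deriv_le u)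

/-- A Schwartz function as an element of `H¹`. -/
def ofSchwartz (φ : 𝓢(ℝ, ℝ)) : SobolevSpace 1 :=
  mkOne (φ.toLp 2) ((SchwartzMap.derivCLM ℝ ℝ φ).toLp 2) (hasWeakDeriv_toLp φ)

theorem toL2_ofSchwartz (φ : 𝓢(ℝ, ℝ)) : (ofSchwartz φ).toL2 = φ.toLp 2 := rfl

theorem toL2_deriv_ofSchwartz (φ : 𝓢(ℝ, ℝ)) :
    (ofSchwartz φ).deriv.toL2 = (SchwartzMap.derivCLM ℝ ℝ φ).toLp 2 :=
  toL2_deriv_mkOne _ _ (hasWeakDeriv_toLp φ)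

theorem denseRange_ofSchwartz : DenseRange ofSchwartz := by
  have h := besselL2_surjective.denseRange.comp denseRange_toLp_real besselL2.continuous
  refine h.mono ?_
  rintro _ ⟨φ, rfl⟩
  refine ⟨schwartzBessel φ, ext ?_⟩
  rw [Function.comp_apply, toL2_besselL2, bessel_toLp, toL2_ofSchwartz]

theorem ae_abs_le_norm (u : SobolevSpace 1) : ∀ᵐ x, |u.toL2 x| ≤ ‖u‖ := by
  obtain ⟨w, hw, hlim⟩ := mem_closure_iff_seq_limit.1 (denseRange_ofSchwartz u)
  choose φ hφ using hw
  have hlim' : Tendsto (fun k => (w k).toL2) atTop (𝓝 u.toL2) :=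
    (toL2L.continuous.tendsto u).comp hlim
  obtain ⟨ns, hns, hae⟩ := (tendstoInMeasure_of_tendsto_Lp hlim').exists_seq_tendsto_ae
  have hbound : ∀ k, ∀ᵐ x, |(w k).toL2 x| ≤ ‖w k‖ := by
    intro k
    filter_upwards [(φ k).coeFn_toLp 2] with x hx
    rw [← hφ k, toL2_ofSchwartz, hx]
    refine abs_le_of_sq_le_sq ?_ (norm_nonneg _)
    rw [norm_one_sq, toL2_ofSchwartz, toL2_deriv_ofSchwartz]
    exact schwartz_sq_le (φ k) x
  filter_upwards [hae, ae_all_iff.2 hbound] with x hx_lim hx_bound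
  exact le_of_tendsto_of_tendsto hx_lim.abs (hlim.norm.comp hns.tendsto_atTop)
    (Eventually.of_forall fun i => hx_bound (ns i))

theorem memLp_top (u : SobolevSpace 1) : MemLp u.toL2 ⊤ (volume : Measure ℝ) :=
  memLp_top_of_bound (Lp.aestronglyMeasurable _) ‖u‖ u.ae_abs_le_norm

/-- The embedding of `H¹` into `L^∞`. -/
def toLInfty : SobolevSpace 1 →L[ℝ] Lp ℝ ⊤ (volume : Measure ℝ) :=
  LinearMap.mkContinuous
    { toFun := fun u => u.memLp_top.toLp
      map_add' := fun u v => by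
        rw [← MemLp.toLp_add, MemLp.toLp_eq_toLp_iff, map_add]
        exact Lp.coeFn_add _ _
      map_smul' := fun c u => by
        rw [RingHom.id_apply, ← MemLp.toLp_const_smul, MemLp.toLp_eq_toLp_iff, map_smul]
        exact Lp.coeFn_smul _ _ } 1 fun u => by
    rw [one_mul]
    change ‖u.memLp_top.toLp‖ ≤ _
    rw [Lp.norm_toLp]
    refine ENNReal.toReal_le_of_le_ofReal (norm_nonneg _) ?_
    rw [eLpNorm_exponent_top]
    exact eLpNormEssSup_le_of_ae_bound u.ae_abs_le_norm

theorem coeFn_toLInfty (u : SobolevSpace 1) : toLInfty u =ᵐ[volume] u.toL2 :=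
  u.memLp_top.coeFn_toLp

theorem norm_toLInfty_le (u : SobolevSpace 1) : ‖toLInfty u‖ ≤ ‖u‖ := by
  have h : ‖toLInfty‖ ≤ 1 := LinearMap.mkContinuous_norm_le _ zero_le_one _
  simpa using toLInfty.le_of_opNorm_le h u

/-- Multiplication by `H¹` functions on `L²`. -/
def mulL : SobolevSpace 1 →L[ℝ] RealL2 →L[ℝ] RealL2 :=
  ((ContinuousLinearMap.mul ℝ ℝ).holderL (volume : Measure ℝ) ⊤ 2 2).comp toLInfty

theorem coeFn_mulL (a : SobolevSpace 1) (f : RealL2) :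
    mulL a f =ᵐ[volume] fun x => a.toL2 x * f x := by
  filter_upwards [(ContinuousLinearMap.mul ℝ ℝ).coeFn_holder (r := 2) (toLInfty a) f,
    a.coeFn_toLInfty] with x holder_apply toLInfty_apply
  rw [← toLInfty_apply]
  exact holder_apply

theorem norm_mulL_le (a : SobolevSpace 1) (f : RealL2) : ‖mulL a f‖ ≤ ‖a‖ * ‖f‖ := by
  refine ((ContinuousLinearMap.mul ℝ ℝ).norm_holder_apply_apply_le (r := 2)
    (toLInfty a) f).trans ?_
  rw [ContinuousLinearMap.opNorm_mul, one_mul]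
  gcongr
  exact norm_toLInfty_le a

theorem mulL_comm (a b : SobolevSpace 1) : mulL a b.toL2 = mulL b a.toL2 := by
  ext1
  filter_upwards [coeFn_mulL a b.toL2, coeFn_mulL b a.toL2] with x hab hba
  rw [hab, hba, mul_comm]

theorem inner_mulL (a : SobolevSpace 1) (f g : RealL2) :
    ⟪mulL a f, g⟫_ℝ = ⟪f, mulL a g⟫_ℝ := by
  rw [L2.inner_def, L2.inner_def]
  refine integral_congr_ae ?_
  filter_upwards [coeFn_mulL a f, coeFn_mulL a g] with x hf hg
  rw [hf, hg]
  simp only [RCLike.inner_apply, conj_trivial]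
  ring

theorem mulL_ofSchwartz (φ ψ : 𝓢(ℝ, ℝ)) : mulL (ofSchwartz φ) (ψ.toLp 2) =
    (SchwartzMap.pairing (ContinuousLinearMap.mul ℝ ℝ) φ ψ).toLp 2 := by
  ext1
  filter_upwards [coeFn_mulL (ofSchwartz φ) (ψ.toLp 2), φ.coeFn_toLp 2, ψ.coeFn_toLp 2,
    (SchwartzMap.pairing (ContinuousLinearMap.mul ℝ ℝ) φ ψ).coeFn_toLp 2]
    with x hmul hφ hψ hpairing
  rw [hmul, hpairing, hψ, toL2_ofSchwartz, hφ]
  rfl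

theorem hasWeakDeriv_mulL (a b : SobolevSpace 1) :
    HasWeakDeriv (mulL a b.toL2) (mulL a b.deriv.toL2 + mulL b a.deriv.toL2) := by
  have continuous_toL2 : Continuous fun u : SobolevSpace 1 => u.toL2 := toL2L.continuous
  have continuous_deriv : Continuous fun u : SobolevSpace 1 => u.deriv.toL2 :=
    (toL2L.comp derivL).continuous
  refine denseRange_ofSchwartz.induction_on a (isClosed_setOf_hasWeakDeriv.preimage
    (f := fun a => (mulL a b.toL2, mulL a b.deriv.toL2 + mulL b a.deriv.toL2))
    (by fun_prop)) fun φ => ?_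
  refine denseRange_ofSchwartz.induction_on b (isClosed_setOf_hasWeakDeriv.preimage
    (f := fun b => (mulL (ofSchwartz φ) b.toL2,
      mulL (ofSchwartz φ) b.deriv.toL2 + mulL b (ofSchwartz φ).deriv.toL2))
    (by fun_prop)) fun ψ => ?_
  rw [toL2_deriv_ofSchwartz, toL2_deriv_ofSchwartz, toL2_ofSchwartz, mulL_ofSchwartz,
    mulL_ofSchwartz, mulL_ofSchwartz]
  have h := hasWeakDeriv_toLp (SchwartzMap.pairing (ContinuousLinearMap.mul ℝ ℝ) φ ψ)
  rwa [derivCLM_pairing_mul] at h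

theorem norm_le_norm_toL2_add (u : SobolevSpace 1) : ‖u‖ ≤ ‖u.toL2‖ + ‖u.deriv.toL2‖ := by
  refine le_of_sq_le_sq ?_ (by positivity)
  rw [norm_one_sq]
  nlinarith [norm_nonneg u.toL2, norm_nonneg u.deriv.toL2]

/-- The product of two elements of `H¹`. -/
def mulOne (a b : SobolevSpace 1) : SobolevSpace 1 := mkOne _ _ (hasWeakDeriv_mulL a b)

theorem toL2_mulOne (a b : SobolevSpace 1) : (mulOne a b).toL2 = mulL a b.toL2 := rfl

theorem toL2_deriv_mulOne (a b : SobolevSpace 1) :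
    (mulOne a b).deriv.toL2 = mulL a b.deriv.toL2 + mulL b a.deriv.toL2 :=
  toL2_deriv_mkOne _ _ (hasWeakDeriv_mulL a b)

theorem norm_mulOne_le (a b : SobolevSpace 1) : ‖mulOne a b‖ ≤ 3 * ‖a‖ * ‖b‖ := by
  have hvalue : ‖mulL a b.toL2‖ ≤ ‖a‖ * ‖b‖ :=
    (norm_mulL_le a _).trans (by gcongr; exact norm_toL2_le b)
  have hderiv_right : ‖mulL a b.deriv.toL2‖ ≤ ‖a‖ * ‖b‖ :=
    (norm_mulL_le a _).trans (by gcongr; exact norm_deriv_toL2_le b)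
  have hderiv_left : ‖mulL b a.deriv.toL2‖ ≤ ‖b‖ * ‖a‖ :=
    (norm_mulL_le b _).trans (by gcongr; exact norm_deriv_toL2_le a)
  calc ‖mulOne a b‖
      ≤ ‖mulL a b.toL2‖ + ‖mulL a b.deriv.toL2 + mulL b a.deriv.toL2‖ := by
        rw [← toL2_mulOne, ← toL2_deriv_mulOne]
        exact norm_le_norm_toL2_add _
    _ ≤ ‖a‖ * ‖b‖ + (‖a‖ * ‖b‖ + ‖b‖ * ‖a‖) :=
        add_le_add hvalue ((norm_add_le _ _).trans (add_le_add hderiv_right hderiv_left))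
    _ = 3 * ‖a‖ * ‖b‖ := by ring

/-- Multiplication in `H¹`. -/
def mulOneL : SobolevSpace 1 →L[ℝ] SobolevSpace 1 →L[ℝ] SobolevSpace 1 :=
  LinearMap.mkContinuous₂
    (LinearMap.mk₂ ℝ mulOne
      (fun a a' b => ext (by simp only [map_add, toL2_mulOne, add_apply]))
      (fun c a b => ext (by simp only [map_smul, toL2_mulOne, smul_apply]))
      (fun a b b' => ext (by simp only [map_add, toL2_mulOne]))
      (fun c a b => ext (by simp only [map_smul, toL2_mulOne]))) 3 norm_mulOne_le

theorem mulOneL_apply (a b : SobolevSpace 1) : mulOneL a b = mulOne a b := rfl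

/-- The differential operator `a ∂ₓ + b` as an operator of `H²` into `H¹`. -/
def firstOrder (a b : SobolevSpace 1) : SobolevSpace 2 →L[ℝ] SobolevSpace 1 :=
  (mulOneL a).comp derivL + (mulOneL b).comp incl

theorem firstOrder_apply (a b : SobolevSpace 1) (u : SobolevSpace 2) :
    firstOrder a b u = mulOne a u.deriv + mulOne b (incl u) := rfl

theorem coeFn_firstOrder (a b : SobolevSpace 1) (u : SobolevSpace 2) :
    (firstOrder a b u).toL2 =ᵐ[volume]
      fun x => a.toL2 x * u.deriv.toL2 x + b.toL2 x * u.toL2 x := by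
  rw [firstOrder_apply, map_add, toL2_mulOne, toL2_mulOne]
  filter_upwards [Lp.coeFn_add (mulL a u.deriv.toL2) (mulL b (incl u).toL2),
    coeFn_mulL a u.deriv.toL2, coeFn_mulL b (incl u).toL2] with x hadd ha hb
  rw [hadd, Pi.add_apply, ha, hb]
  rfl

theorem norm_firstOrder_le (a b : SobolevSpace 1) (u : SobolevSpace 2) :
    ‖firstOrder a b u‖ ≤ 3 * (‖a‖ + ‖b‖) * ‖u‖ := by
  calc ‖firstOrder a b u‖ ≤ ‖mulOne a u.deriv‖ + ‖mulOne b (incl u)‖ := norm_add_le _ _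
    _ ≤ 3 * ‖a‖ * ‖u.deriv‖ + 3 * ‖b‖ * ‖incl u‖ :=
        add_le_add (norm_mulOne_le _ _) (norm_mulOne_le _ _)
    _ ≤ 3 * ‖a‖ * ‖u‖ + 3 * ‖b‖ * ‖u‖ := by
        gcongr
        exacts [norm_deriv_le u, norm_incl_le u]
    _ = 3 * (‖a‖ + ‖b‖) * ‖u‖ := by ring

theorem abs_inner_mulL_le (a : SobolevSpace 1) (f g : RealL2) :
    |⟪mulL a f, g⟫_ℝ| ≤ ‖a‖ * ‖f‖ * ‖g‖ :=
  (abs_real_inner_le_norm _ _).trans (by gcongr; exact norm_mulL_le a f)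

theorem inner_mulL_deriv_self (a : SobolevSpace 2) (w : SobolevSpace 1) :
    ⟪mulL (incl a) w.deriv.toL2, w.toL2⟫_ℝ = -⟪mulL a.deriv w.toL2, w.toL2⟫_ℝ / 2 := by
  have integration_by_parts := (hasWeakDeriv_mulL (incl a) w).inner_eq_neg w.hasWeakDeriv
  rw [deriv_incl, toL2_incl, mulL_comm w a.deriv, inner_mulL _ w.toL2, real_inner_comm,
    inner_add_right] at integration_by_parts
  rw [real_inner_comm, real_inner_comm w.toL2 (mulL a.deriv w.toL2)]
  linarith

theorem inner_mulOne_deriv_incl (a u : SobolevSpace 2) :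
    ⟪mulOne (incl a) u.deriv, incl u⟫_ℝ =
      ⟪mulL (incl a) u.deriv.toL2, u.toL2⟫_ℝ +
        ⟪mulL a.deriv u.deriv.toL2, u.deriv.toL2⟫_ℝ / 2 := by
  rw [inner_one, toL2_mulOne, toL2_deriv_mulOne, deriv_incl, deriv_incl, toL2_incl, toL2_incl,
    mulL_comm u.deriv a.deriv, inner_add_left, toL2_incl]
  have := inner_mulL_deriv_self a u.deriv
  linarith

theorem abs_inner_mulOne_deriv_incl_le (a u : SobolevSpace 2) :
    |⟪mulOne (incl a) u.deriv, incl u⟫_ℝ| ≤ 2 * ‖a‖ * ‖incl u‖ ^ 2 := by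
  have norm_u : ‖u.toL2‖ ≤ ‖incl u‖ := norm_toL2_le (incl u)
  have norm_deriv_u : ‖u.deriv.toL2‖ ≤ ‖incl u‖ := norm_deriv_toL2_le (incl u)
  have hvalue : |⟪mulL (incl a) u.deriv.toL2, u.toL2⟫_ℝ| ≤ ‖a‖ * ‖incl u‖ * ‖incl u‖ :=
    (abs_inner_mulL_le _ _ _).trans (by gcongr; exact norm_incl_le a)
  have hderiv : |⟪mulL a.deriv u.deriv.toL2, u.deriv.toL2⟫_ℝ| ≤ ‖a‖ * ‖incl u‖ * ‖incl u‖ :=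
    (abs_inner_mulL_le _ _ _).trans (by gcongr; exact norm_deriv_le a)
  rw [inner_mulOne_deriv_incl]
  refine (abs_add_le _ _).trans ?_
  rw [abs_div, abs_two]
  linarith [abs_nonneg ⟪mulL a.deriv u.deriv.toL2, u.deriv.toL2⟫_ℝ]

theorem abs_inner_firstOrder_le (a : SobolevSpace 2) (b : SobolevSpace 1) (u : SobolevSpace 2) :
    |⟪firstOrder (incl a) b u, incl u⟫_ℝ| ≤ (2 * ‖a‖ + 3 * ‖b‖) * ‖incl u‖ ^ 2 := by
  have hb : |⟪mulOne b (incl u), incl u⟫_ℝ| ≤ 3 * ‖b‖ * ‖incl u‖ * ‖incl u‖ :=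
    (abs_real_inner_le_norm _ _).trans (by gcongr; exact norm_mulOne_le b (incl u))
  rw [firstOrder_apply, inner_add_left]
  refine (abs_add_le _ _).trans ?_
  linarith [abs_inner_mulOne_deriv_incl_le a u]

end SobolevSpace

/-! ### The commutator with `(1 - ∂ₓ²)^{-1/2}` -/

section Commutator

theorem integral_norm_mul_norm_le {F G : ℝ → ℂ} (hF : MemLp F 2) (hG : MemLp G 2) :
    ∫ x, ‖F x‖ * ‖G x‖ ≤ Real.sqrt (∫ x, ‖F x‖ ^ 2) * Real.sqrt (∫ x, ‖G x‖ ^ 2) := by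
  have holder := integral_mul_norm_le_Lp_mul_Lq (f := F) (g := G) Real.HolderConjugate.two_two
    (by simpa using hF) (by simpa using hG)
  simpa [Real.sqrt_eq_rpow] using holder

theorem sqrt_integral_norm_realFourier_sq (φ : 𝓢(ℝ, ℝ)) :
    Real.sqrt (∫ ξ, ‖realFourier φ ξ‖ ^ 2) = ‖(φ.toLp 2 : RealL2)‖ := by
  rw [Real.sqrt_eq_iff_mul_self_eq (integral_nonneg fun ξ => sq_nonneg _) (norm_nonneg _), ← sq,
    ← real_inner_self_eq_norm_sq, inner_toLp_toLp]
  apply Complex.ofReal_injective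
  rw [← integral_inner_realFourier, ← integral_complex_ofReal]
  refine integral_congr_ae (Eventually.of_forall fun ξ => ?_)
  simp only [inner_self_eq_norm_sq_to_K]
  norm_cast

/-- The `L²` norm of the symbol of `(1 - ∂ₓ²)^{-1/2}`. -/
def besselSymbolNorm : ℝ := Real.sqrt (∫ ξ, ‖(besselSymbol ξ : ℂ)‖ ^ 2)

theorem besselSymbolNorm_nonneg : 0 ≤ besselSymbolNorm := Real.sqrt_nonneg _

theorem memLp_besselSymbol : MemLp (fun ξ => (besselSymbol ξ : ℂ)) 2 := by
  rw [memLp_two_iff_integrable_sq_norm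
    besselSymbol_ofReal_hasTemperateGrowth.1.continuous.aestronglyMeasurable]
  refine (integrable_inv_one_add_sq.comp_mul_left' (R := 2 * Real.pi) (by positivity)).congr
    (Eventually.of_forall fun ξ => ?_)
  simp only [Complex.norm_real, Real.norm_eq_abs, sq_abs]
  exact (eq_inv_of_mul_eq_one_left (besselSymbol_sq ξ)).symm

theorem integral_norm_realFourier_schwartzBessel_le (φ : 𝓢(ℝ, ℝ)) :
    ∫ ξ, ‖realFourier (schwartzBessel φ) ξ‖ ≤ besselSymbolNorm * ‖(φ.toLp 2 : RealL2)‖ := by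
  rw [← sqrt_integral_norm_realFourier_sq]
  simp only [realFourier_schwartzBessel, norm_mul]
  exact integral_norm_mul_norm_le memLp_besselSymbol ((realFourier φ).memLp 2)

theorem abs_sqrt_one_add_sq_sub_le (x y : ℝ) :
    |Real.sqrt (1 + x ^ 2) - Real.sqrt (1 + y ^ 2)| ≤ |x - y| := by
  have sqrt_eq_norm (r : ℝ) : Real.sqrt (1 + r ^ 2) = ‖(1 + r * Complex.I : ℂ)‖ := by
    simpa using (Complex.norm_add_mul_I 1 r).symm
  rw [sqrt_eq_norm, sqrt_eq_norm]
  refine (abs_norm_sub_norm_le _ _).trans_eq ?_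
  rw [add_sub_add_left_eq_sub, ← sub_mul, norm_mul, Complex.norm_I, mul_one, ← Complex.ofReal_sub,
    Complex.norm_real, Real.norm_eq_abs]

theorem abs_besselSymbol_sub_le (s t : ℝ) : |besselSymbol t - besselSymbol s| ≤
    |2 * Real.pi * (s - t)| * (besselSymbol t * besselSymbol s) := by
  have symbols_pos := mul_pos (besselSymbol_pos t) (besselSymbol_pos s)
  have := Real.sqrt_pos.2 (one_add_two_pi_mul_sq_pos s)
  have := Real.sqrt_pos.2 (one_add_two_pi_mul_sq_pos t)
  have hsub : besselSymbol t - besselSymbol s =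
      (Real.sqrt (1 + (2 * Real.pi * s) ^ 2) - Real.sqrt (1 + (2 * Real.pi * t) ^ 2)) *
        (besselSymbol t * besselSymbol s) := by
    simp only [besselSymbol]
    field_simp
  rw [hsub, abs_mul, abs_of_pos symbols_pos, mul_sub]
  exact mul_le_mul_of_nonneg_right (abs_sqrt_one_add_sq_sub_le _ _) symbols_pos.le

theorem fourierInv_schwartzOfReal (φ : 𝓢(ℝ, ℝ)) (t : ℝ) :
    (𝓕⁻ (schwartzOfReal φ)) t = realFourier φ (-t) := by
  rw [SchwartzMap.fourierInv_coe, Real.fourierInv_eq_fourier_neg, realFourier,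
    SchwartzMap.fourier_coe]

theorem fourierInv_pairing_schwartzOfReal (f g : 𝓢(ℝ, ℝ)) (ζ : ℝ) :
    (𝓕⁻ (SchwartzMap.pairing (ContinuousLinearMap.mul ℂ ℂ) (schwartzOfReal f)
      (schwartzOfReal g))) ζ = ∫ t, realFourier f (-t) * realFourier g (t - ζ) := by
  have convolution_eq := SchwartzMap.convolution_apply (ContinuousLinearMap.mul ℂ ℂ)
    (𝓕⁻ (schwartzOfReal f)) (𝓕⁻ (schwartzOfReal g)) ζ
  rw [convolution_def] at convolution_eq
  have fourier_eq := SchwartzMap.fourier_convolution (ContinuousLinearMap.mul ℂ ℂ)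
    (𝓕⁻ (schwartzOfReal f)) (𝓕⁻ (schwartzOfReal g))
  rw [FourierTransform.fourier_fourierInv_eq, FourierTransform.fourier_fourierInv_eq]
    at fourier_eq
  rw [← fourier_eq, FourierTransform.fourierInv_fourier_eq, convolution_eq]
  refine integral_congr_ae (Eventually.of_forall fun t => ?_)
  simp only [ContinuousLinearMap.mul_apply', fourierInv_schwartzOfReal, neg_sub]

theorem integral_mul_mul_eq (χ f g : 𝓢(ℝ, ℝ)) :
    ((∫ x, χ x * (f x * g x) : ℝ) : ℂ) =
      ∫ ζ, realFourier χ ζ * ∫ t, realFourier f (-t) * realFourier g (t - ζ) := by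
  have parseval := SchwartzMap.integral_fourierInv_mul_eq (realFourier χ)
    (SchwartzMap.pairing (ContinuousLinearMap.mul ℂ ℂ) (schwartzOfReal f) (schwartzOfReal g))
  simp only [fourierInv_pairing_schwartzOfReal] at parseval
  rw [← parseval, ← integral_complex_ofReal]
  refine integral_congr_ae (Eventually.of_forall fun x => ?_)
  simp only [realFourier, FourierTransform.fourierInv_fourier_eq,
    SchwartzMap.pairing_apply_apply, schwartzOfReal_apply, ContinuousLinearMap.mul_apply']
  push_cast
  rfl

theorem integrable_realFourier_mul_integral (χ f g : 𝓢(ℝ, ℝ)) :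
    Integrable fun ζ => realFourier χ ζ * ∫ t, realFourier f (-t) * realFourier g (t - ζ) := by
  simp only [← fourierInv_pairing_schwartzOfReal]
  exact (SchwartzMap.pairing (ContinuousLinearMap.mul ℂ ℂ) (realFourier χ)
    (𝓕⁻ (SchwartzMap.pairing (ContinuousLinearMap.mul ℂ ℂ) (schwartzOfReal f)
      (schwartzOfReal g)))).integrable

theorem memLp_realFourier_neg (f : 𝓢(ℝ, ℝ)) : MemLp (fun t => realFourier f (-t)) 2 :=
  ((realFourier f).memLp 2).comp_measurePreserving
    (Measure.measurePreserving_neg (volume : Measure ℝ))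

theorem memLp_realFourier_sub (g : 𝓢(ℝ, ℝ)) (ζ : ℝ) : MemLp (fun t => realFourier g (t - ζ)) 2 :=
  ((realFourier g).memLp 2).comp_measurePreserving (measurePreserving_sub_right volume ζ)

theorem integrable_realFourier_mul (f g : 𝓢(ℝ, ℝ)) (ζ : ℝ) :
    Integrable fun t => realFourier f (-t) * realFourier g (t - ζ) :=
  (memLp_realFourier_neg f).integrable_mul (memLp_realFourier_sub g ζ)

theorem integral_norm_realFourier_mul_le (f g : 𝓢(ℝ, ℝ)) (ζ : ℝ) :
    ∫ t, ‖realFourier f (-t) * realFourier g (t - ζ)‖ ≤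
      ‖(f.toLp 2 : RealL2)‖ * ‖(g.toLp 2 : RealL2)‖ := by
  simp only [norm_mul]
  refine (integral_norm_mul_norm_le (memLp_realFourier_neg f)
    (memLp_realFourier_sub g ζ)).trans_eq ?_
  rw [integral_neg_eq_self (fun t => ‖realFourier f t‖ ^ 2),
    integral_sub_right_eq_self (fun t => ‖realFourier g t‖ ^ 2), sqrt_integral_norm_realFourier_sq,
    sqrt_integral_norm_realFourier_sq]

theorem norm_realFourier_schwartzBessel_mul_sub_le (f g : 𝓢(ℝ, ℝ)) (ζ t : ℝ) :
    ‖realFourier (schwartzBessel f) (-t) * realFourier g (t - ζ) -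
        realFourier f (-t) * realFourier (schwartzBessel g) (t - ζ)‖ ≤
      |2 * Real.pi * ζ| *
        ‖realFourier (schwartzBessel f) (-t) * realFourier (schwartzBessel g) (t - ζ)‖ := by
  have hsub : realFourier (schwartzBessel f) (-t) * realFourier g (t - ζ) -
      realFourier f (-t) * realFourier (schwartzBessel g) (t - ζ) =
      ((besselSymbol t - besselSymbol (t - ζ) : ℝ) : ℂ) *
        (realFourier f (-t) * realFourier g (t - ζ)) := by
    rw [realFourier_schwartzBessel, realFourier_schwartzBessel, besselSymbol_neg]
    push_cast
    ring
  have hsymbol := abs_besselSymbol_sub_le (t - ζ) t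
  rw [sub_sub_cancel_left, mul_neg, abs_neg] at hsymbol
  rw [hsub, realFourier_schwartzBessel, realFourier_schwartzBessel, besselSymbol_neg]
  simp only [norm_mul, Complex.norm_real, Real.norm_eq_abs, abs_of_pos (besselSymbol_pos _)]
  calc _ ≤ (|2 * Real.pi * ζ| * (besselSymbol t * besselSymbol (t - ζ))) *
        (‖realFourier f (-t)‖ * ‖realFourier g (t - ζ)‖) := by gcongr
    _ = _ := by ring

theorem norm_integral_realFourier_schwartzBessel_mul_sub_le (f g : 𝓢(ℝ, ℝ)) (ζ : ℝ) :
    ‖(∫ t, realFourier (schwartzBessel f) (-t) * realFourier g (t - ζ)) -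
        ∫ t, realFourier f (-t) * realFourier (schwartzBessel g) (t - ζ)‖ ≤
      |2 * Real.pi * ζ| *
        (‖((schwartzBessel f).toLp 2 : RealL2)‖ * ‖((schwartzBessel g).toLp 2 : RealL2)‖) := by
  rw [← integral_sub (integrable_realFourier_mul _ _ _) (integrable_realFourier_mul _ _ _)]
  refine (norm_integral_le_of_norm_le
    ((integrable_realFourier_mul (schwartzBessel f) (schwartzBessel g) ζ).norm.const_mul _)
    (Eventually.of_forall (norm_realFourier_schwartzBessel_mul_sub_le f g ζ))).trans ?_
  rw [integral_const_mul]
  gcongr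
  exact integral_norm_realFourier_mul_le _ _ ζ

theorem integral_commutator_eq (χ f g : 𝓢(ℝ, ℝ)) :
    (((∫ x, χ x * (schwartzBessel f x * g x)) -
        ∫ x, χ x * (f x * schwartzBessel g x) : ℝ) : ℂ) =
      ∫ ζ, realFourier χ ζ * ((∫ t, realFourier (schwartzBessel f) (-t) * realFourier g (t - ζ)) -
        ∫ t, realFourier f (-t) * realFourier (schwartzBessel g) (t - ζ)) := by
  simp only [mul_sub]
  rw [Complex.ofReal_sub, integral_mul_mul_eq, integral_mul_mul_eq,
    integral_sub (integrable_realFourier_mul_integral _ _ _)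
      (integrable_realFourier_mul_integral _ _ _)]

theorem norm_realFourier_schwartzBessel_deriv (φ : 𝓢(ℝ, ℝ)) (ζ : ℝ) :
    ‖realFourier (schwartzBessel (SchwartzMap.derivCLM ℝ ℝ φ)) ζ‖ =
      |2 * Real.pi * ζ| * ‖realFourier (schwartzBessel φ) ζ‖ := by
  rw [schwartzBessel_deriv, ← deriv_schwartzBessel, realFourier_deriv, norm_mul, norm_mul,
    Complex.norm_I, mul_one, Complex.norm_real, Real.norm_eq_abs]

theorem abs_integral_commutator_le (φ f g : 𝓢(ℝ, ℝ)) :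
    |(∫ x, schwartzBessel φ x * (schwartzBessel f x * g x)) -
      ∫ x, schwartzBessel φ x * (f x * schwartzBessel g x)| ≤
      besselSymbolNorm * ‖((SchwartzMap.derivCLM ℝ ℝ φ).toLp 2 : RealL2)‖ *
        (‖((schwartzBessel f).toLp 2 : RealL2)‖ * ‖((schwartzBessel g).toLp 2 : RealL2)‖) := by
  set N : ℝ := ‖((schwartzBessel f).toLp 2 : RealL2)‖ * ‖((schwartzBessel g).toLp 2 : RealL2)‖
  rw [← Real.norm_eq_abs, ← Complex.norm_real, integral_commutator_eq]
  calc _ ≤ ∫ ζ, ‖realFourier (schwartzBessel (SchwartzMap.derivCLM ℝ ℝ φ)) ζ‖ * N := by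
        refine norm_integral_le_of_norm_le (((realFourier (schwartzBessel
          (SchwartzMap.derivCLM ℝ ℝ φ))).integrable (μ := volume)).norm.mul_const N)
          (Eventually.of_forall fun ζ => ?_)
        rw [norm_mul, norm_realFourier_schwartzBessel_deriv, mul_comm |_|, mul_assoc]
        gcongr
        exact norm_integral_realFourier_schwartzBessel_mul_sub_le f g ζ
    _ ≤ _ := by
        rw [integral_mul_const]
        gcongr
        exact integral_norm_realFourier_schwartzBessel_le _

end Commutator

section Factorization

variable {X : Type*} [NormedAddCommGroup X] [InnerProductSpace ℝ X] [CompleteSpace X]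

theorem exists_apply_eq_of_abs_inner_le {P : X →L[ℝ] X} (hP : DenseRange P)
    (hsymm : ∀ x y, ⟪P x, y⟫_ℝ = ⟪x, P y⟫_ℝ) {y : X} {M : ℝ} (hM : 0 ≤ M)
    (hy : ∀ g, |⟪y, g⟫_ℝ| ≤ M * ‖P g‖) : ∃ d, P d = y ∧ ‖d‖ ≤ M := by
  let ℓ : X →ₗ[ℝ] ℝ := (innerSL ℝ y).toLinearMap
  refine ⟨(InnerProductSpace.toDual ℝ X).symm (ℓ.extendOfNorm P.toLinearMap), ?_, ?_⟩
  · refine ext_inner_right ℝ fun g => ?_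
    rw [hsymm, InnerProductSpace.toDual_symm_apply]
    exact LinearMap.extendOfNorm_eq hP ⟨M, hy⟩ g
  · rw [LinearIsometryEquiv.norm_map]
    exact LinearMap.opNorm_extendOfNorm_le hP hM hy

theorem exists_factorization_of_abs_inner_le (P E : X →L[ℝ] X) (hP : Function.Injective P)
    (hsymm : ∀ x y, ⟪P x, y⟫_ℝ = ⟪x, P y⟫_ℝ) {M : ℝ} (hM : 0 ≤ M)
    (hE : ∀ f g, |⟪E f, g⟫_ℝ| ≤ M * (‖P f‖ * ‖P g‖)) :
    ∃ C : X →L[ℝ] X, ‖C‖ ≤ M ∧ ∀ f, P (C (P f)) = E f := by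
  have hdense : DenseRange P :=
    denseRange_of_symmetric (ι := P) (Q := ContinuousLinearEquiv.refl ℝ X) hP hsymm
  have hpreimage (f : X) : ∃ d, P d = E f ∧ ‖d‖ ≤ M * ‖P f‖ :=
    exists_apply_eq_of_abs_inner_le hdense hsymm (by positivity) fun g => by
      rw [mul_assoc]
      exact hE f g
  choose preimage apply_preimage norm_preimage_le using hpreimage
  let D : X →ₗ[ℝ] X :=
    { toFun := preimage
      map_add' := fun f g => hP (by simp only [map_add, apply_preimage])
      map_smul' := fun r f => hP (by simp only [map_smul, apply_preimage, RingHom.id_apply]) }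
  refine ⟨D.extendOfNorm P.toLinearMap,
    LinearMap.opNorm_extendOfNorm_le hdense hM norm_preimage_le, fun f => ?_⟩
  rw [← apply_preimage f]
  exact congrArg P (LinearMap.extendOfNorm_eq (f := D) hdense ⟨M, norm_preimage_le⟩ f)

end Factorization

namespace SobolevSpace

theorem incl_besselUp_ofSchwartz (φ : 𝓢(ℝ, ℝ)) :
    incl (besselUp (ofSchwartz φ)) = ofSchwartz (schwartzBessel φ) :=
  ext (by rw [toL2_incl_besselUp, toL2_ofSchwartz, toL2_ofSchwartz, bessel_toLp])

theorem inner_mulL_ofSchwartz_toLp (φ f g : 𝓢(ℝ, ℝ)) :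
    ⟪mulL (ofSchwartz φ) (f.toLp 2), g.toLp 2⟫_ℝ = ∫ x, φ x * (f x * g x) := by
  rw [mulL_ofSchwartz, inner_toLp_toLp]
  refine integral_congr_ae (Eventually.of_forall fun x => ?_)
  simp [mul_assoc]

/-- The commutator of multiplication by `c` with `(1 - ∂ₓ²)^{-1/2}`, on `L²`. -/
def besselCommutator (c : SobolevSpace 2) : RealL2 →L[ℝ] RealL2 :=
  (mulL (incl c)).comp bessel - bessel.comp (mulL (incl c))

theorem besselCommutator_apply (c : SobolevSpace 2) (f : RealL2) :
    besselCommutator c f = mulL (incl c) (bessel f) - bessel (mulL (incl c) f) := rfl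

theorem inner_besselCommutator (c : SobolevSpace 2) (f g : RealL2) :
    ⟪besselCommutator c f, g⟫_ℝ =
      ⟪mulL (incl c) (bessel f), g⟫_ℝ - ⟪mulL (incl c) f, bessel g⟫_ℝ := by
  rw [besselCommutator_apply, inner_sub_left, bessel_symm]

theorem abs_inner_besselCommutator_le (c : SobolevSpace 2) (f g : RealL2) :
    |⟪besselCommutator c f, g⟫_ℝ| ≤
      besselSymbolNorm * ‖c.deriv‖ * (‖bessel f‖ * ‖bessel g‖) := by
  obtain ⟨d, rfl⟩ := besselUp_surjective c
  simp only [← derivL_apply]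
  induction d using denseRange_ofSchwartz.induction_on with
  | hp =>
    simp only [inner_besselCommutator]
    exact isClosed_le (by fun_prop) (by fun_prop)
  | ih φ =>
  induction f using denseRange_toLp_real.induction_on with
  | hp => exact isClosed_le (by fun_prop) (by fun_prop)
  | ih f =>
  induction g using denseRange_toLp_real.induction_on with
  | hp => exact isClosed_le (by fun_prop) (by fun_prop)
  | ih g =>
  rw [inner_besselCommutator, derivL_apply, deriv_besselUp, LinearIsometry.norm_map,
    toL2_deriv_ofSchwartz, incl_besselUp_ofSchwartz, bessel_toLp, bessel_toLp,
    inner_mulL_ofSchwartz_toLp, inner_mulL_ofSchwartz_toLp]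
  exact abs_integral_commutator_le φ f g

theorem exists_besselCommutator_factorization (c : SobolevSpace 2) :
    ∃ C : RealL2 →L[ℝ] RealL2, ‖C‖ ≤ besselSymbolNorm * ‖c.deriv‖ ∧
      ∀ f, bessel (C (bessel f)) = besselCommutator c f :=
  exists_factorization_of_abs_inner_le bessel (besselCommutator c) bessel_injective bessel_symm
    (mul_nonneg besselSymbolNorm_nonneg (norm_nonneg _))
    (abs_inner_besselCommutator_le c)

theorem mulL_incl_eq_bessel_bessel (c w : SobolevSpace 2) :
    mulL (incl c) w.toL2 = bessel (bessel (mulL (incl c) (w.toL2 - w.deriv.deriv.toL2) -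
      mulL (incl w) c.deriv.deriv.toL2 - (2 : ℝ) • mulL c.deriv w.deriv.toL2)) := by
  -- Leibniz' rule: `(1 - ∂ₓ²)(c w) = c (1 - ∂ₓ²) w - w c'' - 2 c' w'`.
  have first_deriv := hasWeakDeriv_mulL (incl c) (incl w)
  rw [deriv_incl, deriv_incl, toL2_incl, toL2_incl, toL2_incl] at first_deriv
  have second_deriv :=
    (hasWeakDeriv_mulL (incl c) w.deriv).add (hasWeakDeriv_mulL (incl w) c.deriv)
  rw [deriv_incl, deriv_incl, toL2_incl, toL2_incl, mulL_comm w.deriv c.deriv] at second_deriv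
  have inverse_eq := first_deriv.bessel_sub
  rw [second_deriv.riesz_eq, ← map_sub] at inverse_eq
  rw [← inverse_eq]
  congr 2
  rw [map_sub, two_smul]
  abel

/-- `besselL2` as an isometric isomorphism of `L²` onto `H¹`. -/
def besselL2Equiv : RealL2 ≃ₗᵢ[ℝ] SobolevSpace 1 :=
  LinearIsometryEquiv.ofSurjective besselL2 besselL2_surjective

/-- The operator `[(1 - ∂ₓ²)^{1/2}, c] (1 - ∂ₓ²)^{-1/2}` of `H¹`, written in terms of an operator
`C` of `L²` which is meant to satisfy `P C P = [c, P]` with `P = (1 - ∂ₓ²)^{-1/2}`. -/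
def conjugationOperator (c : SobolevSpace 2) (C : RealL2 →L[ℝ] RealL2) :
    SobolevSpace 1 →L[ℝ] SobolevSpace 1 :=
  besselL2.toContinuousLinearMap.comp
    (-mulL.flip c.deriv.deriv.toL2 - (2 : ℝ) • (mulL c.deriv).comp (toL2L.comp derivL) -
      C.comp (besselL2Equiv.symm.toContinuousLinearEquiv : SobolevSpace 1 →L[ℝ] RealL2))

theorem conjugationOperator_apply (c : SobolevSpace 2) (C : RealL2 →L[ℝ] RealL2)
    (w : SobolevSpace 1) : conjugationOperator c C w =
      besselL2 (-mulL w c.deriv.deriv.toL2 - (2 : ℝ) • mulL c.deriv w.deriv.toL2 -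
        C (besselL2Equiv.symm w)) := rfl

theorem norm_conjugationOperator_le (c : SobolevSpace 2) (C : RealL2 →L[ℝ] RealL2) :
    ‖conjugationOperator c C‖ ≤ 3 * ‖c.deriv‖ + ‖C‖ := by
  refine ContinuousLinearMap.opNorm_le_bound _ (by positivity) fun w => ?_
  have hsecond : ‖mulL w c.deriv.deriv.toL2‖ ≤ ‖w‖ * ‖c.deriv‖ :=
    (norm_mulL_le _ _).trans (by gcongr; exact norm_deriv_toL2_le _)
  have hfirst : ‖mulL c.deriv w.deriv.toL2‖ ≤ ‖c.deriv‖ * ‖w‖ :=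
    (norm_mulL_le _ _).trans (by gcongr; exact norm_deriv_toL2_le _)
  have hcommutator : ‖C (besselL2Equiv.symm w)‖ ≤ ‖C‖ * ‖w‖ :=
    (C.le_opNorm _).trans_eq (by rw [LinearIsometryEquiv.norm_map])
  rw [conjugationOperator_apply, LinearIsometry.norm_map]
  calc _ ≤ ‖mulL w c.deriv.deriv.toL2‖ + 2 * ‖mulL c.deriv w.deriv.toL2‖ +
        ‖C (besselL2Equiv.symm w)‖ := by
        refine (norm_sub_le _ _).trans (add_le_add_left ((norm_sub_le _ _).trans_eq ?_) _)
        rw [norm_neg, norm_smul, Real.norm_ofNat]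
    _ ≤ _ := by linarith

theorem mulL_bessel_eq_bessel_conjugationOperator {c : SobolevSpace 2} {C : RealL2 →L[ℝ] RealL2}
    (hC : ∀ f, bessel (C (bessel f)) = besselCommutator c f) (h : SobolevSpace 1) :
    mulL (incl c) (bessel h.toL2) =
      bessel (mulL (incl c) h.toL2 + (conjugationOperator c C (incl (besselUp h))).toL2) := by
  obtain ⟨k, rfl⟩ := besselL2_surjective h
  have hk : (besselUp (besselL2 k)).toL2 - (besselUp (besselL2 k)).deriv.deriv.toL2 = k := by
    rw [deriv_besselUp, toL2_deriv_besselL2, toL2_besselUp, toL2_besselL2, toL2_deriv_besselL2,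
      bessel_sq_sub]
  have hsymm : besselL2Equiv.symm (incl (besselUp (besselL2 k))) = bessel k :=
    besselL2Equiv.symm_apply_eq.2 (ext rfl)
  have leibniz := mulL_incl_eq_bessel_bessel c (besselUp (besselL2 k))
  rw [hk, toL2_besselUp] at leibniz
  rw [leibniz]
  congr 1
  rw [conjugationOperator_apply, hsymm, deriv_incl, toL2_incl, toL2_besselL2, toL2_besselL2]
  simp only [map_sub, map_neg, hC, besselCommutator_apply]
  abel

theorem exists_conjugation (c : SobolevSpace 2) :
    ∃ Φ : SobolevSpace 1 →L[ℝ] SobolevSpace 1, ‖Φ‖ ≤ (3 + besselSymbolNorm) * ‖c.deriv‖ ∧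
      ∀ h : SobolevSpace 1, mulL (incl c) (bessel h.toL2) =
        bessel (mulL (incl c) h.toL2 + (Φ (incl (besselUp h))).toL2) := by
  obtain ⟨C, norm_C_le, hC⟩ := exists_besselCommutator_factorization c
  refine ⟨conjugationOperator c C, ?_, mulL_bessel_eq_bessel_conjugationOperator hC⟩
  linarith [norm_conjugationOperator_le c C]

end SobolevSpace

/-! ### First order operators and Kato's condition -/

namespace SobolevSpace

theorem exists_conjugation_firstOrder (a b : SobolevSpace 2) :
    ∃ B : SobolevSpace 1 →L[ℝ] SobolevSpace 1,
      ‖B‖ ≤ (3 + besselSymbolNorm) * (‖a.deriv‖ + ‖b.deriv‖) ∧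
      ∀ u, firstOrder (incl a) (incl b) (besselUp (incl u)) =
        incl (besselUp (firstOrder (incl a) (incl b) u + B (incl u))) := by
  obtain ⟨Φ, norm_Φ_le, hΦ⟩ := exists_conjugation a
  obtain ⟨Ψ, norm_Ψ_le, hΨ⟩ := exists_conjugation b
  let B : SobolevSpace 1 →L[ℝ] SobolevSpace 1 :=
    Φ.comp (besselL2.toContinuousLinearMap.comp (toL2L.comp derivL)) +
      Ψ.comp (incl.comp besselUp.toContinuousLinearMap)
  have B_apply (w) : B w = Φ (besselL2 w.deriv.toL2) + Ψ (incl (besselUp w)) := rfl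
  refine ⟨B, ContinuousLinearMap.opNorm_le_bound _ (mul_nonneg
    (by linarith [besselSymbolNorm_nonneg]) (by positivity)) fun w => ?_, fun u => ?_⟩
  · have hfirst : ‖Φ (besselL2 w.deriv.toL2)‖ ≤ (3 + besselSymbolNorm) * ‖a.deriv‖ * ‖w‖ :=
      Φ.le_of_opNorm_le_of_le norm_Φ_le
        ((besselL2.norm_map _).trans_le (norm_deriv_toL2_le w))
    have hzeroth : ‖Ψ (incl (besselUp w))‖ ≤ (3 + besselSymbolNorm) * ‖b.deriv‖ * ‖w‖ :=
      Ψ.le_of_opNorm_le_of_le norm_Ψ_le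
        ((norm_incl_le _).trans_eq (besselUp.norm_map _))
    rw [B_apply, mul_add, add_mul]
    exact (norm_add_le _ _).trans (add_le_add hfirst hzeroth)
  · have hfirst := hΦ u.deriv
    have hzeroth : mulL (incl b) (besselUp (incl u)).toL2 =
        bessel (mulL (incl b) u.toL2 + (Ψ (incl (besselUp (incl u)))).toL2) := hΨ (incl u)
    rw [show incl (besselUp u.deriv) = besselL2 (incl u).deriv.toL2 from ext rfl] at hfirst
    refine ext ?_
    rw [toL2_incl_besselUp, firstOrder_apply, firstOrder_apply, B_apply, deriv_besselUp]
    simp only [map_add, toL2_mulOne, toL2_besselL2, deriv_incl, toL2_incl]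
      at hfirst hzeroth ⊢
    rw [hfirst, hzeroth]
    abel

variable (a : SobolevSpace 3) (b : SobolevSpace 2)

/-- The operator `a ∂ₓ + b` of `H²` into `H¹`, with the coefficients in the spaces of the
theorem. -/
def transport : SobolevSpace 2 →L[ℝ] SobolevSpace 1 := firstOrder (incl (incl a)) (incl b)

theorem coeFn_transport (u : SobolevSpace 2) : (transport a b u).toL2 =ᵐ[volume]
    fun x => a.toL2 x * u.deriv.toL2 x + b.toL2 x * u.toL2 x :=
  coeFn_firstOrder _ _ u

theorem eq_transport_of_ae_eq {u : SobolevSpace 2} {f : SobolevSpace 1}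
    (h : f.toL2 =ᵐ[volume] fun x => a.toL2 x * u.deriv.toL2 x + b.toL2 x * u.toL2 x) :
    f = transport a b u :=
  ext (Lp.ext (h.trans (coeFn_transport a b u).symm))

theorem abs_inner_transport_le (u : SobolevSpace 2) :
    |⟪transport a b u, incl u⟫_ℝ| ≤ (2 * ‖a‖ + 3 * ‖b‖) * ‖incl u‖ ^ 2 := by
  refine (abs_inner_firstOrder_le _ _ _).trans ?_
  gcongr
  · exact norm_incl_le a
  · exact norm_incl_le b

theorem norm_transport_sub_le (a' : SobolevSpace 3) (b' : SobolevSpace 2) (u : SobolevSpace 2) :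
    ‖transport a b u - transport a' b' u‖ ≤ 3 * (‖a - a'‖ + ‖b - b'‖) * ‖u‖ := by
  have hsub : transport a b u - transport a' b' u =
      firstOrder (incl (incl (a - a'))) (incl (b - b')) u := by
    simp only [transport, firstOrder_apply, ← mulOneL_apply, map_sub, sub_apply]
    abel
  rw [hsub]
  refine (norm_firstOrder_le _ _ u).trans ?_
  gcongr
  · exact (norm_incl_le _).trans (norm_incl_le _)
  · exact norm_incl_le _

theorem exists_conjugation_transport :
    ∃ B : SobolevSpace 1 →L[ℝ] SobolevSpace 1,
      ‖B‖ ≤ 2 * (3 + besselSymbolNorm) * max ‖a.deriv‖ ‖b‖ ∧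
      ∀ u, transport a b (sqrtOneSub.toContinuousLinearEquiv.symm (incl u)) =
        incl (sqrtOneSub.toContinuousLinearEquiv.symm (transport a b u + B (incl u))) := by
  obtain ⟨B, norm_B_le, hconj⟩ := exists_conjugation_firstOrder (incl a) b
  refine ⟨B, norm_B_le.trans ?_, hconj⟩
  have norm_deriv_a_le : ‖(incl a).deriv‖ ≤ max ‖a.deriv‖ ‖b‖ := by
    rw [deriv_incl]
    exact (norm_incl_le _).trans (le_max_left _ _)
  have norm_deriv_b_le : ‖b.deriv‖ ≤ max ‖a.deriv‖ ‖b‖ :=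
    (norm_deriv_le b).trans (le_max_right _ _)
  rw [mul_comm 2, mul_assoc, two_mul]
  have := besselSymbolNorm_nonneg
  gcongr

theorem denseRange_incl : DenseRange (incl : SobolevSpace 2 →L[ℝ] SobolevSpace 1) :=
  denseRange_of_symmetric (Q := sqrtOneSub.toContinuousLinearEquiv) incl_injective
    inner_incl_besselUp

theorem isQuasiSkewAdjoint_transport :
    IsQuasiSkewAdjoint (graphClosure incl (transport a b)) (2 * ‖a‖ + 3 * ‖b‖) := by
  obtain ⟨B, -, hconj⟩ := exists_conjugation_transport a b
  exact isQuasiSkewAdjoint_graphClosure (Q := sqrtOneSub.toContinuousLinearEquiv) (B := B)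
    (T := transport a b) incl_injective inner_incl_besselUp hconj (by positivity)
    (abs_inner_transport_le a b)

end SobolevSpace

open SobolevSpace

namespace IsFirstOrderGenerator

variable {a : SobolevSpace 3} {b : SobolevSpace 2} {G : SobolevSpace 1 →ₗ.[ℝ] SobolevSpace 1}

theorem graph_eq (h : IsFirstOrderGenerator a b G) :
    G.graph = graphClosure incl (transport a b) := by
  obtain ⟨⟨U, hU, hG⟩, hext⟩ := h
  refine (isQuasiSkewAdjoint_transport a b).graph_eq_of_le hU hG ?_
  have hgraph := hU.isGeneratorOfGroup_iff.1 hG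
  refine fun p hp => (hgraph p.1 p.2).2
    (graphClosure_subset hU.isClosed_setOf_hasDerivAt (fun u => ?_) hp)
  obtain ⟨f, hf, hfe⟩ := hext u
  exact (hgraph _ _).1 (eq_transport_of_ae_eq a b hfe ▸ hf)

theorem of_graph_eq (h : G.graph = graphClosure incl (transport a b)) :
    IsFirstOrderGenerator a b G := by
  obtain ⟨U, hU, hG, -⟩ := (isQuasiSkewAdjoint_transport a b).exists_isGeneratorOfGroup h
  exact ⟨⟨U, hU, hG⟩, fun u => ⟨_, h ▸ mk_mem_graphClosure _ _ u, coeFn_transport a b u⟩⟩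

theorem exists_isC0Group (h : IsFirstOrderGenerator a b G) :
    ∃ U : ℝ → SobolevSpace 1 →L[ℝ] SobolevSpace 1, IsC0Group U ∧ IsGeneratorOfGroup G U ∧
      ∀ t, ‖U t‖ ≤ Real.exp (2 * (2 * ‖a‖ + 3 * ‖b‖) * |t|) :=
  (isQuasiSkewAdjoint_transport a b).exists_isGeneratorOfGroup h.graph_eq

theorem exists_conjugationIdentity (h : IsFirstOrderGenerator a b G) :
    ∃ B : SobolevSpace 1 →L[ℝ] SobolevSpace 1,
      ConjugationIdentity incl sqrtOneSub.toContinuousLinearEquiv G B ∧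
        ‖B‖ ≤ 2 * (3 + besselSymbolNorm) * max ‖a.deriv‖ ‖b‖ := by
  obtain ⟨B, norm_B_le, hconj⟩ := exists_conjugation_transport a b
  exact ⟨B, conjugationIdentity_of_graph_eq incl_injective hconj
    (isQuasiSkewAdjoint_transport a b) h.graph_eq, norm_B_le⟩

theorem transport_mem_graph (h : IsFirstOrderGenerator a b G) (u : SobolevSpace 2) :
    (incl u, transport a b u) ∈ G.graph :=
  h.graph_eq ▸ mk_mem_graphClosure _ _ u

theorem eq_transport (h : IsFirstOrderGenerator a b G) {u : SobolevSpace 2} {f : SobolevSpace 1}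
    (hf : (incl u, f) ∈ G.graph) : f = transport a b u :=
  G.mem_graph_snd_inj hf (h.transport_mem_graph u) rfl

end IsFirstOrderGenerator

theorem existsUnique_isFirstOrderGenerator (a : SobolevSpace 3) (b : SobolevSpace 2) :
    ∃! G, IsFirstOrderGenerator a b G := by
  obtain ⟨G, hG⟩ := (isQuasiSkewAdjoint_transport a b).exists_graph_eq
  exact ⟨G, .of_graph_eq hG, fun G' hG' => LinearPMap.eq_of_eq_graph (hG'.graph_eq.trans hG.symm)⟩

section Kato

variable {a : SobolevSpace 1 → SobolevSpace 3} {b : SobolevSpace 1 → SobolevSpace 2}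
  {A : SobolevSpace 1 → SobolevSpace 1 →ₗ.[ℝ] SobolevSpace 1}

theorem exists_semigroup_norm_le (hA : ∀ y, IsFirstOrderGenerator (a y) (b y) (A y)) {R Ma Mb : ℝ}
    (hMa : ∀ y, ‖y‖ ≤ R → ‖a y‖ ≤ Ma) (hMb : ∀ y, ‖y‖ ≤ R → ‖b y‖ ≤ Mb) :
    ∃ S : SobolevSpace 1 → ℝ → SobolevSpace 1 →L[ℝ] SobolevSpace 1,
      (∀ y, IsC0Semigroup (S y) ∧ IsGeneratorOfSemigroup (-A y) (S y)) ∧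
      ∀ y, ‖y‖ ≤ R → ∀ s, 0 ≤ s → ‖S y s‖ ≤ Real.exp (2 * (2 * Ma + 3 * Mb) * s) := by
  choose U hU hG norm_U_le using fun y => (hA y).exists_isC0Group
  refine ⟨fun y s => U y (-s), fun y =>
    ⟨(hU y).comp_neg.isC0Semigroup, (hG y).neg_isGeneratorOfSemigroup (hU y)⟩,
    fun y hy s hs => (norm_U_le y (-s)).trans ?_⟩
  rw [abs_neg, abs_of_nonneg hs]
  gcongr
  exacts [hMa y hy, hMb y hy]

theorem norm_apply_sub_apply_le (hA : ∀ y, IsFirstOrderGenerator (a y) (b y) (A y))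
    {s : Set (SobolevSpace 1)} {La Lb : NNReal} (ha : LipschitzOnWith La a s)
    (hb : LipschitzOnWith Lb b s) {y₁ y₂ f₁ f₂ : SobolevSpace 1} (hy₁ : y₁ ∈ s) (hy₂ : y₂ ∈ s)
    {u : SobolevSpace 2} (hf₁ : (incl u, f₁) ∈ (A y₁).graph) (hf₂ : (incl u, f₂) ∈ (A y₂).graph) :
    ‖f₁ - f₂‖ ≤ 3 * (La + Lb) * ‖y₁ - y₂‖ * ‖u‖ := by
  rw [(hA y₁).eq_transport hf₁, (hA y₂).eq_transport hf₂]
  refine (norm_transport_sub_le _ _ _ _ u).trans ?_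
  gcongr ?_ * _
  linarith [ha.norm_sub_le hy₁ hy₂, hb.norm_sub_le hy₁ hy₂]

theorem exists_norm_le_of_lipschitzOnWith_closedBall {E F : Type*} [SeminormedAddCommGroup E]
    [SeminormedAddCommGroup F] {f : E → F} {L : NNReal} {R : ℝ}
    (hf : LipschitzOnWith L f (Metric.closedBall 0 R)) : ∃ M, ∀ y, ‖y‖ ≤ R → ‖f y‖ ≤ M := by
  refine ⟨‖f 0‖ + L * R, fun y hy => (norm_le_norm_add_norm_sub' (f y) (f 0)).trans ?_⟩
  have hzero : (0 : E) ∈ Metric.closedBall 0 R :=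
    Metric.mem_closedBall_self ((norm_nonneg y).trans hy)
  gcongr
  refine (hf.norm_sub_le (mem_closedBall_zero_iff.2 hy) hzero).trans ?_
  rw [sub_zero]
  gcongr

theorem katoCondition_of_isFirstOrderGenerator
    (hA : ∀ y, IsFirstOrderGenerator (a y) (b y) (A y))
    {B : SobolevSpace 1 → SobolevSpace 1 →L[ℝ] SobolevSpace 1}
    (hconj : ∀ y, ConjugationIdentity incl sqrtOneSub.toContinuousLinearEquiv (A y) (B y))
    {K : ℝ} (hK : 0 ≤ K) (norm_B_le : ∀ y, ‖B y‖ ≤ K * max ‖(a y).deriv‖ ‖b y‖)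
    {R : ℝ} {La Lb : NNReal} (ha : LipschitzOnWith La a (Metric.closedBall 0 R))
    (hb : LipschitzOnWith Lb b (Metric.closedBall 0 R)) (I : Set ℝ) :
    KatoCondition incl I R (fun _ v => A (incl v)) sqrtOneSub.toContinuousLinearEquiv
      (fun _ v => B (incl v)) := by
  obtain ⟨Ma, hMa⟩ := exists_norm_le_of_lipschitzOnWith_closedBall ha
  obtain ⟨Mb, hMb⟩ := exists_norm_le_of_lipschitzOnWith_closedBall hb
  have norm_incl_le_R {v : SobolevSpace 2} (hv : ‖v‖ ≤ R) : ‖incl v‖ ≤ R :=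
    (norm_incl_le v).trans hv
  exact
    { injective := incl_injective
      denseRange := denseRange_incl
      generates := by
        obtain ⟨S, hS, norm_S_le⟩ := exists_semigroup_norm_le hA hMa hMb
        exact ⟨fun _ v => S (incl v), fun _ _ v => hS _, _,
          fun _ _ v hv => norm_S_le _ (norm_incl_le_R hv)⟩
      conjugation := fun _ _ _ => hconj _
      stronglyMeasurable := fun _ => stronglyMeasurable_const
      bounded := by
        refine ⟨K * max Ma Mb, fun _ _ v hv => (norm_B_le _).trans ?_⟩
        gcongr
        exacts [(norm_deriv_le _).trans (hMa _ (norm_incl_le_R hv)), hMb _ (norm_incl_le_R hv)]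
      continuous := fun v => ⟨fun _ => transport (a (incl v)) (b (incl v)),
        fun _ _ u => (hA _).transport_mem_graph u, continuousOn_const⟩
      lipschitz := ⟨3 * (La + Lb), fun _ _ u v₁ v₂ hv₁ hv₂ f₁ f₂ hf₁ hf₂ =>
        norm_apply_sub_apply_le hA ha hb (mem_closedBall_zero_iff.2 (norm_incl_le_R hv₁))
          (mem_closedBall_zero_iff.2 (norm_incl_le_R hv₂)) hf₁ hf₂⟩ }

end Kato

theorem mainTheorem5_general :
    ∃ Q : SobolevSpace 2 ≃ₗᵢ[ℝ] SobolevSpace 1, IsSqrtOneSubDerivSq Q ∧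
    ∃ K : ℝ, 0 < K ∧
    ∀ (a : SobolevSpace 1 → SobolevSpace 3) (b : SobolevSpace 1 → SobolevSpace 2),
      (∀ r, ∃ L, LipschitzOnWith L a (Metric.closedBall 0 r)) →
      (∀ r, ∃ L, LipschitzOnWith L b (Metric.closedBall 0 r)) →
      (∀ y, ∃! G, IsFirstOrderGenerator (a y) (b y) G) ∧
      ∀ A : SobolevSpace 1 → SobolevSpace 1 →ₗ.[ℝ] SobolevSpace 1,
        (∀ y, IsFirstOrderGenerator (a y) (b y) (A y)) →
        ∃ B : SobolevSpace 1 → SobolevSpace 1 →L[ℝ] SobolevSpace 1,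
          (∀ y, ConjugationIdentity incl Q.toContinuousLinearEquiv (A y) (B y) ∧
            ‖B y‖ ≤ K * max ‖(a y).deriv‖ ‖b y‖) ∧
          ∀ (R : ℝ) (I : Set ℝ), KatoCondition incl I R (fun _ v => A (incl v))
            Q.toContinuousLinearEquiv (fun _ v => B (incl v)) := by
  have hK : 0 < 2 * (3 + besselSymbolNorm) := by linarith [besselSymbolNorm_nonneg]
  refine ⟨sqrtOneSub, isSqrtOneSubDerivSq_sqrtOneSub, _, hK, fun a b ha hb =>
    ⟨fun y => existsUnique_isFirstOrderGenerator (a y) (b y), fun A hA => ?_⟩⟩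
  choose B hconj norm_B_le using fun y => (hA y).exists_conjugationIdentity
  refine ⟨B, fun y => ⟨hconj y, norm_B_le y⟩, fun R I => ?_⟩
  obtain ⟨La, ha⟩ := ha R
  obtain ⟨Lb, hb⟩ := hb R
  exact katoCondition_of_isFirstOrderGenerator hA hconj hK.le norm_B_le ha hb I

end

theorem mainTheorem5 :
    ∃ Q : SobolevSpace 2 ≃ₗᵢ[ℝ] SobolevSpace 1, IsSqrtOneSubDerivSq Q ∧
    ∃ K : ℝ, 0 < K ∧
    ∀ (a : SobolevSpace 1 → SobolevSpace 3) (b : SobolevSpace 1 → SobolevSpace 2),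
      (∃ L, LipschitzWith L a) → (∃ L, LipschitzWith L b) →
      (∃ M : ℝ, ∀ y, ‖a y‖ ≤ M) → (∃ M : ℝ, ∀ y, ‖b y‖ ≤ M) →
      (∀ y, ∃! G, IsFirstOrderGenerator (a y) (b y) G) ∧
      ∀ A : SobolevSpace 1 → SobolevSpace 1 →ₗ.[ℝ] SobolevSpace 1,
        (∀ y, IsFirstOrderGenerator (a y) (b y) (A y)) →
        ∃ B : SobolevSpace 1 → SobolevSpace 1 →L[ℝ] SobolevSpace 1,
          (∀ y, ConjugationIdentity SobolevSpace.incl Q.toContinuousLinearEquiv (A y) (B y) ∧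
            ‖B y‖ ≤ K * max ‖(a y).deriv‖ ‖b y‖) ∧
          ∀ R > 0, ∀ τ > 0,
            KatoCondition SobolevSpace.incl (Set.Icc (-τ) τ) R
              (fun _ v => A (SobolevSpace.incl v)) Q.toContinuousLinearEquiv
              (fun _ v => B (SobolevSpace.incl v)) := by
  obtain ⟨Q, hQ, K, hK, general⟩ := mainTheorem5_general
  refine ⟨Q, hQ, K, hK, fun a b ⟨La, ha⟩ ⟨Lb, hb⟩ _ _ => ?_⟩
  obtain ⟨hunique, hkato⟩ :=
    general a b (fun _ => ⟨La, ha.lipschitzOnWith⟩) (fun _ => ⟨Lb, hb.lipschitzOnWith⟩)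
  refine ⟨hunique, fun A hA => ?_⟩
  obtain ⟨B, hB, hfamily⟩ := hkato A hA
  exact ⟨B, hB, fun R _ τ _ => hfamily R _⟩
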